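/- Let $m,n\ge 1$, $0<\gamma<mn$, $1\le\theta<p_j\le\alpha_j<s_j\le\infty$ $(j=1,\dots,m)$, and set $\frac1{q_j}=\frac1{p_j}-\frac{\gamma}{mn}$, $\frac1p=\sum_j\frac1{p_j}$, $\frac1q=\sum_j\frac1{q_j}$, $\frac1s=\sum_j\frac1{s_j}$, $\frac1\alpha=\sum_j\frac1{\alpha_j}$, $\frac1{\alpha^*}=\frac1\alpha-\frac\gamma n$, where $0<q_j<\infty$, $0<\alpha^*<s$ and $\frac{\alpha}{\alpha_j}=\frac{p}{p_j}=\frac{s}{s_j}$ for all $j$ (the last equality meaning $\frac1{s_j}=\frac{\alpha}{\alpha_j}\cdot\frac1s$). Let $\omega_1,\dots,\omega_m$ be weights on $\mathbb R^n$ (nonnegative, a.e. positive, locally integrable functions) with $\omega_j^{p_j}\in A_\infty$ for all $j$. Put $\nu_{\vec\omega}=\prod_j\omega_j$ and suppose $\vec\omega^{\,\theta}=(\omega_1^\theta,\dots,\omega_m^\theta)\in A_{\vec P/\theta,\,q/\theta}$, i.e. with $r_j=p_j/\theta$, $r_j'=r_j/(r_j-1)$, $$\sup_B\Big(\frac1{|B|}\int_B\nu_{\vec\omega}^{\,q}\Big)^{\theta/q}\prod_{j=1}^m\Big(\frac1{|B|}\int_B\omega_j^{-\theta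 r_j'}\Big)^{1/r_j'}<\infty .$$ Let $\mathcal T_\gamma$ be an $m$-linear operator, bounded from $L^{p_1}(\omega_1^{p_1})\times\cdots\times L^{p_m}(\omega_m^{p_m})$ to $L^q(\nu_{\vec\omega}^{\,q})$, for which there is a constant $C$ such that for all $f_j\in L^{p_j}(\omega_j^{p_j})$, every nonempty $\sigma\subset\{1,\dots,m\}$, every ball $B$ and a.e. $x\in B$, $$|\mathcal T_\gamma(\vec f^{D})(x)|\le C\prod_{j\in\sigma^c}\Big(\frac1{|2B|^{1-\gamma\theta/(mn)}}\int_{2B}|f_j|^\theta\Big)^{1/\theta}\prod_{j\in\sigma}\sum_{k=1}^\infty\frac{k}{2^{kn|\varrho|}}\Big(\frac1{|2^{k+1}B|^{1-\gamma\theta/(mn)}}\int_{2^{k+1}B\setminus2^kB}|f_j|^\theta\Big)^{1/\theta},$$ where $|\varrho|=|\sigma^c|\,(1-\gamma/(mn))$ and $\vec f^D$ has $j$-th entry $f_j\chi_{\mathbb R^n\setminus 2B}$ if $j\in\sigma$ and $f_j\chi_{2B}$ if $j\in\sigma^c$. Let $b_1,\dots,b_m\in BMO(\mathbb R^n)$,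 and let $[b,S]_j(\vec f)=b\,S(\vec f)-S(f_1,\dots,bf_j,\dots,f_m)$, $$\mathcal T_{\gamma,\Sigma\vec b}=\sum_{j=1}^m[b_j,\mathcal T_\gamma]_j,\qquad \mathcal T_{\gamma,\Pi\vec b}=[b_1,[b_2,\cdots[b_m,\mathcal T_\gamma]_m\cdots]_2]_1 .$$ For $0<a\le\beta\le t\le\infty$ let $(L^a,L^t)^\beta$ be the amalgam space of measurable $f$ on $\mathbb R^n$ with $$\|f\|_{(L^a,L^t)^\beta}=\sup_{r>0}\Big\|\,|B(y,r)|^{\frac1\beta-\frac1a-\frac1t}\,\|f\chi_{B(y,r)}\|_{L^a}\Big\|_{L^t(dy)}<\infty .$$ Then $\mathcal T_{\gamma,\Sigma\vec b}$ and $\mathcal T_{\gamma,\Pi\vec b}$ are bounded from $(L^{p_1},L^{s_1})^{\alpha_1}\times\cdots\times(L^{p_m},L^{s_m})^{\alpha_m}$ to $(L^q,L^s)^{\alpha^*}$: for each of these two operators $S$ there is $C<\infty$ such that for all $f_j\in(L^{p_j},L^{s_j})^{\alpha_j}$ the value $S(\vec f)=\lim_{N\to\infty}S\big(f_1\chi_{\{|x|\le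 N,\,|f_1|\le N\}},\dots,f_m\chi_{\{|x|\le N,\,|f_m|\le N\}}\big)$ exists a.e., and $$\|S(\vec f)\|_{(L^q,L^s)^{\alpha^*}}\le C\prod_{j=1}^m\|f_j\|_{(L^{p_j},L^{s_j})^{\alpha_j}} .$$ -/

import Mathlib

open MeasureTheory Filter Topology
open scoped ENNReal

noncomputable section

namespace FracAmalgam

/-- Euclidean space `ℝⁿ`. -/
abbrev Rn (n : ℕ) : Type := EuclideanSpace ℝ (Fin n)

/-! ### Weights -/

/-- A weight: nonnegative, locally integrable, almost everywhere positive. -/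
def IsWeight {n : ℕ} (w : Rn n → ℝ) : Prop :=
  (∀ x, 0 ≤ w x) ∧ (∀ᵐ x, 0 < w x) ∧ LocallyIntegrable w volume

/-- The Muckenhoupt class `A_p`, `1 ≤ p < ∞`. -/
def MuckenhouptA {n : ℕ} (p : ℝ) (w : Rn n → ℝ) : Prop :=
  IsWeight w ∧ 1 ≤ p ∧ ∃ C : ℝ≥0∞, C < ∞ ∧ ∀ (y : Rn n) (r : ℝ), 0 < r →
    if p = 1 then
      ∀ᵐ x ∂(volume.restrict (Metric.ball y r)),
        (⨍⁻ z in Metric.ball y r, ENNReal.ofReal (w z) ∂volume) ≤ C * ENNReal.ofReal (w x)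
    else
      (⨍⁻ z in Metric.ball y r, ENNReal.ofReal (w z) ∂volume) ^ (1 / p) *
        (⨍⁻ z in Metric.ball y r,
          ENNReal.ofReal (w z) ^ (1 - p.conjExponent) ∂volume) ^ (1 / p.conjExponent) ≤ C

/-- `A_∞ = ⋃_{1 ≤ p < ∞} A_p`. -/
def MuckenhouptAInfty {n : ℕ} (w : Rn n → ℝ) : Prop :=
  ∃ p : ℝ, MuckenhouptA p w

/-- The product weight `ν_ω = ∏ ω_j`. -/
def prodWeight {n m : ℕ} (ω : Fin m → Rn n → ℝ) (x : Rn n) : ℝ := ∏ j, ω j x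

/-- The factor `(|B|⁻¹ ∫_B w^{-p'})^{1/p'}`, read as `(ess inf_B w)⁻¹` when `p = 1`. -/
def dualFactor {n : ℕ} (p : ℝ) (w : Rn n → ℝ) (B : Set (Rn n)) : ℝ≥0∞ :=
  if p = 1 then (essInf (fun x => ENNReal.ofReal (w x)) (volume.restrict B))⁻¹
  else (⨍⁻ z in B, ENNReal.ofReal (w z) ^ (-p.conjExponent) ∂volume) ^ (1 / p.conjExponent)

/-- The multiple weight class `A_{P,q}` for `P = (p_1, …, p_m)`. -/
def MultiAPq {n m : ℕ} (P : Fin m → ℝ) (q : ℝ) (ω : Fin m → Rn n → ℝ) : Prop :=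
  (∀ j, IsWeight (ω j)) ∧ ∃ C : ℝ≥0∞, C < ∞ ∧ ∀ (y : Rn n) (r : ℝ), 0 < r →
    (⨍⁻ x in Metric.ball y r, ENNReal.ofReal (prodWeight ω x) ^ q ∂volume) ^ (1 / q) *
      ∏ j, dualFactor (P j) (ω j) (Metric.ball y r) ≤ C

/-- The measure `w(x) dx`. -/
def weightMeasure {n : ℕ} (w : Rn n → ℝ) : Measure (Rn n) :=
  volume.withDensity fun x => ENNReal.ofReal (w x)

/-! ### BMO and amalgam spaces -/

/-- Functions of bounded mean oscillation. -/
def IsBMO {n : ℕ} {𝕜 : Type*} [RCLike 𝕜] (b : Rn n → 𝕜) : Prop :=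
  LocallyIntegrable b volume ∧ ∃ C : ℝ, ∀ (y : Rn n) (r : ℝ), 0 < r →
    (⨍ x in Metric.ball y r, ‖b x - ⨍ z in Metric.ball y r, b z ∂volume‖ ∂volume) ≤ C

/-- The quasi-norm at scale `r` of the amalgam space `(L^q, L^p)^α`: the `L^p(dy)` quasi-norm of
`|B(y,r)|^{1/α - 1/q - 1/p} ‖f χ_{B(y,r)}‖_{L^q}` (with `1/∞ = 0`; `p = ∞` is the essential
supremum). -/
def amalgamNormAt {n : ℕ} {𝕜 : Type*} [RCLike 𝕜] (q : ℝ) (p : ℝ≥0∞) (α r : ℝ)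
    (f : Rn n → 𝕜) : ℝ≥0∞ :=
  eLpNorm (fun y : Rn n =>
    volume (Metric.ball y r) ^ (1 / α - 1 / q - p⁻¹.toReal) *
      eLpNorm ((Metric.ball y r).indicator f) (ENNReal.ofReal q) volume) p volume

/-- The quasi-norm of `(L^q, L^p)^α`, the supremum over all scales. -/
def amalgamNorm {n : ℕ} {𝕜 : Type*} [RCLike 𝕜] (q : ℝ) (p : ℝ≥0∞) (α : ℝ)
    (f : Rn n → 𝕜) : ℝ≥0∞ :=
  ⨆ (r : ℝ) (_ : 0 < r), amalgamNormAt q p α r f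

/-- Membership in the amalgam space `(L^q, L^p)^α`. -/
def MemAmalgam {n : ℕ} {𝕜 : Type*} [RCLike 𝕜] (q : ℝ) (p : ℝ≥0∞) (α : ℝ)
    (f : Rn n → 𝕜) : Prop :=
  AEStronglyMeasurable f volume ∧ amalgamNorm q p α f < ∞

/-! ### Multilinear operators on products of weighted Lebesgue spaces -/

/-- `f_j ∈ L^{p_j}(ω_j^{p_j})` for all `j`. -/
def MemProdLp {n m : ℕ} {𝕜 : Type*} [RCLike 𝕜] (p : Fin m → ℝ) (ω : Fin m → Rn n → ℝ)
    (f : Fin m → Rn n → 𝕜) : Prop :=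
  ∀ j, MemLp (f j) (ENNReal.ofReal (p j)) (weightMeasure fun x => ω j x ^ p j)

/-- `T` is `m`-linear (up to null sets) on `L^{p_1}(ω_1^{p_1}) × ⋯ × L^{p_m}(ω_m^{p_m})`. -/
def IsMultilinearOp {n m : ℕ} {𝕜 : Type*} [RCLike 𝕜] (p : Fin m → ℝ) (ω : Fin m → Rn n → ℝ)
    (T : (Fin m → Rn n → 𝕜) → Rn n → 𝕜) : Prop :=
  (∀ (f : Fin m → Rn n → 𝕜) (j : Fin m) (g : Rn n → 𝕜), MemProdLp p ω f →
      MemProdLp p ω (Function.update f j g) →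
      T (Function.update f j (f j + g)) =ᵐ[volume] T f + T (Function.update f j g)) ∧
  (∀ (f : Fin m → Rn n → 𝕜) (j : Fin m) (c : 𝕜), MemProdLp p ω f →
      T (Function.update f j (c • f j)) =ᵐ[volume] c • T f)

/-- `T` is bounded from `L^{p_1}(ω_1^{p_1}) × ⋯ × L^{p_m}(ω_m^{p_m})` to `L^q(ν_ω^q)`. -/
def BoundedOnLp {n m : ℕ} {𝕜 : Type*} [RCLike 𝕜] (p : Fin m → ℝ) (q : ℝ)
    (ω : Fin m → Rn n → ℝ) (T : (Fin m → Rn n → 𝕜) → Rn n → 𝕜) : Prop :=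
  ∃ C : ℝ≥0∞, C < ∞ ∧ ∀ f : Fin m → Rn n → 𝕜, MemProdLp p ω f →
    MemLp (T f) (ENNReal.ofReal q) (weightMeasure fun x => prodWeight ω x ^ q) ∧
    eLpNorm (T f) (ENNReal.ofReal q) (weightMeasure fun x => prodWeight ω x ^ q) ≤
      C * ∏ j, eLpNorm (f j) (ENNReal.ofReal (p j)) (weightMeasure fun x => ω j x ^ p j)

/-- The tuple `f^D`: `f_j` is restricted to the complement of `A` for `j ∈ σ`, and to `A` for
`j ∉ σ`. -/
def splitTuple {n m : ℕ} {𝕜 : Type*} [RCLike 𝕜] (σ : Finset (Fin m)) (A : Set (Rn n))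
    (f : Fin m → Rn n → 𝕜) : Fin m → Rn n → 𝕜 :=
  fun j => if j ∈ σ then Aᶜ.indicator (f j) else A.indicator (f j)

/-- `(|A|^{-(1 - γθ/(mn))} ∫_S |f|^θ)^{1/θ}`. -/
def fracAvg {n : ℕ} {𝕜 : Type*} [RCLike 𝕜] (m : ℕ) (γ θ : ℝ) (A S : Set (Rn n))
    (f : Rn n → 𝕜) : ℝ≥0∞ :=
  ((volume A ^ (1 - γ * θ / (m * n : ℝ)))⁻¹ * ∫⁻ z in S, ‖f z‖ₑ ^ θ) ^ (1 / θ)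

/-- The pointwise size condition on `T_γ`: for `B = B(y,r)`, nonempty `σ` and a.e. `x ∈ B`,
`|T(f^D)(x)| ≤ C ∏_{j ∉ σ} (|2B|^{-(1-γθ/mn)} ∫_{2B} |f_j|^θ)^{1/θ}
  × ∏_{j ∈ σ} ∑_{k ≥ 1} k 2^{-kn|ϱ|} (|2^{k+1}B|^{-(1-γθ/mn)} ∫_{2^{k+1}B∖2^kB} |f_j|^θ)^{1/θ}`,
with `|ϱ| = |σᶜ| (1 - γ/(mn))`. The sum over `k ≥ 1` is indexed by `i` with `k = i + 1`. -/
def FracSizeCondition {n m : ℕ} {𝕜 : Type*} [RCLike 𝕜] (γ θ : ℝ) (p : Fin m → ℝ)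
    (ω : Fin m → Rn n → ℝ) (T : (Fin m → Rn n → 𝕜) → Rn n → 𝕜) : Prop :=
  ∃ C : ℝ≥0∞, C < ∞ ∧ ∀ f : Fin m → Rn n → 𝕜, MemProdLp p ω f →
    ∀ σ : Finset (Fin m), σ.Nonempty → ∀ (y : Rn n) (r : ℝ), 0 < r →
      ∀ᵐ x ∂(volume.restrict (Metric.ball y r)),
        ‖T (splitTuple σ (Metric.ball y (2 * r)) f) x‖ₑ ≤
          C * (∏ j ∈ σᶜ,
            fracAvg m γ θ (Metric.ball y (2 * r)) (Metric.ball y (2 * r)) (f j)) *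
          ∏ j ∈ σ, ∑' i : ℕ,
            ((i + 1 : ℕ) : ℝ≥0∞) *
            (2 : ℝ≥0∞) ^ (-(((i + 1 : ℕ) : ℝ) * n * (σᶜ.card * (1 - γ / (m * n : ℝ))))) *
            fracAvg m γ θ (Metric.ball y (2 ^ (i + 2) * r))
              (Metric.ball y (2 ^ (i + 2) * r) \ Metric.ball y (2 ^ (i + 1) * r)) (f j)

/-! ### Commutators -/

/-- `[b, T]_j (f) = b T(f) - T(f_1, …, b f_j, …, f_m)`. -/
def commAt {n m : ℕ} {𝕜 : Type*} [RCLike 𝕜] (j : Fin m) (b : Rn n → 𝕜)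
    (T : (Fin m → Rn n → 𝕜) → Rn n → 𝕜) : (Fin m → Rn n → 𝕜) → Rn n → 𝕜 :=
  fun f x => b x * T f x - T (Function.update f j fun z => b z * f j z) x

/-- The multilinear commutator `T_{Σb} = ∑_j [b_j, T]_j`. -/
def sumComm {n m : ℕ} {𝕜 : Type*} [RCLike 𝕜] (b : Fin m → Rn n → 𝕜)
    (T : (Fin m → Rn n → 𝕜) → Rn n → 𝕜) : (Fin m → Rn n → 𝕜) → Rn n → 𝕜 :=
  fun f x => ∑ j, commAt j (b j) T f x

/-- The iterated commutator `T_{Πb} = [b_1, [b_2, ⋯ [b_m, T]_m ⋯ ]_2]_1`. -/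
def iterComm {n m : ℕ} {𝕜 : Type*} [RCLike 𝕜] (b : Fin m → Rn n → 𝕜)
    (T : (Fin m → Rn n → 𝕜) → Rn n → 𝕜) : (Fin m → Rn n → 𝕜) → Rn n → 𝕜 :=
  (List.finRange m).foldr (fun j S => commAt j (b j) S) T

/-! ### Boundedness on amalgam spaces -/

open Classical in
/-- The bounded, boundedly supported truncation `f χ_{|x| ≤ N, |f(x)| ≤ N}`. -/
def trunc {n : ℕ} {𝕜 : Type*} [RCLike 𝕜] (N : ℕ) (f : Rn n → 𝕜) : Rn n → 𝕜 :=
  fun x => if ‖x‖ ≤ N ∧ ‖f x‖ ≤ N then f x else 0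

/-- `g` is the value `S(f)`, where an operator `S`, defined on bounded functions of bounded
support, is extended by passing to the a.e. limit along truncations of `f_1, …, f_m`. Such a `g`
is unique up to null sets. -/
def HasValue {n m : ℕ} {𝕜 : Type*} [RCLike 𝕜] (S : (Fin m → Rn n → 𝕜) → Rn n → 𝕜)
    (f : Fin m → Rn n → 𝕜) (g : Rn n → 𝕜) : Prop :=
  ∀ᵐ x, Tendsto (fun N : ℕ => S (fun j => trunc N (f j)) x) atTop (𝓝 (g x))

/-- `S` is (defined and) bounded from `(L^{p_1}, L^{s_1})^{α_1} × ⋯ × (L^{p_m}, L^{s_m})^{α_m}` to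
`(L^q, L^t)^β`. -/
def BoundedOnAmalgam {n m : ℕ} {𝕜 : Type*} [RCLike 𝕜] (p : Fin m → ℝ) (s : Fin m → ℝ≥0∞)
    (α : Fin m → ℝ) (q : ℝ) (t : ℝ≥0∞) (β : ℝ)
    (S : (Fin m → Rn n → 𝕜) → Rn n → 𝕜) : Prop :=
  ∃ C : ℝ≥0∞, C < ∞ ∧ ∀ f : Fin m → Rn n → 𝕜, (∀ j, MemAmalgam (p j) (s j) (α j) (f j)) →
    ∃ g : Rn n → 𝕜, HasValue S f g ∧ MemAmalgam q t β g ∧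
      amalgamNorm q t β g ≤ C * ∏ j, amalgamNorm (p j) (s j) (α j) (f j)

end FracAmalgam

end

/-! The operator is dominated pointwise by a positive operator that involves no weights. Write
F_r(x) = r^γ ∏_j (|B|⁻¹ ∫_B |f_j|^θ)^{1/θ} with B = B(x,r); this is `fracTerm`. When a ball of
radius ρ is doubled, multilinearity writes the change of T(f χ_B) as a sum over nonempty σ of terms
covered by the size condition. The entries vanish outside the doubled ball, so only the first
annulus contributes and the change is at most C F_{4ρ} (`exists_enorm_sub_le_fracTerm`). Telescoping
over radii leaves T(f χ_B) with B small. Here 1/q = 1/p - γ/n forces q > p, and the assumed Lebesgue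
bound gives Σ_B ∫ |T(f χ_B)|^q ν^q ≤ C Σ_B κ(B)^{q/p} with one finite measure κ ≪ dx. Over coverings
by shrinking balls of bounded overlap this sum tends to 0. Hence |T f| ≤ C Σ_K F_{t 2^K} almost
everywhere, for every t > 0 (`exists_enorm_le_tsum_fracTerm`).

A commutator is a polynomial in the values b_j(x). With these values replaced by scalars a_j it
equals T applied to the tuple with entries (a_j - b_j) f_j, to which the domination applies.
Hölder's inequality trades a - b for an oscillation of b at the price of raising θ to some τ_j <
p_j; then a tends to b(x) through a countable dense set (`exists_enorm_commOn_le`). The result is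
the operator `fracSum`, a sum over scales of oscillations times fractional averages. The products
b_j f_j are admissible entries of T for bounded f_j of bounded support because b_j lies locally in
every L^u(w) when w is in A_∞, by the John–Nirenberg inequality with respect to w.

It remains to study `fracSum` with respect to Lebesgue measure. On products of Lebesgue spaces it is
controlled by Hedberg's inequality and the maximal theorem; the oscillations are averaged out at
each scale, where the fractional average is essentially constant (`lintegral_fracSum_rpow_le`). For
the amalgam norm at scale r take t = r. Scales up to r see only the data near B(y,r), so the
Lebesgue bound applies. The scale 2^k r contributes norms over B(y, 2^{k+1} r), whose coefficients
decay geometrically because α* < s, while the oscillations grow only polynomially in k. Hölder's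
inequality in y with proportional exponents finishes the estimate (`eLpNorm_ballNorm_fracSum_le`).

Finally, finiteness of `fracSum` almost everywhere makes the values along truncations a Cauchy
sequence, by dominated convergence, and the pointwise bound passes to the limit
(`IsDominated.exists_limit`). -/

noncomputable section

namespace FracAmalgam

/-! ### Series in `ℝ≥0∞` -/

/-- If S is the weighted sum on the right, then each `G k` is at most S^{1/a} 2^{-δk/a}, and a
geometric series remains. The argument makes no distinction between a ≥ 1 and a < 1, so it replaces
the triangle inequality for quasi-norms at the price of the factor 2^{δk}. -/
theorem tsum_rpow_le {a δ : ℝ} (ha : 0 < a) (hδ : 0 < δ) :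
    ∃ C : ℝ≥0∞, C < ∞ ∧ ∀ G : ℕ → ℝ≥0∞,
      (∑' k, G k) ^ a ≤ C * ∑' k : ℕ, (2 : ℝ≥0∞) ^ (δ * k) * G k ^ a := by
  have h2 : ((2 : ℝ≥0∞) ^ (-(δ / a))) < 1 :=
    ENNReal.rpow_lt_one_of_one_lt_of_neg (by norm_num) (by simpa using div_pos hδ ha)
  refine ⟨((1 - (2 : ℝ≥0∞) ^ (-(δ / a)))⁻¹) ^ a, ?_, fun G => ?_⟩
  · refine ENNReal.rpow_lt_top_of_nonneg ha.le ?_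
    simpa [tsub_eq_zero_iff_le] using h2
  set S := ∑' k : ℕ, (2 : ℝ≥0∞) ^ (δ * k) * G k ^ a
  have hG : ∀ k, G k ≤ S ^ (1 / a) * ((2 : ℝ≥0∞) ^ (-(δ / a))) ^ k := by
    intro k
    have h1 : (2 : ℝ≥0∞) ^ (δ * k) * G k ^ a ≤ S := ENNReal.le_tsum k
    have h3 : ((2 : ℝ≥0∞) ^ (δ * k) * G k ^ a) ^ (1 / a) * ((2 : ℝ≥0∞) ^ (-(δ / a))) ^ k
        = G k := by
      rw [ENNReal.mul_rpow_of_nonneg _ _ (by positivity), ← ENNReal.rpow_mul, ← ENNReal.rpow_mul,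
        mul_one_div_cancel ha.ne', ENNReal.rpow_one, ← ENNReal.rpow_natCast, ← ENNReal.rpow_mul,
        mul_right_comm, ← ENNReal.rpow_add _ _ (by norm_num) (by norm_num)]
      have : δ * k * (1 / a) + -(δ / a) * k = 0 := by ring
      rw [this, ENNReal.rpow_zero, one_mul]
    calc G k = _ := h3.symm
      _ ≤ _ := by gcongr
  calc (∑' k, G k) ^ a ≤ (∑' k, S ^ (1 / a) * ((2 : ℝ≥0∞) ^ (-(δ / a))) ^ k) ^ a := by
        gcongr with k; exact hG k
    _ = _ := by
        rw [ENNReal.tsum_mul_left, ENNReal.tsum_geometric, ENNReal.mul_rpow_of_nonneg _ _ ha.le,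
          ← ENNReal.rpow_mul, one_div_mul_cancel ha.ne', ENNReal.rpow_one, mul_comm]

theorem tsum_two_rpow_lt_top {c : ℝ} (hc : c < 0) :
    ∑' k : ℕ, (2 : ℝ≥0∞) ^ (c * k) < ∞ := by
  have h2 : ((2 : ℝ≥0∞) ^ c) < 1 := ENNReal.rpow_lt_one_of_one_lt_of_neg (by norm_num) hc
  simp_rw [ENNReal.rpow_mul, ENNReal.rpow_natCast]
  rw [ENNReal.tsum_geometric]
  simpa [tsub_eq_zero_iff_le] using h2

theorem tsum_int_le (f : ℤ → ℝ≥0∞) :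
    ∑' j : ℤ, f j ≤ ∑' k : ℕ, f k + ∑' k : ℕ, f (-(k : ℤ)) := by
  have h := HasSum.of_nat_of_neg_add_one (f := f) (ENNReal.summable.hasSum)
    (ENNReal.summable.hasSum)
  rw [h.tsum_eq]
  refine add_le_add le_rfl ?_
  have := ENNReal.tsum_comp_le_tsum_of_injective (f := fun k : ℕ => k + 1)
    (add_left_injective 1) (fun k : ℕ => f (-(k : ℤ)))
  simpa using this

/-- Summation of a sequence which is dominated by a growing and by a decaying geometric sequence. -/
theorem tsum_min_rpow_le {a b : ℝ} (ha : 0 < a) (hb : 0 < b) :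
    ∃ C : ℝ≥0∞, C < ∞ ∧ ∀ t : ℝ, 0 < t → ∀ A B : ℝ≥0∞,
      ∑' K : ℤ, min (ENNReal.ofReal (t * 2 ^ K) ^ a * A) (ENNReal.ofReal (t * 2 ^ K) ^ (-b) * B)
        ≤ C * (A ^ (b / (a + b)) * B ^ (a / (a + b))) := by
  -- Profile of the terms around the crossover scale. The extra factor 2^b allows for `t * 2 ^ k₀`
  -- being up to a factor 2 below the crossover point.
  set c : ℤ → ℝ≥0∞ := fun j =>
    min ((2 : ℝ≥0∞) ^ (a * j)) ((2 : ℝ≥0∞) ^ (b - b * j)) with hc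
  have hab : 0 < a + b := by positivity
  -- The summand 1 makes the constant visibly nonzero, so that the right side is ∞ when one of A, B
  -- is infinite and the other nonzero.
  refine ⟨1 + ∑' j, c j, ?_, fun t ht A B => ?_⟩
  · refine ENNReal.add_lt_top.2 ⟨by simp, (tsum_int_le c).trans_lt (ENNReal.add_lt_top.2 ⟨?_, ?_⟩)⟩
    · calc ∑' k : ℕ, c k ≤ ∑' k : ℕ, (2 : ℝ≥0∞) ^ b * (2 : ℝ≥0∞) ^ ((-b) * k) := by
            gcongr with k
            rw [← ENNReal.rpow_add _ _ (by norm_num) (by norm_num)]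
            refine (min_le_right _ _).trans (le_of_eq ?_)
            congr 1; push_cast; ring
        _ < ∞ := by
            rw [ENNReal.tsum_mul_left]
            exact ENNReal.mul_lt_top (ENNReal.rpow_lt_top_of_nonneg hb.le (by norm_num))
              (tsum_two_rpow_lt_top (by linarith))
    · calc ∑' k : ℕ, c (-(k : ℤ)) ≤ ∑' k : ℕ, (2 : ℝ≥0∞) ^ ((-a) * k) := by
            gcongr with k
            refine (min_le_left _ _).trans (le_of_eq ?_)
            congr 1; push_cast; ring
        _ < ∞ := tsum_two_rpow_lt_top (by linarith)
  rcases eq_or_ne A 0 with rfl | hA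
  · simp
  rcases eq_or_ne B 0 with rfl | hB
  · simp
  have hC : (1 + ∑' j, c j) ≠ 0 := by simp
  have hb' : 0 < b / (a + b) := by positivity
  have ha' : 0 < a / (a + b) := by positivity
  rcases eq_or_ne A ∞ with rfl | hA'
  · have : B ^ (a / (a + b)) ≠ 0 := by simp [hB, ha'.le, ha']
    rw [ENNReal.top_rpow_of_pos hb', ENNReal.top_mul this, ENNReal.mul_top hC]
    exact le_top
  rcases eq_or_ne B ∞ with rfl | hB'
  · have : A ^ (b / (a + b)) ≠ 0 := by simp [hA, hb'.le, hb']
    rw [ENNReal.top_rpow_of_pos ha', ENNReal.mul_top this, ENNReal.mul_top hC]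
    exact le_top
  set A' := A.toReal
  set B' := B.toReal
  have hA0 : 0 < A' := ENNReal.toReal_pos hA hA'
  have hB0 : 0 < B' := ENNReal.toReal_pos hB hB'
  have eA : A = ENNReal.ofReal A' := (ENNReal.ofReal_toReal hA').symm
  have eB : B = ENNReal.ofReal B' := (ENNReal.ofReal_toReal hB').symm
  -- The crossover point, where x^a A' = x^{-b} B'; the common value there is the weighted geometric
  -- mean of A' and B'.
  set x₀ : ℝ := (B' / A') ^ (1 / (a + b)) with hx₀
  have hx0 : 0 < x₀ := by positivity
  obtain ⟨k₀, hk1, hk2⟩ := exists_mem_Ico_zpow (x := x₀ / t) (y := (2 : ℝ)) (by positivity)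
    (by norm_num)
  rw [le_div_iff₀ ht] at hk1
  rw [div_lt_iff₀ ht] at hk2
  have hV : A ^ (b / (a + b)) * B ^ (a / (a + b))
      = ENNReal.ofReal (A' ^ (b / (a + b)) * B' ^ (a / (a + b))) := by
    rw [ENNReal.ofReal_mul (by positivity), eA, eB, ENNReal.ofReal_rpow_of_pos hA0,
      ENNReal.ofReal_rpow_of_pos hB0]
  have hV1 : x₀ ^ a * A' = A' ^ (b / (a + b)) * B' ^ (a / (a + b)) := by
    rw [hx₀, ← Real.rpow_mul (by positivity), Real.div_rpow hB0.le hA0.le, one_div_mul_eq_div]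
    have : A' ^ (b / (a + b)) = A' / A' ^ (a / (a + b)) := by
      rw [eq_div_iff (by positivity), ← Real.rpow_add hA0, ← add_div, add_comm b, div_self hab.ne',
        Real.rpow_one]
    rw [this]; ring
  have hV2 : x₀ ^ (-b) * B' = A' ^ (b / (a + b)) * B' ^ (a / (a + b)) := by
    rw [hx₀, ← Real.rpow_mul (by positivity), Real.div_rpow hB0.le hA0.le]
    have e1 : 1 / (a + b) * -b = -(b / (a + b)) := by ring
    rw [e1, Real.rpow_neg hB0.le, Real.rpow_neg hA0.le]
    have : B' ^ (a / (a + b)) = B' / B' ^ (b / (a + b)) := by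
      rw [eq_div_iff (by positivity), ← Real.rpow_add hB0, ← add_div, div_self hab.ne',
        Real.rpow_one]
    rw [this]; field_simp
  set V := A' ^ (b / (a + b)) * B' ^ (a / (a + b))
  clear_value V
  have htwo : ∀ x : ℝ, (2 : ℝ≥0∞) ^ x = ENNReal.ofReal ((2 : ℝ) ^ x) := by
    intro x
    rw [← ENNReal.ofReal_rpow_of_pos (by norm_num)]; simp
  have key : ∀ j : ℤ, min (ENNReal.ofReal (t * 2 ^ (j + k₀)) ^ a * A)
      (ENNReal.ofReal (t * 2 ^ (j + k₀)) ^ (-b) * B) ≤ c j * ENNReal.ofReal V := by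
    intro j
    have hpos : 0 < t * (2 : ℝ) ^ (j + k₀) := by positivity
    have hz : (2 : ℝ) ^ j = (2 : ℝ) ^ (j : ℝ) := (Real.rpow_intCast 2 j).symm
    have hle : t * (2 : ℝ) ^ (j + k₀) ≤ (2 : ℝ) ^ (j : ℝ) * x₀ := by
      rw [zpow_add₀ (by norm_num), ← hz]
      calc t * ((2 : ℝ) ^ j * 2 ^ k₀) = 2 ^ j * (2 ^ k₀ * t) := by ring
        _ ≤ _ := by gcongr
    have hge : (2 : ℝ) ^ ((j : ℝ) - 1) * x₀ ≤ t * (2 : ℝ) ^ (j + k₀) := by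
      rw [zpow_add₀ (by norm_num), Real.rpow_sub (by norm_num), ← hz, Real.rpow_one]
      calc (2 : ℝ) ^ j / 2 * x₀ ≤ 2 ^ j / 2 * (2 ^ (k₀ + 1) * t) := by gcongr
        _ = _ := by rw [zpow_add₀ (by norm_num)]; ring
    rw [hc]; simp only
    rw [eA, eB, ENNReal.ofReal_rpow_of_pos hpos, ENNReal.ofReal_rpow_of_pos hpos,
      ← ENNReal.ofReal_mul (by positivity), ← ENNReal.ofReal_mul (by positivity), htwo, htwo]
    refine le_trans (min_le_min (α := ℝ≥0∞) (ENNReal.ofReal_le_ofReal (q := 2 ^ (a * j) * V) ?_)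
      (ENNReal.ofReal_le_ofReal (q := 2 ^ (b - b * j) * V) ?_)) ?_
    · calc (t * (2 : ℝ) ^ (j + k₀)) ^ a * A' ≤ ((2 : ℝ) ^ (j : ℝ) * x₀) ^ a * A' := by gcongr
        _ = _ := by
          rw [Real.mul_rpow (by positivity) hx0.le, mul_assoc, hV1, ← Real.rpow_mul (by norm_num),
            mul_comm a]
    · calc (t * (2 : ℝ) ^ (j + k₀)) ^ (-b) * B' ≤ ((2 : ℝ) ^ ((j : ℝ) - 1) * x₀) ^ (-b) * B' := by
            gcongr ?_ * _
            exact Real.rpow_le_rpow_of_nonpos (by positivity) hge (by linarith)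
        _ = _ := by
          rw [Real.mul_rpow (by positivity) hx0.le, mul_assoc, hV2, ← Real.rpow_mul (by norm_num)]
          congr 2; ring
    · rw [ENNReal.ofReal_mul (by positivity), ENNReal.ofReal_mul (by positivity)]
      rcases le_total (ENNReal.ofReal ((2 : ℝ) ^ (a * j)))
        (ENNReal.ofReal ((2 : ℝ) ^ (b - b * j))) with h | h
      · rw [min_eq_left h]; exact min_le_left _ _
      · rw [min_eq_right h]; exact min_le_right _ _
  rw [hV, ← (Equiv.addRight k₀).tsum_eq]
  calc _ ≤ ∑' j, c j * ENNReal.ofReal V := by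
        gcongr with j; exact key j
    _ = (∑' j, c j) * ENNReal.ofReal V := ENNReal.tsum_mul_right
    _ ≤ _ := by gcongr; exact le_add_self

/-- Discrete layer-cake formula: for finite nonzero y the single term with 2^k < y ≤ 2^{k+1} already
suffices. Together with `tsum_indicator_le_rpow` it replaces the integration over levels in the
interpolation argument for `dyMax`. -/
theorem rpow_le_tsum_indicator {p : ℝ} (hp : 0 < p) (y : ℝ≥0∞) :
    y ^ p ≤ ∑' k : ℤ, (2 : ℝ≥0∞) ^ (((k : ℝ) + 1) * p) *
      (if ENNReal.ofReal (2 ^ k) < y then 1 else 0) := by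
  rcases eq_or_ne y 0 with rfl | h0
  · simp [hp]
  have htwo : ∀ k : ℤ, ENNReal.ofReal ((2 : ℝ) ^ k) = (2 : ℝ≥0∞) ^ (k : ℝ) := by
    intro x
    rw [← Real.rpow_intCast, ← ENNReal.ofReal_rpow_of_pos (by norm_num)]; simp
  rcases eq_or_ne y ∞ with rfl | hy
  · have : (∑' k : ℤ, (2 : ℝ≥0∞) ^ (((k : ℝ) + 1) * p) *
      (if ENNReal.ofReal (2 ^ k) < ∞ then 1 else 0)) = ∞ := by
      refine top_unique ?_
      calc ∞ = ∑' _ : ℕ, (1 : ℝ≥0∞) := (ENNReal.tsum_const_eq_top_of_ne_zero (by simp)).symm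
        _ ≤ ∑' k : ℕ, (2 : ℝ≥0∞) ^ ((((k : ℤ) : ℝ) + 1) * p) := by
            gcongr with k
            exact ENNReal.one_le_rpow (by norm_num) (by push_cast; positivity)
        _ ≤ _ := by
            simpa using ENNReal.tsum_comp_le_tsum_of_injective (f := fun k : ℕ => (k : ℤ))
              Nat.cast_injective (fun k : ℤ => (2 : ℝ≥0∞) ^ (((k : ℝ) + 1) * p))
    rw [this]; exact le_top
  · obtain ⟨k, hk1, hk2⟩ := exists_mem_Ioc_zpow (x := y.toReal) (y := (2 : ℝ))
      (ENNReal.toReal_pos h0 hy) (by norm_num)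
    refine le_trans ?_ (ENNReal.le_tsum k)
    have h1 : ENNReal.ofReal (2 ^ k) < y := by
      rw [← ENNReal.ofReal_toReal hy]
      exact (ENNReal.ofReal_lt_ofReal_iff (ENNReal.toReal_pos h0 hy)).2 hk1
    rw [if_pos h1, mul_one, ENNReal.rpow_mul]
    gcongr
    rw [← ENNReal.ofReal_toReal hy]
    refine (ENNReal.ofReal_le_ofReal hk2).trans ?_
    rw [htwo]; push_cast; exact le_rfl

/-- For 2^k < y one has 2^{ks} ≤ 2^{-ks} y^{2s}, so `tsum_min_rpow_le` applies with A = 1 and B =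
y^{2s}, whose geometric mean is y^s. -/
theorem tsum_indicator_le_rpow {s : ℝ} (hs : 0 < s) :
    ∃ C : ℝ≥0∞, C < ∞ ∧ ∀ y : ℝ≥0∞, ∑' k : ℤ, ENNReal.ofReal (2 ^ k) ^ s *
      (if ENNReal.ofReal (2 ^ k) < y then 1 else 0) ≤ C * y ^ s := by
  obtain ⟨C, hC, h⟩ := tsum_min_rpow_le hs hs
  refine ⟨C, hC, fun y => ?_⟩
  have := h 1 one_pos 1 (y ^ (2 * s))
  have e : (y ^ (2 * s)) ^ (s / (s + s)) = y ^ s := by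
    rw [← ENNReal.rpow_mul]; congr 1; field_simp; norm_num
  rw [ENNReal.one_rpow, one_mul, e] at this
  refine le_trans ?_ this
  gcongr with k
  have hpos : ENNReal.ofReal ((2 : ℝ) ^ k) ≠ 0 := by simp; positivity
  rw [one_mul]
  split_ifs with hk
  · rw [mul_one]
    refine le_min le_rfl ?_
    calc ENNReal.ofReal (2 ^ k) ^ s = ENNReal.ofReal (2 ^ k) ^ (-s) *
          ENNReal.ofReal (2 ^ k) ^ (2 * s) := by
            rw [← ENNReal.rpow_add _ _ hpos ENNReal.ofReal_ne_top]; congr 1; ring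
      _ ≤ _ := by gcongr
  · simp

/-! ### The dyadic centred maximal function -/

variable {n : ℕ}

theorem volume_ball_pos (x : Rn n) {r : ℝ} (hr : 0 < r) : volume (Metric.ball x r) ≠ 0 :=
  (Metric.measure_ball_pos volume x hr).ne'

theorem volume_ball_ne_top (x : Rn n) (r : ℝ) : volume (Metric.ball x r) ≠ ∞ :=
  measure_ball_lt_top.ne

theorem volume_ball_eq (x : Rn n) {r : ℝ} (hr : 0 < r) :
    volume (Metric.ball x r) = ENNReal.ofReal (r ^ n) * volume (Metric.ball (0 : Rn n) 1) := by
  have := Measure.addHaar_ball_of_pos (volume : Measure (Rn n)) x hr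
  simpa using this

theorem volume_ball_mul (x y : Rn n) {a r : ℝ} (ha : 0 < a) (hr : 0 < r) :
    volume (Metric.ball x (a * r)) = ENNReal.ofReal (a ^ n) * volume (Metric.ball y r) := by
  rw [volume_ball_eq x (by positivity), volume_ball_eq y hr, mul_pow,
    ENNReal.ofReal_mul (by positivity), mul_assoc]

theorem volume_ball_two_mul (x y : Rn n) {r : ℝ} (hr : 0 < r) :
    volume (Metric.ball x (2 * r)) = 2 ^ n * volume (Metric.ball y r) := by
  rw [volume_ball_mul x y two_pos hr, ENNReal.ofReal_pow (by norm_num)]; simp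

theorem measurableSet_dist_lt (r : ℝ) : MeasurableSet {p : Rn n × Rn n | dist p.2 p.1 < r} :=
  (isOpen_lt (by fun_prop) (by fun_prop)).measurableSet

theorem measurable_setLIntegral_ball {F : Rn n → Rn n → ℝ≥0∞}
    (hF : Measurable (Function.uncurry F)) (r : ℝ) :
    Measurable fun x : Rn n => ∫⁻ z in Metric.ball x r, F x z := by
  have h : (fun x : Rn n => ∫⁻ z in Metric.ball x r, F x z) = fun x => ∫⁻ z,
      ({p : Rn n × Rn n | dist p.2 p.1 < r}.indicator (Function.uncurry F)) (x, z) := by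
    ext x
    rw [← lintegral_indicator Metric.isOpen_ball.measurableSet]
    rfl
  rw [h]
  exact (hF.indicator (measurableSet_dist_lt r)).lintegral_prod_right'

/-- The average of `F` over the ball `B(x, r)`. -/
def ballAvg (r : ℝ) (F : Rn n → ℝ≥0∞) (x : Rn n) : ℝ≥0∞ :=
  ⨍⁻ z in Metric.ball x r, F z ∂volume

theorem ballAvg_eq (r : ℝ) (F : Rn n → ℝ≥0∞) (x : Rn n) :
    ballAvg r F x = (∫⁻ z in Metric.ball x r, F z) / volume (Metric.ball x r) :=
  setLAverage_eq _ _ _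

theorem measurable_ballAvg {F : Rn n → Rn n → ℝ≥0∞}
    (hF : Measurable (Function.uncurry F)) (r : ℝ) :
    Measurable fun x : Rn n => ballAvg r (F x) x := by
  have : (fun x : Rn n => ballAvg r (F x) x)
      = fun x => (∫⁻ z in Metric.ball x r, F x z) / volume (Metric.ball (0 : Rn n) r) := by
    ext x
    rw [ballAvg_eq, Measure.addHaar_ball_center]
  rw [this]
  exact (measurable_setLIntegral_ball hF r).div_const _

/-- Averaging over balls of a fixed radius preserves integrals. -/
theorem lintegral_ballAvg {F : Rn n → ℝ≥0∞} (hF : Measurable F) {r : ℝ} (hr : 0 < r) :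
    ∫⁻ x, ballAvg r F x = ∫⁻ z, F z := by
  have h1 : ∀ x : Rn n, ballAvg r F x
      = (volume (Metric.ball (0 : Rn n) r))⁻¹ * ∫⁻ z, ({p : Rn n × Rn n | dist p.2 p.1 < r}.indicator
        (fun p => F p.2)) (x, z) := by
    intro x
    rw [ballAvg_eq, Measure.addHaar_ball_center, ENNReal.div_eq_inv_mul,
      ← lintegral_indicator Metric.isOpen_ball.measurableSet]
    rfl
  have hm : Measurable ({p : Rn n × Rn n | dist p.2 p.1 < r}.indicator (fun p => F p.2)) :=
    (hF.comp measurable_snd).indicator (measurableSet_dist_lt r)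
  simp_rw [h1]
  rw [lintegral_const_mul _ hm.lintegral_prod_right',
    lintegral_lintegral_swap (f := fun x z => ({p : Rn n × Rn n | dist p.2 p.1 < r}.indicator
        (fun p => F p.2)) (x, z)) hm.aemeasurable]
  have h2 : ∀ z : Rn n, ∫⁻ x, ({p : Rn n × Rn n | dist p.2 p.1 < r}.indicator
        (fun p => F p.2)) (x, z) = F z * volume (Metric.ball (0 : Rn n) r) := by
    intro z
    rw [← Measure.addHaar_ball_center volume z, ← setLIntegral_const,
      ← lintegral_indicator Metric.isOpen_ball.measurableSet]
    refine lintegral_congr fun x => ?_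
    simp only [Set.indicator, Set.mem_ofPred_eq, Metric.mem_ball, dist_comm z x]
  simp_rw [h2]
  rw [lintegral_mul_const _ hF, mul_comm, mul_assoc,
    ENNReal.mul_inv_cancel (volume_ball_pos 0 hr) (volume_ball_ne_top 0 r), mul_one]

/-- The centred maximal function over balls of radii `t 2^K`, `K ∈ ℤ`. -/
def dyMax (t : ℝ) (F : Rn n → ℝ≥0∞) (x : Rn n) : ℝ≥0∞ :=
  ⨆ K : ℤ, ballAvg (t * 2 ^ K) F x

theorem measurable_dyMax {F : Rn n → ℝ≥0∞} (hF : Measurable F) (t : ℝ) :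
    Measurable (dyMax t F) :=
  Measurable.iSup fun _ => measurable_ballAvg (F := fun _ z => F z) (hF.comp measurable_snd) _

theorem ballAvg_le_dyMax (t : ℝ) (F : Rn n → ℝ≥0∞) (x : Rn n) (K : ℤ) :
    ballAvg (t * 2 ^ K) F x ≤ dyMax t F x :=
  le_iSup (fun K : ℤ => ballAvg (t * 2 ^ K) F x) K

/-- The weak type (1,1) bound, by Vitali covering with the balls on which the average exceeds l. The
covering lemma needs bounded radii, so first only the scales K ≤ N are admitted; the resulting sets
increase to the full level set. -/
theorem mul_measure_lt_dyMax_le {t : ℝ} (ht : 0 < t) (F : Rn n → ℝ≥0∞) (l : ℝ≥0∞) :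
    l * volume {x | l < dyMax t F x} ≤ 5 ^ n * ∫⁻ x, F x := by
  set A : ℕ → Set (Rn n) := fun N => {x | ∃ K : ℤ, K ≤ N ∧ l < ballAvg (t * 2 ^ K) F x}
  have hA : {x | l < dyMax t F x} = ⋃ N, A N := by
    ext x
    simp only [dyMax, lt_iSup_iff, Set.mem_ofPred_eq, Set.mem_iUnion, A]
    exact ⟨fun ⟨K, hK⟩ => ⟨K.toNat, K, Int.self_le_toNat K, hK⟩, fun ⟨N, K, _, hK⟩ => ⟨K, hK⟩⟩
  have hmono : Monotone A := fun N N' h x ⟨K, hK, hx⟩ => ⟨K, hK.trans (by exact_mod_cast h), hx⟩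
  rw [hA, hmono.measure_iUnion, ENNReal.mul_iSup]
  refine iSup_le fun N => ?_
  have hch : ∀ x : A N, ∃ K : ℤ, K ≤ N ∧ l < ballAvg (t * 2 ^ K) F (x : Rn n) :=
    fun x => x.2
  choose K hKN hK using hch
  -- Any enlargement factor above 3 is allowed; with 4, the enlarged closed ball sits inside the
  -- open ball of five times the radius.
  obtain ⟨u, -, hdisj, hcov⟩ := Vitali.exists_disjoint_subfamily_covering_enlargement_closedBall
    (Set.univ : Set (A N)) (fun x => (x : Rn n)) (fun x => t * 2 ^ K x) (t * 2 ^ N)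
    (fun x _ => by
      have := zpow_le_zpow_right₀ (one_le_two (α := ℝ)) (hKN x)
      rw [zpow_natCast] at this
      gcongr) 4 (by norm_num)
  have hpos : ∀ x : A N, 0 < t * (2 : ℝ) ^ K x := fun x => by positivity
  have hdisj' : u.PairwiseDisjoint fun x : A N => Metric.ball (x : Rn n) (t * 2 ^ K x) :=
    hdisj.mono fun x => Metric.ball_subset_closedBall
  have hcount : u.Countable := hdisj'.countable_of_isOpen (fun _ _ => Metric.isOpen_ball)
    (fun x _ => ⟨x, Metric.mem_ball_self (hpos x)⟩)
  have hcov' : A N ⊆ ⋃ x ∈ u, Metric.ball (x : Rn n) (5 * (t * 2 ^ K x)) := by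
    intro x hx
    obtain ⟨y, hy, hxy⟩ := hcov ⟨x, hx⟩ trivial
    refine Set.mem_biUnion hy ?_
    have := hxy (Metric.mem_closedBall_self (hpos _).le)
    rw [Metric.mem_closedBall] at this
    rw [Metric.mem_ball]
    linarith [hpos y]
  have := hcount.to_subtype
  calc l * volume (A N) ≤ l * ∑' x : u, volume (Metric.ball (x.1 : Rn n) (5 * (t * 2 ^ K x.1))) := by
        gcongr
        exact (measure_mono hcov').trans (measure_biUnion_le _ hcount _)
    _ = ∑' x : u, 5 ^ n * (l * volume (Metric.ball (x.1 : Rn n) (t * 2 ^ K x.1))) := by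
        rw [← ENNReal.tsum_mul_left]
        congr with x
        rw [volume_ball_mul x.1.1 x.1.1 (by norm_num) (hpos _), ENNReal.ofReal_pow (by norm_num)]
        simp only [ENNReal.ofReal_ofNat]
        ring
    _ ≤ ∑' x : u, 5 ^ n * ∫⁻ z in Metric.ball (x.1 : Rn n) (t * 2 ^ K x.1), F z := by
        gcongr with x
        have := (hK x.1).le
        rw [ballAvg_eq] at this
        exact (ENNReal.le_div_iff_mul_le (Or.inl (volume_ball_pos _ (hpos _)))
          (Or.inl (volume_ball_ne_top _ _))).1 this
    _ = 5 ^ n * ∫⁻ z in ⋃ x ∈ u, Metric.ball (x : Rn n) (t * 2 ^ K x), F z := by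
        rw [ENNReal.tsum_mul_left, lintegral_biUnion hcount
          (fun _ _ => Metric.isOpen_ball.measurableSet) hdisj']
    _ ≤ _ := mul_le_mul_right (setLIntegral_le_lintegral _ _) _

/-- The part of F below the level l has all its averages at most l, so large values of the maximal
function come from the part above l. -/
theorem dyMax_le_add {t : ℝ} (ht : 0 < t) (F : Rn n → ℝ≥0∞) (l : ℝ≥0∞) (x : Rn n) :
    dyMax t F x ≤ dyMax t ({z | l < F z}.indicator F) x + l := by
  refine iSup_le fun K : ℤ => ?_
  have hpos : 0 < t * (2 : ℝ) ^ K := by positivity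
  refine le_trans ?_ (add_le_add (ballAvg_le_dyMax t _ x K) le_rfl)
  have h1 : ∀ z, F z ≤ {z | l < F z}.indicator F z + l := by
    intro z
    by_cases h : l < F z
    · rw [Set.indicator_of_mem (by exact h)]; exact le_self_add
    · rw [Set.indicator_of_notMem (by exact h), zero_add]; exact not_lt.1 h
  have h2 : ballAvg (t * 2 ^ K) (fun _ => l) x = l :=
    setLAverage_const (volume_ball_pos x hpos) (volume_ball_ne_top x _) l
  calc _ ≤ ballAvg (t * 2 ^ K) (fun z => {z | l < F z}.indicator F z + l) x :=
        laverage_mono_ae (Eventually.of_forall h1)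
    _ = _ := by
        refine Eq.trans ?_ (congrArg (_ + ·) h2)
        simp only [ballAvg, laverage]
        rw [lintegral_add_right _ measurable_const]

/-- The strong type `(p, p)` bound for the maximal function. -/
theorem lintegral_dyMax_rpow_le {p : ℝ} (hp : 1 < p) :
    ∃ C : ℝ≥0∞, C < ∞ ∧ ∀ t : ℝ, 0 < t → ∀ F : Rn n → ℝ≥0∞, Measurable F →
      ∫⁻ x, dyMax t F x ^ p ≤ C * ∫⁻ x, F x ^ p := by
  obtain ⟨C, hC, h⟩ := tsum_indicator_le_rpow (s := p - 1) (by linarith)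
  refine ⟨(2 ^ (2 * p) * 5 ^ n * C) , ?_, fun t ht F hF => ?_⟩
  · have : (2 : ℝ≥0∞) ^ (2 * p) < ∞ := ENNReal.rpow_lt_top_of_nonneg (by linarith) (by norm_num)
    exact ENNReal.mul_lt_top (ENNReal.mul_lt_top this (by simp)) hC
  have hM := measurable_dyMax hF t
  have htwo : ∀ k : ℤ, ENNReal.ofReal ((2 : ℝ) ^ k) = (2 : ℝ≥0∞) ^ (k : ℝ) := by
    intro x
    rw [← Real.rpow_intCast, ← ENNReal.ofReal_rpow_of_pos (by norm_num)]; simp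
  have hstep : ∀ k : ℤ, (2 : ℝ≥0∞) ^ (((k : ℝ) + 1) * p) *
      volume {x | ENNReal.ofReal (2 ^ k) < dyMax t F x} ≤
      2 ^ (2 * p) * 5 ^ n * ∫⁻ x, ENNReal.ofReal (2 ^ (k - 1)) ^ (p - 1) *
        (if ENNReal.ofReal (2 ^ (k - 1)) < F x then 1 else 0) * F x := by
    intro k
    -- Half of the level 2^k: the part of F below l accounts for at most l, so reaching beyond 2l
    -- forces the part above l to have maximal function beyond l.
    set l := ENNReal.ofReal ((2 : ℝ) ^ (k - 1)) with hl
    have hl2 : ENNReal.ofReal ((2 : ℝ) ^ k) = l + l := by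
      rw [hl, ← ENNReal.ofReal_add (by positivity) (by positivity)]
      congr 1
      rw [zpow_sub_one₀ (by norm_num)]; ring
    have hsub : {x | ENNReal.ofReal (2 ^ k) < dyMax t F x} ⊆
        {x | l < dyMax t ({z | l < F z}.indicator F) x} := by
      intro x hx
      by_contra hcon
      simp only [Set.mem_ofPred_eq, not_lt] at hx hcon
      refine absurd hx (not_lt.2 ?_)
      rw [hl2]
      exact (dyMax_le_add ht F l x).trans (by gcongr)
    have hw := mul_measure_lt_dyMax_le ht ({z | l < F z}.indicator F) l
    have hlr : (2 : ℝ≥0∞) ^ (((k : ℝ) + 1) * p) = 2 ^ (2 * p) * (l ^ (p - 1) * l) := by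
      have hl0 : l = 2 ^ ((k : ℝ) - 1) := by rw [hl, htwo]; push_cast; rfl
      have : l ^ (p - 1) * l = l ^ p := by
        conv_lhs => rw [← ENNReal.rpow_one l, ← ENNReal.rpow_mul]
        rw [← ENNReal.rpow_add _ _ (by rw [hl0]; simp) (by rw [hl]; simp)]
        congr 1; ring
      rw [this, hl0, ← ENNReal.rpow_mul, ← ENNReal.rpow_add _ _ (by norm_num) (by norm_num)]
      congr 1; ring
    calc _ ≤ 2 ^ (2 * p) * (l ^ (p - 1) * l) *
          volume {x | l < dyMax t ({z | l < F z}.indicator F) x} := by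
          rw [hlr]; gcongr
      _ = 2 ^ (2 * p) * l ^ (p - 1) *
          (l * volume {x | l < dyMax t ({z | l < F z}.indicator F) x}) := by ring
      _ ≤ 2 ^ (2 * p) * l ^ (p - 1) * (5 ^ n * ∫⁻ x, {z | l < F z}.indicator F x) := by gcongr
      _ = 2 ^ (2 * p) * 5 ^ n * (l ^ (p - 1) * ∫⁻ x, {z | l < F z}.indicator F x) := by ring
      _ = _ := by
        rw [← lintegral_const_mul _ (hF.indicator (measurableSet_lt measurable_const hF))]
        congr 1
        refine lintegral_congr fun x => ?_
        by_cases hx : l < F x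
        · simp [hx, Set.indicator]
        · simp [hx, Set.indicator]
  calc ∫⁻ x, dyMax t F x ^ p ≤ ∫⁻ x, ∑' k : ℤ, (2 : ℝ≥0∞) ^ (((k : ℝ) + 1) * p) *
      (if ENNReal.ofReal (2 ^ k) < dyMax t F x then 1 else 0) :=
        lintegral_mono fun x => rpow_le_tsum_indicator (by linarith) _
    _ = ∑' k : ℤ, (2 : ℝ≥0∞) ^ (((k : ℝ) + 1) * p) *
      volume {x | ENNReal.ofReal (2 ^ k) < dyMax t F x} := by
        have hms : ∀ k : ℤ, MeasurableSet {x | ENNReal.ofReal (2 ^ k) < dyMax t F x} :=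
          fun k => measurableSet_lt measurable_const hM
        have hm : ∀ k : ℤ, Measurable fun x : Rn n =>
            if ENNReal.ofReal (2 ^ k) < dyMax t F x then (1 : ℝ≥0∞) else 0 := fun k =>
          Measurable.ite (hms k) measurable_const measurable_const
        rw [lintegral_tsum fun k => ((hm k).const_mul _).aemeasurable]
        congr with k
        rw [lintegral_const_mul _ (hm k)]
        congr 1
        rw [← lintegral_indicator_one (hms k)]
        refine lintegral_congr fun x => ?_
        simp [Set.indicator]
    _ ≤ ∑' k : ℤ, 2 ^ (2 * p) * 5 ^ n * ∫⁻ x, ENNReal.ofReal (2 ^ (k - 1)) ^ (p - 1) *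
        (if ENNReal.ofReal (2 ^ (k - 1)) < F x then 1 else 0) * F x := by
        exact ENNReal.tsum_le_tsum hstep
    _ = 2 ^ (2 * p) * 5 ^ n * ∫⁻ x, (∑' k : ℤ, ENNReal.ofReal (2 ^ k) ^ (p - 1) *
        (if ENNReal.ofReal (2 ^ k) < F x then 1 else 0)) * F x := by
        rw [ENNReal.tsum_mul_left]
        congr 1
        rw [← (Equiv.addRight (1 : ℤ)).tsum_eq]
        simp only [Equiv.coe_addRight, add_sub_cancel_right]
        rw [← lintegral_tsum]
        · simp_rw [ENNReal.tsum_mul_right]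
        · intro k
          have : Measurable fun x : Rn n =>
              if ENNReal.ofReal (2 ^ k) < F x then (1 : ℝ≥0∞) else 0 :=
            Measurable.ite (measurableSet_lt measurable_const hF) measurable_const measurable_const
          exact ((this.const_mul _).mul hF).aemeasurable
    _ ≤ 2 ^ (2 * p) * 5 ^ n * ∫⁻ x, C * F x ^ p := by
        refine mul_le_mul_right (lintegral_mono fun x => ?_) _
        calc _ ≤ C * F x ^ (p - 1) * F x := by gcongr; exact h _
          _ = C * F x ^ p := by
            rw [mul_assoc]
            congr 1
            rcases eq_or_ne (F x) 0 with h0 | h0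
            · rw [h0, ENNReal.zero_rpow_of_pos (by linarith : 0 < p), mul_zero]
            rcases eq_or_ne (F x) ∞ with h1 | h1
            · rw [h1, ENNReal.top_rpow_of_pos (by linarith), ENNReal.top_rpow_of_pos (by linarith)]
              simp
            · conv_lhs => rw [← ENNReal.rpow_one (F x), ← ENNReal.rpow_mul]
              rw [← ENNReal.rpow_add _ _ h0 h1]
              congr 1; ring
    _ = _ := by
        rw [lintegral_const_mul _ (hF.pow_const p)]; ring

/-! ### The John–Nirenberg inequality on cubes -/

/-- Bernoulli's inequality for the powers of 2^{δ/M}. This is how the polynomial growth of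
oscillations across scales is absorbed into any geometric decay. -/
theorem exists_add_one_rpow_le (M : ℝ) {δ : ℝ} (hδ : 0 < δ) :
    ∃ C : ℝ≥0∞, C < ∞ ∧ ∀ k : ℕ, ((k : ℝ≥0∞) + 1) ^ M ≤ C * (2 : ℝ≥0∞) ^ (δ * k) := by
  rcases le_or_gt M 0 with hM | hM
  · refine ⟨1, by simp, fun k => ?_⟩
    rw [one_mul]
    calc ((k : ℝ≥0∞) + 1) ^ M ≤ ((k : ℝ≥0∞) + 1) ^ (0 : ℝ) :=
          ENNReal.rpow_le_rpow_of_exponent_le le_add_self hM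
      _ = (2 : ℝ≥0∞) ^ (0 : ℝ) := by simp
      _ ≤ _ := ENNReal.rpow_le_rpow_of_exponent_le (by norm_num) (by positivity)
  · set ε : ℝ := 2 ^ (δ / M) - 1 with hε
    have hε0 : 0 < ε := by
      have : (1 : ℝ) < 2 ^ (δ / M) := Real.one_lt_rpow (by norm_num) (by positivity)
      rw [hε]; linarith
    refine ⟨ENNReal.ofReal ((1 + 1 / ε) ^ M), ENNReal.ofReal_lt_top, fun k => ?_⟩
    have hb : 1 + (k : ℝ) * ε ≤ (1 + ε) ^ k := one_add_mul_le_pow (by linarith) k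
    have h1 : (k : ℝ) + 1 ≤ (1 + 1 / ε) * (2 ^ (δ / M)) ^ k := by
      have e : (2 : ℝ) ^ (δ / M) = 1 + ε := by rw [hε]; ring
      rw [e]
      calc (k : ℝ) + 1 ≤ (1 + 1 / ε) * (1 + k * ε) := by
            have : (1 + 1 / ε) * (1 + k * ε) = k + 1 + (k * ε + 1 / ε) := by
              field_simp; ring
            rw [this]
            have : 0 ≤ k * ε + 1 / ε := by positivity
            linarith
        _ ≤ _ := by gcongr
    have h2 : ((k : ℝ) + 1) ^ M ≤ (1 + 1 / ε) ^ M * 2 ^ (δ * k) := by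
      calc ((k : ℝ) + 1) ^ M ≤ ((1 + 1 / ε) * (2 ^ (δ / M)) ^ k) ^ M := by gcongr
        _ = _ := by
          rw [Real.mul_rpow (by positivity) (by positivity), ← Real.rpow_natCast (2 ^ (δ / M)) k,
            ← Real.rpow_mul (by positivity), ← Real.rpow_mul (by positivity)]
          congr 2
          field_simp
    have e1 : ((k : ℝ≥0∞) + 1) = ENNReal.ofReal ((k : ℝ) + 1) := by
      rw [ENNReal.ofReal_add (by positivity) (by norm_num)]; simp
    have e2 : (2 : ℝ≥0∞) = ENNReal.ofReal 2 := by simp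
    rw [e1, e2, ENNReal.ofReal_rpow_of_pos (by positivity), ENNReal.ofReal_rpow_of_pos two_pos,
      ← ENNReal.ofReal_mul (by positivity)]
    exact ENNReal.ofReal_le_ofReal h2

theorem tsum_add_one_rpow_mul_pow_lt_top (u : ℝ) {ρ : ℝ≥0∞} (hρ : ρ < 1) :
    ∑' k : ℕ, ((k : ℝ≥0∞) + 1) ^ u * ρ ^ k < ∞ := by
  obtain ⟨δ, hδ, h⟩ : ∃ δ : ℝ, 0 < δ ∧ (2 : ℝ≥0∞) ^ δ * ρ < 1 := by
    have hc : Tendsto (fun δ : ℝ => (2 : ℝ≥0∞) ^ δ * ρ) (𝓝[>] 0) (𝓝 ((2 : ℝ≥0∞) ^ (0 : ℝ) * ρ)) := by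
      refine ENNReal.Tendsto.mul_const ?_ (Or.inl (by simp))
      have htwo : ∀ x : ℝ, (2 : ℝ≥0∞) ^ x = ENNReal.ofReal ((2 : ℝ) ^ x) := by
        intro x
        rw [← ENNReal.ofReal_rpow_of_pos (by norm_num)]; simp
      have hfun : (fun x : ℝ => (2 : ℝ≥0∞) ^ x) = fun x => ENNReal.ofReal ((2 : ℝ) ^ x) :=
        funext htwo
      change Tendsto (fun x : ℝ => (2 : ℝ≥0∞) ^ x) _ _
      rw [hfun, htwo]
      exact ENNReal.tendsto_ofReal
        ((Real.continuousAt_const_rpow (a := 2) (b := 0) (by norm_num)).tendsto.mono_left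
          nhdsWithin_le_nhds)
    have h2 : ∀ᶠ δ : ℝ in 𝓝[>] 0, (2 : ℝ≥0∞) ^ δ * ρ < 1 := by
      refine hc.eventually_lt_const ?_
      simpa using hρ
    obtain ⟨δ, h3, h4⟩ := (h2.and self_mem_nhdsWithin).exists
    exact ⟨δ, h4, h3⟩
  obtain ⟨C, hC, hk⟩ := exists_add_one_rpow_le u hδ
  calc _ ≤ ∑' k : ℕ, C * ((2 : ℝ≥0∞) ^ δ * ρ) ^ k := by
        refine ENNReal.tsum_le_tsum fun k => ?_
        rw [mul_pow, ← mul_assoc, ← ENNReal.rpow_natCast (2 ^ δ), ← ENNReal.rpow_mul]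
        exact mul_le_mul_left (hk k) _
    _ < ∞ := by
        rw [ENNReal.tsum_mul_left, ENNReal.tsum_geometric]
        refine ENNReal.mul_lt_top hC ?_
        simpa [tsub_eq_zero_iff_le] using h

section Cubes

variable {n : ℕ} {𝕜 : Type*} [RCLike 𝕜]

/-- The half-open cube with lower corner `a` and side `L`. -/
def cube (a : Fin n → ℝ) (L : ℝ) : Set (Fin n → ℝ) :=
  Set.pi Set.univ fun i => Set.Ico (a i) (a i + L)

theorem measurableSet_cube (a : Fin n → ℝ) (L : ℝ) : MeasurableSet (cube a L) :=
  MeasurableSet.univ_pi fun _ => measurableSet_Ico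

theorem volume_cube (a : Fin n → ℝ) (L : ℝ) : volume (cube a L) = ENNReal.ofReal L ^ n := by
  simp [cube, Real.volume_pi_Ico]

/-- The dyadic subcube of generation `k` and index `z` of `cube a L`. -/
def subcube (a : Fin n → ℝ) (L : ℝ) (k : ℕ) (z : Fin n → ℤ) : Set (Fin n → ℝ) :=
  cube (fun i => a i + L / 2 ^ k * z i) (L / 2 ^ k)

/-- The index of the dyadic subcube of generation `k` that contains `x`. -/
def cubeIndex (a : Fin n → ℝ) (L : ℝ) (k : ℕ) (x : Fin n → ℝ) : Fin n → ℤ :=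
  fun i => ⌊(x i - a i) / (L / 2 ^ k)⌋

theorem mem_subcube_iff {a : Fin n → ℝ} {L : ℝ} (hL : 0 < L) {k : ℕ} {z : Fin n → ℤ}
    {x : Fin n → ℝ} : x ∈ subcube a L k z ↔ cubeIndex a L k x = z := by
  have hl : 0 < L / 2 ^ k := by positivity
  simp only [subcube, cube, Set.mem_pi, Set.mem_univ, true_imp_iff, Set.mem_Ico, funext_iff,
    cubeIndex, Int.floor_eq_iff]
  refine forall_congr' fun i => ?_
  rw [le_div_iff₀ hl, div_lt_iff₀ hl]
  constructor
  · rintro ⟨h1, h2⟩; constructor <;> linarith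
  · rintro ⟨h1, h2⟩; constructor <;> linarith

theorem subcube_zero (a : Fin n → ℝ) (L : ℝ) : subcube a L 0 0 = cube a L := by
  simp [subcube]

/-- Nesting of the dyadic grids: ⌊2s⌋ determines ⌊s⌋. -/
theorem cubeIndex_eq_of_succ {a : Fin n → ℝ} {L : ℝ} (hL : 0 < L) {k : ℕ} {x y : Fin n → ℝ}
    (h : cubeIndex a L (k + 1) x = cubeIndex a L (k + 1) y) :
    cubeIndex a L k x = cubeIndex a L k y := by
  have key : ∀ s t : ℝ, ⌊2 * s⌋ = ⌊2 * t⌋ → ⌊s⌋ ≤ ⌊t⌋ := by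
    intro s t hst
    rw [Int.le_floor]
    have h1 : (2 * ⌊s⌋ : ℤ) ≤ ⌊2 * s⌋ := by
      rw [Int.le_floor]; push_cast; linarith [Int.floor_le s]
    rw [hst, Int.le_floor] at h1
    push_cast at h1; linarith
  ext i
  have hi := congrFun h i
  simp only [cubeIndex] at hi ⊢
  have e : ∀ w : Fin n → ℝ, (w i - a i) / (L / 2 ^ (k + 1)) = 2 * ((w i - a i) / (L / 2 ^ k)) := by
    intro w; rw [pow_succ]; field_simp
  rw [e, e] at hi
  exact le_antisymm (key _ _ hi) (key _ _ hi.symm)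

theorem cubeIndex_eq_of_le {a : Fin n → ℝ} {L : ℝ} (hL : 0 < L) {j k : ℕ} (hjk : j ≤ k)
    {x y : Fin n → ℝ} (h : cubeIndex a L k x = cubeIndex a L k y) :
    cubeIndex a L j x = cubeIndex a L j y := by
  induction k, hjk using Nat.le_induction with
  | base => exact h
  | succ k _ ih => exact ih (cubeIndex_eq_of_succ hL h)

theorem volume_subcube {a : Fin n → ℝ} {L : ℝ} {k : ℕ} (z : Fin n → ℤ) :
    volume (subcube a L k z) = ENNReal.ofReal (L / 2 ^ k) ^ n := by
  rw [subcube, volume_cube]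

/-- Lebesgue's differentiation theorem along dyadic subcubes, in the form of a bound. -/
theorem ae_enorm_sub_le_of_subcube_average_le {a : Fin n → ℝ} {L : ℝ} (hL : 0 < L)
    {b : (Fin n → ℝ) → 𝕜} (hb : LocallyIntegrable b) (β : 𝕜) (l : ℝ≥0∞) :
    ∀ᵐ x, (∀ k, ∫⁻ y in subcube a L k (cubeIndex a L k x), ‖b y - β‖ₑ ≤
        l * volume (subcube a L k (cubeIndex a L k x))) → ‖b x - β‖ₑ ≤ l := by
  filter_upwards [IsUnifLocDoublingMeasure.ae_tendsto_average_norm_sub volume hb 1] with x hx hk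
  -- In the sup norm a closed ball is a closed cube. The subcube around x therefore lies in a ball
  -- of the same volume with centre `w k` and radius `δ k`, and the differentiation theorem accepts
  -- balls that are not centred at x.
  set w : ℕ → Fin n → ℝ := fun k i => a i + L / 2 ^ k * cubeIndex a L k x i + L / 2 ^ k / 2
  set δ : ℕ → ℝ := fun k => L / 2 ^ k / 2
  have hδ0 : ∀ k, 0 < δ k := fun k => by positivity
  have hδ : Tendsto δ atTop (𝓝[>] 0) := by
    refine tendsto_nhdsWithin_iff.2 ⟨?_, Eventually.of_forall hδ0⟩
    have : Tendsto (fun k : ℕ => L / 2 * (1 / 2 : ℝ) ^ k) atTop (𝓝 (L / 2 * 0)) :=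
      (tendsto_pow_atTop_nhds_zero_of_lt_one (by norm_num) (by norm_num)).const_mul _
    rw [mul_zero] at this
    refine this.congr fun k => ?_
    simp only [δ, one_div, inv_pow]; ring
  have hsub : ∀ k, subcube a L k (cubeIndex a L k x) ⊆ Metric.closedBall (w k) (δ k) := by
    intro k y hy
    rw [closedBall_pi _ (hδ0 k).le]
    intro i _
    have hi := hy i trivial
    simp only [Set.mem_Ico] at hi
    simp only [Real.closedBall_eq_Icc]
    constructor <;> simp only [w, δ] <;> linarith [hi.1, hi.2]
  have hvol : ∀ k, volume (Metric.closedBall (w k) (δ k)) =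
      volume (subcube a L k (cubeIndex a L k x)) := by
    intro k
    rw [volume_subcube, Real.volume_pi_closedBall _ (hδ0 k).le, ENNReal.ofReal_pow (by
      have := hδ0 k; positivity)]
    simp only [δ, Fintype.card_fin]
    congr 2; ring
  have hlim := hx w δ hδ (Eventually.of_forall fun k => by
    rw [one_mul]; exact hsub k (mem_subcube_iff hL |>.2 rfl))
  have hbound : ∀ k, ‖b x - β‖ₑ ≤
      ENNReal.ofReal (⨍ y in Metric.closedBall (w k) (δ k), ‖b y - b x‖) + l := by
    intro k
    set V := volume (subcube a L k (cubeIndex a L k x)) with hV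
    have hV0 : V ≠ 0 := by
      rw [hV, volume_subcube]
      exact pow_ne_zero _ (by simp; positivity)
    have hVt : V ≠ ∞ := by
      rw [hV, volume_subcube]; exact ENNReal.pow_ne_top ENNReal.ofReal_ne_top
    have hint : IntegrableOn (fun y => b y - b x) (Metric.closedBall (w k) (δ k)) :=
      (hb.integrableOn_isCompact (isCompact_closedBall _ _)).sub
        (integrableOn_const (by rw [hvol]; exact hVt) (by simp))
    have h1 : ∫⁻ y in Metric.closedBall (w k) (δ k), ‖b y - b x‖ₑ =
        ENNReal.ofReal (⨍ y in Metric.closedBall (w k) (δ k), ‖b y - b x‖) * V := by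
      rw [setAverage_eq, smul_eq_mul, ENNReal.ofReal_mul (by positivity), measureReal_def, hvol,
        ← ofReal_integral_norm_eq_lintegral_enorm hint,
        ENNReal.ofReal_inv_of_pos (ENNReal.toReal_pos hV0 hVt), ENNReal.ofReal_toReal hVt, mul_comm,
        ← mul_assoc, ENNReal.mul_inv_cancel hV0 hVt, one_mul]
    have h2 : ‖b x - β‖ₑ * V ≤
        (ENNReal.ofReal (⨍ y in Metric.closedBall (w k) (δ k), ‖b y - b x‖) + l) * V := by
      rw [add_mul, ← h1, hV, ← setLIntegral_const]
      refine le_trans ?_ (add_le_add (lintegral_mono_set (hsub k)) (hk k))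
      rw [← lintegral_add_left' ?_]
      · refine lintegral_mono fun y => ?_
        calc ‖b x - β‖ₑ = ‖(b y - β) - (b y - b x)‖ₑ := by congr 1; abel
          _ ≤ ‖b y - b x‖ₑ + ‖b y - β‖ₑ := by rw [add_comm]; exact enorm_sub_le
      · exact (hb.aestronglyMeasurable.sub aestronglyMeasurable_const).enorm.restrict
    exact (ENNReal.mul_le_mul_iff_left hV0 hVt).1 h2
  have : Tendsto (fun k => ENNReal.ofReal (⨍ y in Metric.closedBall (w k) (δ k), ‖b y - b x‖) + l)
      atTop (𝓝 (ENNReal.ofReal 0 + l)) := (ENNReal.tendsto_ofReal hlim).add tendsto_const_nhds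
  rw [ENNReal.ofReal_zero, zero_add] at this
  exact ge_of_tendsto' this hbound

/-- The distributional form of the John–Nirenberg inequality, for a measure `μ` to which sets
that fill at most half of a cube contribute at most the proportion `ρ`. -/
theorem measure_lt_enorm_sub_le {μ : Measure (Fin n → ℝ)} (hμ : μ ≪ volume) {ρ : ℝ≥0∞}
    (hρ : ∀ (a : Fin n → ℝ) (L : ℝ), 0 < L → ∀ F ⊆ cube a L, MeasurableSet F →
      2 * volume F ≤ volume (cube a L) → μ F ≤ ρ * μ (cube a L))
    {b : (Fin n → ℝ) → 𝕜} (hb : LocallyIntegrable b) {D : ℝ≥0∞} (hD0 : D ≠ 0) (hD : D ≠ ∞)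
    (β : (Fin n → ℝ) → ℝ → 𝕜)
    (hβ : ∀ (a : Fin n → ℝ) (L : ℝ), 0 < L →
      ∫⁻ x in cube a L, ‖b x - β a L‖ₑ ≤ D * volume (cube a L)) (k : ℕ) :
    ∀ (a : Fin n → ℝ) (L : ℝ), 0 < L →
      μ {x ∈ cube a L | (k : ℝ≥0∞) * (D + 2 ^ n * (2 * D)) < ‖b x - β a L‖ₑ} ≤
        ρ ^ k * μ (cube a L) := by
  induction k with
  | zero =>
    intro a L _
    rw [pow_zero, one_mul]
    exact measure_mono fun x hx => hx.1
  | succ k ih =>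
    intro a L hL
    -- Bounds the jump of β from the cube to a stopping cube: D for the oscillation on the stopping
    -- cube itself, and 2^n · 2D from its parent, which has not been stopped.
    set c := D + 2 ^ n * (2 * D) with hc
    have hbm : AEMeasurable (fun y => ‖b y - β a L‖ₑ) volume :=
      (hb.aestronglyMeasurable.sub aestronglyMeasurable_const).enorm
    -- Calderón–Zygmund stopping condition: the mean of |b - β| over the generation-j cube around x
    -- exceeds 2D.
    set P : (Fin n → ℝ) → ℕ → Prop := fun x j =>
      2 * D * volume (subcube a L j (cubeIndex a L j x)) <
        ∫⁻ y in subcube a L j (cubeIndex a L j x), ‖b y - β a L‖ₑ with hP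
    -- The maximal stopping cubes, recorded by generation and index: no earlier generation satisfies
    -- the stopping condition.
    set I : Set (ℕ × (Fin n → ℤ)) := {q | ∃ x ∈ cube a L, cubeIndex a L q.1 x = q.2 ∧ P x q.1 ∧
      ∀ j < q.1, ¬ P x j} with hI
    have hPcongr : ∀ {x y : Fin n → ℝ} {j k : ℕ}, j ≤ k → cubeIndex a L k x = cubeIndex a L k y →
        (P x j ↔ P y j) := by
      intro x y j k hjk h
      simp only [hP, cubeIndex_eq_of_le hL hjk h]
    have hQ : ∀ {x : Fin n → ℝ}, x ∈ cube a L ↔ cubeIndex a L 0 x = 0 := by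
      intro x; rw [← mem_subcube_iff hL, subcube_zero]
    have hP0 : ∀ x ∈ cube a L, ¬ P x 0 := by
      intro x hx
      simp only [hP, hQ.1 hx, subcube_zero, not_lt]
      refine (hβ a L hL).trans ?_
      gcongr
      exact le_mul_of_one_le_left' (by norm_num)
    have hmin : ∀ q ∈ I, ∀ y ∈ subcube a L q.1 q.2, y ∈ cube a L ∧ P y q.1 ∧ ∀ j < q.1, ¬ P y j := by
      rintro ⟨k, z⟩ ⟨x, hx, hxz, hPx, hPj⟩ y hy
      rw [mem_subcube_iff hL] at hy
      simp only at hxz hPx hPj hy ⊢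
      have hxy : cubeIndex a L k x = cubeIndex a L k y := hxz.trans hy.symm
      refine ⟨?_, (hPcongr le_rfl hxy).1 hPx, fun j hj => ?_⟩
      · rw [hQ] at hx ⊢
        rw [← cubeIndex_eq_of_le hL (Nat.zero_le k) hxy, hx]
      · rw [← hPcongr hj.le hxy]; exact hPj j hj
    have hdisj : I.PairwiseDisjoint fun q => subcube a L q.1 q.2 := by
      rintro ⟨k₁, z₁⟩ h₁ ⟨k₂, z₂⟩ h₂ hne
      refine Set.disjoint_left.2 fun y hy₁ hy₂ => hne ?_
      obtain ⟨-, p₁, m₁⟩ := hmin _ h₁ y hy₁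
      obtain ⟨-, p₂, m₂⟩ := hmin _ h₂ y hy₂
      have hk : k₁ = k₂ := by
        rcases lt_trichotomy k₁ k₂ with h | h | h
        · exact absurd p₁ (m₂ _ h)
        · exact h
        · exact absurd p₂ (m₁ _ h)
      subst hk
      rw [mem_subcube_iff hL] at hy₁ hy₂
      simp only at hy₁ hy₂
      rw [← hy₁, ← hy₂]
    have hcount : I.Countable := Set.to_countable I
    have hms : ∀ q : ℕ × (Fin n → ℤ), MeasurableSet (subcube a L q.1 q.2) :=
      fun q => measurableSet_cube _ _
    set E : Set (Fin n → ℝ) := ⋃ q ∈ I, subcube a L q.1 q.2 with hE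
    have hEm : MeasurableSet E := MeasurableSet.biUnion hcount fun q _ => hms q
    have hEQ : E ⊆ cube a L := Set.iUnion₂_subset fun q hq y hy => (hmin q hq y hy).1
    have hmemE : ∀ x ∈ cube a L, (∃ j, P x j) → x ∈ E := by
      intro x hx hj
      classical
      refine Set.mem_biUnion (x := (Nat.find hj, cubeIndex a L (Nat.find hj) x)) ?_
        ((mem_subcube_iff hL).2 rfl)
      exact ⟨x, hx, rfl, Nat.find_spec hj, fun j h => Nat.find_min hj h⟩
    -- Chebyshev: the mean over every stopping cube exceeds 2D, while the mean over the whole cube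
    -- is at most D.
    have hvolE : 2 * volume E ≤ volume (cube a L) := by
      have h1 : 2 * D * volume E ≤ D * volume (cube a L) := by
        rw [hE, measure_biUnion hcount hdisj fun q _ => hms q, ← ENNReal.tsum_mul_left]
        calc _ ≤ ∑' q : I, ∫⁻ y in subcube a L q.1.1 q.1.2, ‖b y - β a L‖ₑ := by
              refine ENNReal.tsum_le_tsum fun q => ?_
              obtain ⟨x, -, hxz, hPx, -⟩ := q.2
              simp only [hP, hxz] at hPx
              exact hPx.le
          _ = ∫⁻ y in E, ‖b y - β a L‖ₑ := by
              rw [hE, lintegral_biUnion hcount (fun q _ => hms q) hdisj]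
          _ ≤ _ := (lintegral_mono_set hEQ).trans (hβ a L hL)
      rw [mul_comm 2 D, mul_assoc] at h1
      exact (ENNReal.mul_le_mul_iff_right hD0 hD).1 h1
    -- A stopping cube has positive generation, since the whole cube never stops; hence it has a
    -- parent, and by maximality the mean over the parent is at most 2D.
    have hβi : ∀ q ∈ I, ‖β (fun i => a i + L / 2 ^ q.1 * q.2 i) (L / 2 ^ q.1) - β a L‖ₑ ≤ c := by
      rintro ⟨k, z⟩ hq
      obtain ⟨x, hx, hxz, hPx, hPj⟩ := hq
      simp only at hxz hPx hPj ⊢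
      obtain ⟨j, rfl⟩ : ∃ j, k = j + 1 := by
        refine Nat.exists_eq_succ_of_ne_zero ?_
        rintro rfl
        exact hP0 x hx hPx
      have hpar := hPj j (Nat.lt_succ_self j)
      simp only [hP, not_lt] at hpar
      have hsub : subcube a L (j + 1) z ⊆ subcube a L j (cubeIndex a L j x) := by
        intro y hy
        rw [mem_subcube_iff hL] at hy ⊢
        exact cubeIndex_eq_of_succ hL (hy.trans hxz.symm)
      have hl : 0 < L / 2 ^ (j + 1) := by positivity
      have hV0 : volume (subcube a L (j + 1) z) ≠ 0 := by
        rw [volume_subcube]; exact pow_ne_zero _ (by simp; positivity)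
      have hVt : volume (subcube a L (j + 1) z) ≠ ∞ := by
        rw [volume_subcube]; exact ENNReal.pow_ne_top ENNReal.ofReal_ne_top
      have hVV : volume (subcube a L j (cubeIndex a L j x)) =
          2 ^ n * volume (subcube a L (j + 1) z) := by
        rw [volume_subcube, volume_subcube, ← mul_pow]
        congr 1
        rw [show (2 : ℝ≥0∞) = ENNReal.ofReal 2 by simp, ← ENNReal.ofReal_mul (by norm_num)]
        congr 1
        rw [pow_succ]; field_simp
      refine (ENNReal.mul_le_mul_iff_left hV0 hVt).1 ?_
      set β' := β (fun i => a i + L / 2 ^ (j + 1) * z i) (L / 2 ^ (j + 1)) with hβ'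
      rw [← setLIntegral_const, hc, add_mul]
      calc ∫⁻ _ in subcube a L (j + 1) z, ‖β' - β a L‖ₑ
          ≤ ∫⁻ y in subcube a L (j + 1) z, (‖b y - β'‖ₑ + ‖b y - β a L‖ₑ) := by
            refine lintegral_mono fun y => ?_
            calc ‖β' - β a L‖ₑ = ‖(b y - β a L) - (b y - β')‖ₑ := by congr 1; abel
              _ ≤ _ := by rw [add_comm]; exact enorm_sub_le
        _ = (∫⁻ y in subcube a L (j + 1) z, ‖b y - β'‖ₑ) +
            ∫⁻ y in subcube a L (j + 1) z, ‖b y - β a L‖ₑ := lintegral_add_right' _ hbm.restrict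
        _ ≤ _ := by
            refine add_le_add (hβ (fun i => a i + L / 2 ^ (j + 1) * z i) _ hl) ((lintegral_mono_set hsub).trans (hpar.trans ?_))
            rw [hVV]; exact le_of_eq (by ring)
    have hnull : ∀ᵐ x ∂μ, x ∈ cube a L → x ∉ E → ‖b x - β a L‖ₑ ≤ 2 * D := by
      filter_upwards [hμ.ae_le (ae_enorm_sub_le_of_subcube_average_le (a := a) hL hb (β a L) (2 * D))]
        with x hx hxQ hxE
      refine hx fun j => not_lt.1 fun hj => hxE (hmemE x hxQ ⟨j, hj⟩)
    have hct : c ≠ ∞ := by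
      rw [hc]
      exact ENNReal.add_ne_top.2 ⟨hD, ENNReal.mul_ne_top (by simp) (ENNReal.mul_ne_top (by simp) hD)⟩
    have hDc : 2 * D ≤ c := by
      rw [hc]
      exact le_add_left (le_mul_of_one_le_left' (one_le_pow₀ (by norm_num)))
    -- Off E the oscillation is at most 2D ≤ c, so an oscillation above (k+1)c can only occur in a
    -- stopping cube. There the jump of β costs at most c, which leaves more than kc for the
    -- induction hypothesis.
    have hsub : ∀ᵐ x ∂μ, x ∈ {x ∈ cube a L | ((k + 1 : ℕ) : ℝ≥0∞) * c < ‖b x - β a L‖ₑ} →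
        x ∈ ⋃ q ∈ I, {x ∈ subcube a L q.1 q.2 | (k : ℝ≥0∞) * c <
          ‖b x - β (fun i => a i + L / 2 ^ q.1 * q.2 i) (L / 2 ^ q.1)‖ₑ} := by
      filter_upwards [hnull] with x hx hxS
      obtain ⟨hxQ, hxc⟩ := hxS
      push_cast at hxc
      rw [add_mul, one_mul] at hxc
      by_cases hxE : x ∈ E
      · obtain ⟨q, hq, hxq⟩ := Set.mem_iUnion₂.1 hxE
        refine Set.mem_biUnion hq ⟨hxq, ?_⟩
        set β' := β (fun i => a i + L / 2 ^ q.1 * q.2 i) (L / 2 ^ q.1)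
        have h1 : ‖b x - β a L‖ₑ ≤ ‖b x - β'‖ₑ + c := by
          calc ‖b x - β a L‖ₑ = ‖(b x - β') + (β' - β a L)‖ₑ := by congr 1; abel
            _ ≤ _ := (enorm_add_le _ _).trans (add_le_add le_rfl (hβi q hq))
        exact (ENNReal.add_lt_add_iff_right hct).1 (hxc.trans_le h1)
      · exact absurd (hxc.trans_le ((hx hxQ hxE).trans hDc)) (not_lt.2 le_add_self)
    calc _ ≤ μ (⋃ q ∈ I, {x ∈ subcube a L q.1 q.2 | (k : ℝ≥0∞) * c <
          ‖b x - β (fun i => a i + L / 2 ^ q.1 * q.2 i) (L / 2 ^ q.1)‖ₑ}) := measure_mono_ae hsub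
      _ ≤ ∑' q : I, ρ ^ k * μ (subcube a L q.1.1 q.1.2) :=
          (measure_biUnion_le _ hcount _).trans
            (ENNReal.tsum_le_tsum fun q => ih _ _ (by positivity))
      _ = ρ ^ k * μ E := by
          rw [ENNReal.tsum_mul_left, hE, measure_biUnion hcount hdisj fun q _ => hms q]
      _ ≤ ρ ^ k * (ρ * μ (cube a L)) := by
          gcongr; exact hρ a L hL E hEQ hEm hvolE
      _ = _ := by rw [pow_succ, mul_assoc]

/-- The John–Nirenberg inequality: moments of the oscillation. -/
theorem lintegral_cube_enorm_sub_rpow_le {μ : Measure (Fin n → ℝ)} (hμ : μ ≪ volume) {ρ : ℝ≥0∞}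
    (hρ1 : ρ < 1)
    (hρ : ∀ (a : Fin n → ℝ) (L : ℝ), 0 < L → ∀ F ⊆ cube a L, MeasurableSet F →
      2 * volume F ≤ volume (cube a L) → μ F ≤ ρ * μ (cube a L))
    {b : (Fin n → ℝ) → 𝕜} (hb : LocallyIntegrable b) {D : ℝ≥0∞} (hD : D ≠ ∞)
    (β : (Fin n → ℝ) → ℝ → 𝕜)
    (hβ : ∀ (a : Fin n → ℝ) (L : ℝ), 0 < L →
      ∫⁻ x in cube a L, ‖b x - β a L‖ₑ ≤ D * volume (cube a L)) {u : ℝ} (hu : 0 < u) :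
    ∃ C : ℝ≥0∞, C < ∞ ∧ ∀ (a : Fin n → ℝ) (L : ℝ), 0 < L →
      ∫⁻ x in cube a L, ‖b x - β a L‖ₑ ^ u ∂μ ≤ C * μ (cube a L) := by
  -- A vanishing D may be replaced by 1; the level step c is then positive and can be divided by.
  wlog hD0 : D ≠ 0 generalizing D
  · rw [not_not] at hD0
    subst hD0
    exact this (D := 1) (by simp) (fun a L hL => (hβ a L hL).trans (by simp)) (by simp)
  set c := D + 2 ^ n * (2 * D) with hc
  have hct : c ≠ ∞ := by
    rw [hc]
    exact ENNReal.add_ne_top.2 ⟨hD, ENNReal.mul_ne_top (by simp) (ENNReal.mul_ne_top (by simp) hD)⟩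
  have hc0 : c ≠ 0 := by rw [hc]; simp [hD0]
  refine ⟨∑' k : ℕ, (((k : ℝ≥0∞) + 1) * c) ^ u * ρ ^ k, ?_, fun a L hL => ?_⟩
  · have := tsum_add_one_rpow_mul_pow_lt_top u hρ1
    calc _ = ∑' k : ℕ, c ^ u * (((k : ℝ≥0∞) + 1) ^ u * ρ ^ k) := by
          congr with k
          rw [ENNReal.mul_rpow_of_nonneg _ _ hu.le]; ring
      _ < ∞ := by
          rw [ENNReal.tsum_mul_left]
          exact ENNReal.mul_lt_top (ENNReal.rpow_lt_top_of_nonneg hu.le hct) this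
  -- Layers of height c: the term for the least k with y ≤ (k+1)c dominates y^u.
  have hpt : ∀ y : ℝ≥0∞, y ≠ ∞ → y ^ u ≤ ∑' k : ℕ, (((k : ℝ≥0∞) + 1) * c) ^ u *
      (if (k : ℝ≥0∞) * c < y then 1 else 0) := by
    intro y hy
    rcases eq_or_ne y 0 with rfl | hy0
    · simp [hu]
    classical
    have hex : ∃ k : ℕ, y ≤ ((k : ℝ≥0∞) + 1) * c := by
      obtain ⟨k, hk⟩ := ENNReal.exists_nat_gt (ENNReal.div_ne_top hy hc0)
      refine ⟨k, ?_⟩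
      rw [← ENNReal.div_le_iff hc0 hct]
      exact hk.le.trans le_self_add
    have h1 := Nat.find_spec hex
    have h2 : ((Nat.find hex : ℕ) : ℝ≥0∞) * c < y := by
      rcases Nat.eq_zero_or_pos (Nat.find hex) with h | h
      · rw [h]; simpa using pos_iff_ne_zero.2 hy0
      · have := Nat.find_min hex (Nat.sub_lt h one_pos)
        rw [not_le] at this
        convert this using 2
        exact_mod_cast (Nat.sub_add_cancel h).symm
    refine le_trans ?_ (ENNReal.le_tsum (Nat.find hex))
    rw [if_pos h2, mul_one]
    gcongr
  have hbm : AEMeasurable (fun y => ‖b y - β a L‖ₑ) (μ.restrict (cube a L)) :=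
    ((hb.aestronglyMeasurable.sub aestronglyMeasurable_const).enorm.mono_ac hμ).restrict
  calc ∫⁻ x in cube a L, ‖b x - β a L‖ₑ ^ u ∂μ
      ≤ ∫⁻ x in cube a L, ∑' k : ℕ, (((k : ℝ≥0∞) + 1) * c) ^ u *
        (if (k : ℝ≥0∞) * c < ‖b x - β a L‖ₑ then 1 else 0) ∂μ :=
        lintegral_mono fun x => hpt _ enorm_ne_top
    _ = ∑' k : ℕ, (((k : ℝ≥0∞) + 1) * c) ^ u * ∫⁻ x in cube a L,
        (if (k : ℝ≥0∞) * c < ‖b x - β a L‖ₑ then 1 else 0) ∂μ := by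
        have hm : ∀ k : ℕ, AEMeasurable (fun x => if (k : ℝ≥0∞) * c < ‖b x - β a L‖ₑ
            then (1 : ℝ≥0∞) else 0) (μ.restrict (cube a L)) := fun k =>
          (Measurable.ite measurableSet_Ioi measurable_const measurable_const :
            Measurable fun y : ℝ≥0∞ => if (k : ℝ≥0∞) * c < y then (1 : ℝ≥0∞) else 0).comp_aemeasurable
              hbm
        rw [lintegral_tsum fun k => (hm k).const_mul _]
        congr with k
        rw [lintegral_const_mul'' _ (hm k)]
    _ ≤ ∑' k : ℕ, (((k : ℝ≥0∞) + 1) * c) ^ u * (ρ ^ k * μ (cube a L)) := by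
        refine ENNReal.tsum_le_tsum fun k => mul_le_mul_right ?_ _
        refine le_trans ?_ (measure_lt_enorm_sub_le hμ hρ hb hD0 hD β hβ k a L hL)
        have := lintegral_indicator_const_le (μ := μ.restrict (cube a L))
          {x | (k : ℝ≥0∞) * c < ‖b x - β a L‖ₑ} 1
        rw [one_mul, Measure.restrict_apply' (measurableSet_cube a L), Set.inter_comm] at this
        refine le_trans (le_of_eq (lintegral_congr fun x => ?_)) this
        simp [Set.indicator]
    _ = _ := by
        rw [← ENNReal.tsum_mul_right]
        congr with k
        ring

end Cubes

/-! ### Functions of bounded mean oscillation and `A_∞` weights -/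

section BMO

variable {n : ℕ} {𝕜 : Type*} [RCLike 𝕜]

/-- The half-open cube with lower corner `a` and side `L` in Euclidean space. -/
def ecube (a : Fin n → ℝ) (L : ℝ) : Set (Rn n) := WithLp.ofLp ⁻¹' cube a L

theorem measurableSet_ecube (a : Fin n → ℝ) (L : ℝ) : MeasurableSet (ecube a L) :=
  (MeasurableEquiv.toLp 2 (Fin n → ℝ)).symm.measurable (measurableSet_cube a L)

theorem volume_ecube (a : Fin n → ℝ) (L : ℝ) : volume (ecube a L) = ENNReal.ofReal L ^ n := by
  rw [ecube, (PiLp.volume_preserving_ofLp (Fin n)).measure_preimage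
    (measurableSet_cube a L).nullMeasurableSet, volume_cube]

theorem volume_ecube_ne_top (a : Fin n → ℝ) (L : ℝ) : volume (ecube a L) ≠ ∞ := by
  rw [volume_ecube]; exact ENNReal.pow_ne_top ENNReal.ofReal_ne_top

theorem volume_ecube_ne_zero (a : Fin n → ℝ) {L : ℝ} (hL : 0 < L) : volume (ecube a L) ≠ 0 := by
  rw [volume_ecube]; exact pow_ne_zero _ (by simpa using hL)

/-- The centre of a cube. -/
def ecubeCenter (a : Fin n → ℝ) (L : ℝ) : Rn n := WithLp.toLp 2 fun i => a i + L / 2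

theorem ecube_subset_ball (a : Fin n → ℝ) {L : ℝ} (hL : 0 < L) :
    ecube a L ⊆ Metric.ball (ecubeCenter a L) ((n + 1) * L) := by
  intro x hx
  rw [Metric.mem_ball, EuclideanSpace.dist_eq, Real.sqrt_lt' (by positivity)]
  calc ∑ i, dist (x i) (ecubeCenter a L i) ^ 2 ≤ ∑ _i : Fin n, L ^ 2 := by
        refine Finset.sum_le_sum fun i _ => ?_
        have hi := hx i trivial
        simp only [Set.mem_Ico] at hi
        rw [Real.dist_eq, sq_abs]
        refine sq_le_sq' ?_ ?_ <;> simp only [ecubeCenter] <;> linarith [hi.1, hi.2]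
    _ = n * L ^ 2 := by simp
    _ < _ := by
        have : 0 < L ^ 2 := by positivity
        have hn : (0 : ℝ) ≤ n := by positivity
        nlinarith [mul_nonneg hn hn, mul_nonneg (mul_nonneg hn hn) this.le, mul_nonneg hn this.le]

theorem ball_subset_ecube (y : Rn n) {r : ℝ} :
    Metric.ball y r ⊆ ecube (fun i => y i - r) (2 * r) := by
  intro x hx i _
  have h1 : |x i - y i| < r := by
    have := PiLp.norm_apply_le (x - y) i
    rw [← dist_eq_norm] at this
    exact this.trans_lt hx
  rw [abs_lt] at h1
  constructor <;> linarith [h1.1, h1.2]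

theorem volume_ball_ecubeCenter (a : Fin n → ℝ) {L : ℝ} (hL : 0 < L) :
    volume (Metric.ball (ecubeCenter a L) ((n + 1) * L)) =
      (ENNReal.ofReal ((n + 1) ^ n) * volume (Metric.ball (0 : Rn n) 1)) * volume (ecube a L) := by
  rw [volume_ball_eq _ (by positivity), volume_ecube, mul_pow, ENNReal.ofReal_mul (by positivity),
    ENNReal.ofReal_pow hL.le]
  ring

/-- Bounded mean oscillation on cubes. -/
theorem IsBMO.exists_ecube {b : Rn n → 𝕜} (hb : IsBMO b) :
    ∃ D : ℝ≥0∞, D ≠ ∞ ∧ ∃ β : (Fin n → ℝ) → ℝ → 𝕜, ∀ (a : Fin n → ℝ) (L : ℝ), 0 < L →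
      ∫⁻ x in ecube a L, ‖b x - β a L‖ₑ ≤ D * volume (ecube a L) := by
  obtain ⟨hloc, C, hC⟩ := hb
  refine ⟨ENNReal.ofReal C * (ENNReal.ofReal ((n + 1) ^ n) * volume (Metric.ball (0 : Rn n) 1)),
    ?_, fun a L => ⨍ z in Metric.ball (ecubeCenter a L) ((n + 1) * L), b z ∂volume,
    fun a L hL => ?_⟩
  · exact ENNReal.mul_ne_top ENNReal.ofReal_ne_top
      (ENNReal.mul_ne_top ENNReal.ofReal_ne_top (volume_ball_ne_top _ _))
  have hr : (0 : ℝ) < (n + 1) * L := by positivity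
  set B := Metric.ball (ecubeCenter a L) ((n + 1) * L) with hB
  set β := ⨍ z in B, b z ∂volume
  have hV0 : volume B ≠ 0 := volume_ball_pos _ hr
  have hVt : volume B ≠ ∞ := volume_ball_ne_top _ _
  have hint : IntegrableOn (fun y => b y - β) B :=
    ((hloc.integrableOn_isCompact (isCompact_closedBall _ _)).mono_set
      Metric.ball_subset_closedBall).sub (integrableOn_const hVt (by simp))
  calc ∫⁻ x in ecube a L, ‖b x - β‖ₑ ≤ ∫⁻ x in B, ‖b x - β‖ₑ :=
        lintegral_mono_set (ecube_subset_ball a hL)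
    _ = ENNReal.ofReal (⨍ x in B, ‖b x - β‖ ∂volume) * volume B := by
        rw [setAverage_eq, smul_eq_mul, ENNReal.ofReal_mul (by positivity), measureReal_def,
          ← ofReal_integral_norm_eq_lintegral_enorm hint,
          ENNReal.ofReal_inv_of_pos (ENNReal.toReal_pos hV0 hVt), ENNReal.ofReal_toReal hVt,
          mul_comm, ← mul_assoc, ENNReal.mul_inv_cancel hV0 hVt, one_mul]
    _ ≤ ENNReal.ofReal C * volume B := by
        gcongr
        exact hC _ _ hr
    _ = _ := by rw [hB, volume_ball_ecubeCenter a hL]; ring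

/-- Transport along the measure-preserving identification of Euclidean space with `Fin n → ℝ`; the
stopping-time argument lives on the latter, where the sup norm makes closed balls into cubes. -/
theorem lintegral_ecube_enorm_sub_rpow_le {μ : Measure (Rn n)} (hμ : μ ≪ volume) {ρ : ℝ≥0∞}
    (hρ1 : ρ < 1)
    (hρ : ∀ (a : Fin n → ℝ) (L : ℝ), 0 < L → ∀ F ⊆ ecube a L, MeasurableSet F →
      2 * volume F ≤ volume (ecube a L) → μ F ≤ ρ * μ (ecube a L))
    {b : Rn n → 𝕜} (hb : LocallyIntegrable b) {D : ℝ≥0∞} (hD : D ≠ ∞)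
    {β : (Fin n → ℝ) → ℝ → 𝕜}
    (hβ : ∀ (a : Fin n → ℝ) (L : ℝ), 0 < L →
      ∫⁻ x in ecube a L, ‖b x - β a L‖ₑ ≤ D * volume (ecube a L)) {u : ℝ} (hu : 0 < u) :
    ∃ C : ℝ≥0∞, C < ∞ ∧ ∀ (a : Fin n → ℝ) (L : ℝ), 0 < L →
      ∫⁻ x in ecube a L, ‖b x - β a L‖ₑ ^ u ∂μ ≤ C * μ (ecube a L) := by
  set e : Rn n ≃ᵐ (Fin n → ℝ) := (MeasurableEquiv.toLp 2 (Fin n → ℝ)).symm with he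
  have hvol : Measure.map e volume = (volume : Measure (Fin n → ℝ)) :=
    (PiLp.volume_preserving_ofLp (Fin n)).map_eq
  have hint : ∀ (ν : Measure (Rn n)) (a : Fin n → ℝ) (L : ℝ) (f : Rn n → ℝ≥0∞),
      ∫⁻ x in cube a L, f (e.symm x) ∂(Measure.map e ν) = ∫⁻ x in ecube a L, f x ∂ν := by
    intro ν a L f
    rw [MeasurableEquiv.restrict_map, lintegral_map_equiv]
    simp only [MeasurableEquiv.symm_apply_apply]
    rfl
  have hmeas : ∀ (ν : Measure (Rn n)) (F : Set (Fin n → ℝ)), Measure.map e ν F = ν (e ⁻¹' F) :=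
    fun ν F => e.map_apply F
  have hloc : LocallyIntegrable (fun x => b (e.symm x)) (volume : Measure (Fin n → ℝ)) := by
    rw [← hvol]
    have := locallyIntegrable_map_homeomorph (PiLp.homeomorph 2 (fun _ : Fin n => ℝ))
      (f := fun x : Fin n → ℝ => b (e.symm x)) (μ := volume)
    refine this.2 ?_
    exact hb
  obtain ⟨C, hC, h⟩ := lintegral_cube_enorm_sub_rpow_le (μ := Measure.map e μ) (ρ := ρ)
    (b := fun x => b (e.symm x)) (D := D) (u := u)
    (by rw [← hvol]; exact hμ.map e.measurable) hρ1 (fun a L hL F hF hFm hvF => by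
      rw [hmeas, hmeas]
      refine hρ a L hL (e ⁻¹' F) (Set.preimage_mono hF) (e.measurable hFm) ?_
      rw [← hmeas]
      refine le_trans ?_ (hvF.trans (le_of_eq ?_))
      · rw [hvol]
      · rw [volume_cube, volume_ecube]) hloc hD β (fun a L hL => by
      rw [← hvol, hint volume a L fun x => ‖b x - β a L‖ₑ, hvol]
      refine (hβ a L hL).trans (le_of_eq ?_)
      rw [volume_cube, volume_ecube]) hu
  refine ⟨C, hC, fun a L hL => ?_⟩
  have := h a L hL
  rwa [hint μ a L fun x => ‖b x - β a L‖ₑ ^ u, hmeas] at this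

/-- The John–Nirenberg inequality on balls. -/
theorem IsBMO.exists_ballAvg_rpow_le {b : Rn n → 𝕜} (hb : IsBMO b) {u : ℝ} (hu : 0 < u) :
    ∃ C : ℝ≥0∞, C < ∞ ∧ ∀ (y : Rn n) (r : ℝ), 0 < r →
      ∃ β : 𝕜, ballAvg r (fun z => ‖b z - β‖ₑ ^ u) y ≤ C := by
  obtain ⟨D, hD, β, hβ⟩ := hb.exists_ecube
  -- For Lebesgue measure the half-filling condition holds with proportion 1/2.
  obtain ⟨C, hC, h⟩ := lintegral_ecube_enorm_sub_rpow_le (μ := (volume : Measure (Rn n)))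
    Measure.AbsolutelyContinuous.rfl (ρ := 2⁻¹) (by simp) (fun a L hL F _ _ hF => by
      rw [mul_comm, ← div_eq_mul_inv]
      exact (ENNReal.le_div_iff_mul_le (by simp) (by simp)).2 (by rwa [mul_comm])) hb.1 hD hβ hu
  set v := volume (Metric.ball (0 : Rn n) 1) with hv
  have hv0 : v ≠ 0 := volume_ball_pos _ one_pos
  have hvt : v ≠ ∞ := volume_ball_ne_top _ _
  refine ⟨C * (2 ^ n / v), ENNReal.mul_lt_top hC (ENNReal.div_lt_top (by simp) hv0),
    fun y r hr => ⟨β (fun i => y i - r) (2 * r), ?_⟩⟩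
  rw [ballAvg_eq]
  refine ENNReal.div_le_of_le_mul ((lintegral_mono_set (ball_subset_ecube y)).trans
    ((h _ _ (by positivity)).trans (le_of_eq ?_)))
  rw [volume_ecube, volume_ball_eq y hr, ENNReal.ofReal_mul (by norm_num), mul_pow,
    ENNReal.ofReal_pow hr.le, ENNReal.ofReal_ofNat, mul_assoc, ENNReal.div_eq_inv_mul,
    ← hv]
  congr 1
  rw [show v⁻¹ * 2 ^ n * (ENNReal.ofReal r ^ n * v) = (v⁻¹ * v) * (2 ^ n * ENNReal.ofReal r ^ n) by
    ring, ENNReal.inv_mul_cancel hv0 hvt, one_mul]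

theorem weightMeasure_apply (w : Rn n → ℝ) {s : Set (Rn n)} (hs : MeasurableSet s) :
    weightMeasure w s = ∫⁻ x in s, ENNReal.ofReal (w x) :=
  withDensity_apply _ hs

theorem IsWeight.weightMeasure_lt_top {w : Rn n → ℝ} (hw : IsWeight w) {s : Set (Rn n)}
    (hs : Bornology.IsBounded s) : weightMeasure w s < ∞ := by
  obtain ⟨R, hR⟩ := hs.subset_closedBall 0
  refine (measure_mono hR).trans_lt ?_
  rw [weightMeasure_apply _ Metric.isClosed_closedBall.measurableSet]
  have := (hw.2.2.integrableOn_isCompact (isCompact_closedBall (0 : Rn n) R)).2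
  refine lt_of_le_of_lt (lintegral_mono fun x => ?_) this
  exact Real.ofReal_le_enorm _

theorem measure_sdiff_add_of_subset {α : Type*} [MeasurableSpace α] {μ : Measure α} {s t : Set α}
    (ht : MeasurableSet t) (h : t ⊆ s) : μ (s \ t) + μ t = μ s := by
  rw [← measure_inter_add_sdiff s ht, Set.inter_eq_right.2 h, add_comm]

/-- For p > 1, Hölder's inequality for 1 = w^{1/p} w^{-1/p} on E, where the dual factor is enlarged
from E to the ball and then estimated by the A_p condition. For p = 1 the pointwise lower bound on w
is integrated over E. -/
theorem MuckenhouptA.exists_le_mul {p : ℝ} {w : Rn n → ℝ} (hw : MuckenhouptA p w) :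
    ∃ K : ℝ≥0∞, K < ∞ ∧ ∀ (y : Rn n) (r : ℝ), 0 < r → ∀ E ⊆ Metric.ball y r, MeasurableSet E →
      weightMeasure w (Metric.ball y r) * volume E ^ p ≤
        K * volume (Metric.ball y r) ^ p * weightMeasure w E := by
  obtain ⟨hwt, hp, C, hC, h⟩ := hw
  have hWm : AEMeasurable (fun x => ENNReal.ofReal (w x)) volume :=
    hwt.2.2.aestronglyMeasurable.aemeasurable.ennreal_ofReal
  refine ⟨C ^ p, ENNReal.rpow_lt_top_of_nonneg (by linarith) hC.ne, fun y r hr E hE hEm => ?_⟩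
  have hB : MeasurableSet (Metric.ball y r) := Metric.isOpen_ball.measurableSet
  have hV0 := volume_ball_pos y hr
  have hVt := volume_ball_ne_top y r
  rw [weightMeasure_apply _ hB, weightMeasure_apply _ hEm]
  have hy := h y r hr
  set V := volume (Metric.ball y r)
  by_cases hp1 : p = 1
  · subst hp1
    simp only [if_true, setLAverage_eq, ENNReal.rpow_one] at hy ⊢
    have h1 : ∫⁻ _ in E, (∫⁻ x in Metric.ball y r, ENNReal.ofReal (w x)) / V ≤
        ∫⁻ x in E, C * ENNReal.ofReal (w x) :=
      lintegral_mono_ae (ae_restrict_of_ae_restrict_of_subset hE hy)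
    rw [setLIntegral_const, lintegral_const_mul'' _ hWm.restrict] at h1
    calc _ = V * ((∫⁻ x in Metric.ball y r, ENNReal.ofReal (w x)) / V * volume E) := by
          rw [← mul_assoc, ENNReal.mul_div_cancel hV0 hVt]
      _ ≤ V * (C * ∫⁻ x in E, ENNReal.ofReal (w x)) := by gcongr
      _ = _ := by ring
  · have hp1' : 1 < p := lt_of_le_of_ne hp (Ne.symm hp1)
    have hp0 : 0 < p := by linarith
    have hpq : p.HolderConjugate p.conjExponent := Real.HolderConjugate.conjExponent hp1'
    set p' := p.conjExponent
    have hp'0 : 0 < p' := hpq.symm.pos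
    simp only [if_neg hp1, setLAverage_eq] at hy
    set X := ∫⁻ x in Metric.ball y r, ENNReal.ofReal (w x)
    set Y := ∫⁻ x in Metric.ball y r, ENNReal.ofReal (w x) ^ (1 - p')
    have hXY : X ^ (1 / p) * Y ^ (1 / p') ≤ C * V := by
      rw [ENNReal.div_rpow_of_nonneg _ _ (by positivity),
        ENNReal.div_rpow_of_nonneg _ _ (by positivity)] at hy
      have e : V ^ (1 / p) * V ^ (1 / p') = V := by
        rw [← ENNReal.rpow_add _ _ hV0 hVt, one_div, one_div, hpq.inv_add_inv_eq_one,
          ENNReal.rpow_one]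
      have hV1 : V ^ (1 / p) ≠ 0 := by simp [hV0, hVt]
      have hV2 : V ^ (1 / p) ≠ ∞ := by simp [hV0, hVt]
      have hV3 : V ^ (1 / p') ≠ 0 := by simp [hV0, hVt]
      have hV4 : V ^ (1 / p') ≠ ∞ := by simp [hV0, hVt]
      calc X ^ (1 / p) * Y ^ (1 / p') = (V ^ (1 / p) * (X ^ (1 / p) / V ^ (1 / p))) *
            (V ^ (1 / p') * (Y ^ (1 / p') / V ^ (1 / p'))) := by
            rw [ENNReal.mul_div_cancel hV1 hV2, ENNReal.mul_div_cancel hV3 hV4]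
        _ = (X ^ (1 / p) / V ^ (1 / p) * (Y ^ (1 / p') / V ^ (1 / p'))) *
            (V ^ (1 / p) * V ^ (1 / p')) := by ring
        _ ≤ C * V := by rw [e]; gcongr
    have hE1 : volume E ≤ (∫⁻ x in E, ENNReal.ofReal (w x)) ^ (1 / p) * Y ^ (1 / p') := by
      have hae : ∀ᵐ x ∂(volume.restrict E), (1 : ℝ≥0∞) =
          ENNReal.ofReal (w x) ^ (1 / p) * ENNReal.ofReal (w x) ^ (-(1 / p)) := by
        refine ae_restrict_of_ae ?_
        filter_upwards [hwt.2.1] with x hx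
        rw [← ENNReal.rpow_add _ _ (by simpa using hx) ENNReal.ofReal_ne_top]
        simp
      have hmul := ENNReal.lintegral_mul_le_Lp_mul_Lq (volume.restrict E) hpq
        (f := fun x => ENNReal.ofReal (w x) ^ (1 / p))
        (g := fun x => ENNReal.ofReal (w x) ^ (-(1 / p)))
        (hWm.pow_const _).restrict (hWm.pow_const _).restrict
      have hexp : -(1 / p) * p' = 1 - p' := by
        have := hpq.sub_one_mul_conj
        have h2 : p' = (p' - 1) * p := by linarith [hpq.symm.sub_one_mul_conj]
        field_simp
        linarith
      simp only [← ENNReal.rpow_mul, one_div_mul_cancel hp0.ne', ENNReal.rpow_one, hexp] at hmul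
      calc volume E = ∫⁻ _ in E, 1 := by simp
        _ = _ := lintegral_congr_ae hae
        _ ≤ _ := hmul
        _ ≤ _ := by
          gcongr
          exact lintegral_mono_set hE
    have h3 : X ^ (1 / p) * volume E ≤
        C * V * (∫⁻ x in E, ENNReal.ofReal (w x)) ^ (1 / p) := by
      calc _ ≤ X ^ (1 / p) * ((∫⁻ x in E, ENNReal.ofReal (w x)) ^ (1 / p) * Y ^ (1 / p')) := by
            gcongr
        _ = X ^ (1 / p) * Y ^ (1 / p') * (∫⁻ x in E, ENNReal.ofReal (w x)) ^ (1 / p) := by ring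
        _ ≤ _ := by gcongr
    have h4 := ENNReal.rpow_le_rpow h3 hp0.le
    simpa only [ENNReal.mul_rpow_of_nonneg _ _ hp0.le, ← ENNReal.rpow_mul,
      one_div_mul_cancel hp0.ne', ENNReal.rpow_one] using h4

/-- A set that fills at most half of a cube carries at most a fixed proportion of an `A_∞`
weight. -/
theorem MuckenhouptAInfty.exists_lt_one {w : Rn n → ℝ} (hw : MuckenhouptAInfty w) :
    ∃ ρ : ℝ≥0∞, ρ < 1 ∧ ∀ (a : Fin n → ℝ) (L : ℝ), 0 < L → ∀ F ⊆ ecube a L, MeasurableSet F →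
      2 * volume F ≤ volume (ecube a L) →
      weightMeasure w F ≤ ρ * weightMeasure w (ecube a L) := by
  obtain ⟨p, hp⟩ := hw
  have hp0 : 0 < p := by linarith [hp.2.1]
  obtain ⟨K, hK, h⟩ := hp.exists_le_mul
  set κ := ENNReal.ofReal ((n + 1) ^ n) * volume (Metric.ball (0 : Rn n) 1) with hκ
  have hκt : κ ≠ ∞ := ENNReal.mul_ne_top ENNReal.ofReal_ne_top (volume_ball_ne_top _ _)
  set K' := 1 + K * (κ * 2) ^ p with hK'
  have hK't : K' ≠ ∞ := ENNReal.add_ne_top.2 ⟨by simp, ENNReal.mul_ne_top hK.ne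
    (ENNReal.rpow_ne_top_of_nonneg hp0.le (ENNReal.mul_ne_top hκt (by simp)))⟩
  have hK'0 : K' ≠ 0 := by rw [hK']; simp
  refine ⟨1 - K'⁻¹, ENNReal.sub_lt_self (by simp) (by simp) (by simpa using hK't),
    fun a L hL F hF hFm hvF => ?_⟩
  have hQm := measurableSet_ecube a L
  have hV0 := volume_ecube_ne_zero a hL
  have hVt := volume_ecube_ne_top a L
  have hsub := ecube_subset_ball a hL
  -- The complement of F fills at least half of the cube and hence carries at least the proportion
  -- 1/K' of the weight, which leaves at most 1 - 1/K' for F. The summand 1 in K' keeps it away from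
  -- 0.
  have hvE : volume (ecube a L) ≤ 2 * volume (ecube a L \ F) := by
    have h1 : volume (ecube a L \ F) + volume F = volume (ecube a L) :=
      measure_sdiff_add_of_subset hFm hF
    have hFt : volume F ≠ ∞ := ((measure_mono hF).trans_lt hVt.lt_top).ne
    refine (ENNReal.add_le_add_iff_right (ENNReal.mul_ne_top (by simp) hFt : 2 * volume F ≠ ∞)).1 ?_
    rw [← mul_add, h1, two_mul (volume (ecube a L))]
    exact add_le_add le_rfl hvF
  have hE := h (ecubeCenter a L) ((n + 1) * L) (by positivity) (ecube a L \ F)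
    (Set.sdiff_subset.trans hsub) (hQm.diff hFm)
  rw [volume_ball_ecubeCenter a hL, ← hκ] at hE
  clear_value κ
  have hwQ : weightMeasure w (ecube a L) ≤ K' * weightMeasure w (ecube a L \ F) := by
    have hVp0 : volume (ecube a L) ^ p ≠ 0 := by simp [hV0, hp0, hp0.le]
    have hVpt : volume (ecube a L) ^ p ≠ ∞ := ENNReal.rpow_ne_top_of_nonneg hp0.le hVt
    refine (ENNReal.mul_le_mul_iff_left hVp0 hVpt).1 ?_
    calc weightMeasure w (ecube a L) * volume (ecube a L) ^ p
        ≤ weightMeasure w (Metric.ball (ecubeCenter a L) ((n + 1) * L)) *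
          (2 * volume (ecube a L \ F)) ^ p := by gcongr
      _ = 2 ^ p * (weightMeasure w (Metric.ball (ecubeCenter a L) ((n + 1) * L)) *
          volume (ecube a L \ F) ^ p) := by rw [ENNReal.mul_rpow_of_nonneg _ _ hp0.le]; ring
      _ ≤ 2 ^ p * (K * (κ * volume (ecube a L)) ^ p * weightMeasure w (ecube a L \ F)) := by
          gcongr
      _ = K * (κ * 2) ^ p * weightMeasure w (ecube a L \ F) * volume (ecube a L) ^ p := by
          rw [ENNReal.mul_rpow_of_nonneg _ _ hp0.le, ENNReal.mul_rpow_of_nonneg _ _ hp0.le]; ring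
      _ ≤ _ := by gcongr; exact le_add_self
  have hwt : weightMeasure w (ecube a L) ≠ ∞ :=
    (hp.1.weightMeasure_lt_top (Metric.isBounded_ball.subset hsub)).ne
  have hsum : weightMeasure w (ecube a L \ F) + weightMeasure w F = weightMeasure w (ecube a L) :=
    measure_sdiff_add_of_subset hFm hF
  rw [ENNReal.sub_mul (fun _ _ => hwt), one_mul]
  refine ENNReal.le_sub_of_add_le_right (ENNReal.mul_ne_top (by simpa using hK'0) hwt) ?_
  rw [← hsum, add_comm]
  gcongr
  rw [hsum]
  rwa [ENNReal.inv_mul_le_iff hK'0 hK't]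

/-- Bounded, boundedly supported measurable functions. -/
def boundedFun (n : ℕ) (𝕜 : Type*) [RCLike 𝕜] : Submodule 𝕜 (Rn n → 𝕜) where
  carrier := {f | AEStronglyMeasurable f volume ∧ (∃ R : ℝ, ∀ x, f x ≠ 0 → ‖x‖ ≤ R) ∧
    ∃ M : ℝ, ∀ x, ‖f x‖ ≤ M}
  add_mem' := by
    rintro f g ⟨hf, ⟨R, hR⟩, M, hM⟩ ⟨hg, ⟨R', hR'⟩, M', hM'⟩
    refine ⟨hf.add hg, ⟨max R R', fun x hx => ?_⟩, M + M', fun x => ?_⟩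
    · by_cases h : f x = 0
      · have : g x ≠ 0 := fun h' => hx (by simp [h, h'])
        exact (hR' x this).trans (le_max_right _ _)
      · exact (hR x h).trans (le_max_left _ _)
    · exact (norm_add_le _ _).trans (add_le_add (hM x) (hM' x))
  zero_mem' := ⟨aestronglyMeasurable_const, ⟨0, fun x hx => absurd rfl hx⟩, 0, fun x => by simp⟩
  smul_mem' := by
    rintro c f ⟨hf, ⟨R, hR⟩, M, hM⟩
    refine ⟨hf.const_smul c, ⟨R, fun x hx => hR x fun h => hx (by simp [h])⟩, ‖c‖ * M, fun x => ?_⟩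
    rw [Pi.smul_apply, norm_smul]
    gcongr
    exact hM x

theorem mem_boundedFun {f : Rn n → 𝕜} : f ∈ boundedFun n 𝕜 ↔ AEStronglyMeasurable f volume ∧
    (∃ R : ℝ, ∀ x, f x ≠ 0 → ‖x‖ ≤ R) ∧ ∃ M : ℝ, ∀ x, ‖f x‖ ≤ M := Iff.rfl

theorem weightMeasure_absolutelyContinuous (w : Rn n → ℝ) : weightMeasure w ≪ volume :=
  withDensity_absolutelyContinuous _ _

theorem memLp_mul_of_mem_boundedFun {μ : Measure (Rn n)} (hμ : μ ≪ volume) {p : ℝ≥0∞}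
    {b f : Rn n → 𝕜} (hb : ∀ R : ℝ, MemLp b p (μ.restrict (Metric.ball 0 R)))
    (hf : f ∈ boundedFun n 𝕜) : MemLp (fun z => b z * f z) p μ := by
  obtain ⟨hfm, ⟨R, hR⟩, M, hM⟩ := hf
  have hm : MeasurableSet (Metric.ball (0 : Rn n) (R + 1)) := Metric.isOpen_ball.measurableSet
  have h1 : MemLp (fun z => b z * f z) p (μ.restrict (Metric.ball 0 (R + 1))) := by
    refine (hb (R + 1)).of_le_mul (c := M) ((hb _).1.mul (hfm.mono_ac hμ).restrict)
      (Eventually.of_forall fun z => ?_)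
    rw [norm_mul, mul_comm]
    gcongr
    exact hM z
  have h2 : (fun z => b z * f z) = (Metric.ball (0 : Rn n) (R + 1)).indicator
      fun z => b z * f z := by
    ext z
    by_cases hz : z ∈ Metric.ball (0 : Rn n) (R + 1)
    · rw [Set.indicator_of_mem hz]
    · rw [Set.indicator_of_notMem hz]
      have : f z = 0 := by
        by_contra h
        refine hz ?_
        rw [mem_ball_zero_iff]
        linarith [hR z h]
      rw [this, mul_zero]
  rw [h2]
  exact (memLp_indicator_iff_restrict hm).2 h1

theorem IsWeight.memLp_of_mem_boundedFun {w : Rn n → ℝ} (hw : IsWeight w) {f : Rn n → 𝕜}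
    (hf : f ∈ boundedFun n 𝕜) (p : ℝ≥0∞) : MemLp f p (weightMeasure w) := by
  have := memLp_mul_of_mem_boundedFun (weightMeasure_absolutelyContinuous w) (p := p)
    (b := fun _ => (1 : 𝕜)) (fun R => ?_) hf
  · simpa using this
  · have : IsFiniteMeasure ((weightMeasure w).restrict (Metric.ball 0 R)) :=
      ⟨by rw [Measure.restrict_apply_univ]; exact hw.weightMeasure_lt_top Metric.isBounded_ball⟩
    exact memLp_const _

/-- The John–Nirenberg inequality with respect to w itself puts b into L^p(w) on bounded sets. This
makes the entries b_j f_j of a commutator legitimate inputs for T. -/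
theorem MuckenhouptAInfty.memLp_mul_of_mem_boundedFun {w : Rn n → ℝ} (hw : MuckenhouptAInfty w)
    {b f : Rn n → 𝕜} (hb : IsBMO b) (hf : f ∈ boundedFun n 𝕜) {p : ℝ} (hp : 0 < p) :
    MemLp (fun z => b z * f z) (ENNReal.ofReal p) (weightMeasure w) := by
  have hwt : IsWeight w := by obtain ⟨_, h⟩ := hw; exact h.1
  obtain ⟨ρ, hρ1, hρ⟩ := hw.exists_lt_one
  obtain ⟨D, hD, β, hβ⟩ := hb.exists_ecube
  have hμ := weightMeasure_absolutelyContinuous w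
  obtain ⟨C, hC, h⟩ := lintegral_ecube_enorm_sub_rpow_le hμ hρ1 hρ hb.1 hD hβ hp
  refine FracAmalgam.memLp_mul_of_mem_boundedFun hμ (fun R => ?_) hf
  rcases le_or_gt R 0 with hR | hR
  · rw [Metric.ball_eq_empty.2 hR, Measure.restrict_empty]
    exact ⟨aestronglyMeasurable_zero_measure _, by simp⟩
  set a : Fin n → ℝ := fun i => (0 : Rn n) i - R
  have hfin : weightMeasure w (ecube a (2 * R)) < ∞ :=
    hwt.weightMeasure_lt_top (Metric.isBounded_ball.subset (ecube_subset_ball a (by positivity)))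
  have hQ : MemLp b (ENNReal.ofReal p) ((weightMeasure w).restrict (ecube a (2 * R))) := by
    have : IsFiniteMeasure ((weightMeasure w).restrict (ecube a (2 * R))) :=
      ⟨by rwa [Measure.restrict_apply_univ]⟩
    have h1 : MemLp (fun z => b z - β a (2 * R)) (ENNReal.ofReal p)
        ((weightMeasure w).restrict (ecube a (2 * R))) := by
      refine ⟨((hb.1.aestronglyMeasurable.sub aestronglyMeasurable_const).mono_ac hμ).restrict, ?_⟩
      rw [eLpNorm_lt_top_iff_lintegral_rpow_enorm_lt_top (by simpa using hp) (by simp),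
        ENNReal.toReal_ofReal hp.le]
      exact (h a (2 * R) (by positivity)).trans_lt (ENNReal.mul_lt_top hC hfin)
    have h2 := h1.add (memLp_const (β a (2 * R)))
    refine h2.ae_eq (Eventually.of_forall fun z => ?_)
    simp
  exact hQ.mono_measure (Measure.restrict_mono (ball_subset_ecube 0) le_rfl)

end BMO

/-! ### Averages over balls -/

section Averages

variable {n : ℕ} {𝕜 : Type*} [RCLike 𝕜]

/-- The normalised restriction of Lebesgue measure to a ball. -/
def ballMeasure (x : Rn n) (r : ℝ) : Measure (Rn n) :=
  (volume.restrict (Metric.ball x r) Set.univ)⁻¹ • volume.restrict (Metric.ball x r)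

theorem ballAvg_eq_lintegral (r : ℝ) (F : Rn n → ℝ≥0∞) (x : Rn n) :
    ballAvg r F x = ∫⁻ z, F z ∂(ballMeasure x r) := rfl

theorem isProbabilityMeasure_ballMeasure (x : Rn n) {r : ℝ} (hr : 0 < r) :
    IsProbabilityMeasure (ballMeasure x r) := by
  constructor
  rw [ballMeasure, Measure.smul_apply, Measure.restrict_apply_univ, smul_eq_mul,
    ENNReal.inv_mul_cancel (volume_ball_pos x hr) (volume_ball_ne_top x r)]

theorem ballMeasure_absolutelyContinuous (x : Rn n) (r : ℝ) : ballMeasure x r ≪ volume :=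
  (Measure.absolutelyContinuous_of_le_smul le_rfl).trans Measure.absolutelyContinuous_restrict

theorem ae_mem_ball_ballMeasure (x : Rn n) (r : ℝ) : ∀ᵐ z ∂(ballMeasure x r), z ∈ Metric.ball x r :=
  (Measure.absolutelyContinuous_of_le_smul le_rfl).ae_le
    (ae_restrict_mem Metric.isOpen_ball.measurableSet)

theorem ballAvg_mono {r : ℝ} {F G : Rn n → ℝ≥0∞} {x : Rn n}
    (h : ∀ z ∈ Metric.ball x r, F z ≤ G z) : ballAvg r F x ≤ ballAvg r G x :=
  lintegral_mono_ae ((ae_mem_ball_ballMeasure x r).mono h)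

theorem ballAvg_const {r : ℝ} (hr : 0 < r) (c : ℝ≥0∞) (x : Rn n) :
    ballAvg r (fun _ => c) x = c := by
  have := isProbabilityMeasure_ballMeasure x hr
  rw [ballAvg_eq_lintegral, lintegral_const, measure_univ, mul_one]

theorem ballAvg_add {r : ℝ} {F : Rn n → ℝ≥0∞} (hF : AEMeasurable F volume) (G : Rn n → ℝ≥0∞)
    (x : Rn n) : ballAvg r (fun z => F z + G z) x = ballAvg r F x + ballAvg r G x :=
  lintegral_add_left' (hF.mono_ac (ballMeasure_absolutelyContinuous x r)) _

theorem ballAvg_const_mul {r : ℝ} (c : ℝ≥0∞) {F : Rn n → ℝ≥0∞} (hF : AEMeasurable F volume)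
    (x : Rn n) : ballAvg r (fun z => c * F z) x = c * ballAvg r F x :=
  lintegral_const_mul'' _ (hF.mono_ac (ballMeasure_absolutelyContinuous x r))

theorem ballAvg_congr_ae {r : ℝ} {F G : Rn n → ℝ≥0∞} (h : F =ᵐ[volume] G) (x : Rn n) :
    ballAvg r F x = ballAvg r G x :=
  lintegral_congr_ae ((ballMeasure_absolutelyContinuous x r).ae_le h)

theorem ballAvg_mul_le {r : ℝ} {p q : ℝ} (hpq : p.HolderConjugate q) {F G : Rn n → ℝ≥0∞}
    (hF : AEMeasurable F volume) (hG : AEMeasurable G volume) (x : Rn n) :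
    ballAvg r (fun z => F z * G z) x ≤
      ballAvg r (fun z => F z ^ p) x ^ (1 / p) * ballAvg r (fun z => G z ^ q) x ^ (1 / q) :=
  ENNReal.lintegral_mul_le_Lp_mul_Lq _ hpq (hF.mono_ac (ballMeasure_absolutelyContinuous x r))
    (hG.mono_ac (ballMeasure_absolutelyContinuous x r))

theorem ballAvg_le_rpow {r : ℝ} (hr : 0 < r) {p : ℝ} (hp : 1 ≤ p) {F : Rn n → ℝ≥0∞}
    (hF : AEMeasurable F volume) (x : Rn n) :
    ballAvg r F x ≤ ballAvg r (fun z => F z ^ p) x ^ (1 / p) := by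
  rcases hp.eq_or_lt with rfl | hp
  · simp
  · have := ballAvg_mul_le (r := r) (Real.HolderConjugate.conjExponent hp) hF
      (aemeasurable_const (b := (1 : ℝ≥0∞))) x
    simpa [ballAvg_const hr] using this

theorem ballAvg_le_two_mul {r : ℝ} (hr : 0 < r) {x y : Rn n} (h : x ∈ Metric.ball y r)
    (F : Rn n → ℝ≥0∞) : ballAvg r F x ≤ 2 ^ n * ballAvg (2 * r) F y := by
  rw [ballAvg_eq, ballAvg_eq, volume_ball_two_mul y x hr]
  have hsub : Metric.ball x r ⊆ Metric.ball y (2 * r) := by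
    refine Metric.ball_subset_ball' ?_
    rw [Metric.mem_ball] at h; linarith
  have h2 : (2 : ℝ≥0∞) ^ n ≠ 0 := by simp
  have h2' : (2 : ℝ≥0∞) ^ n ≠ ∞ := by simp
  calc _ ≤ (∫⁻ z in Metric.ball y (2 * r), F z) / volume (Metric.ball x r) := by
        gcongr
    _ = _ := by
        rw [ENNReal.div_eq_inv_mul, ENNReal.div_eq_inv_mul,
          ENNReal.mul_inv (Or.inl h2) (Or.inl h2'), ← mul_assoc, ← mul_assoc,
          ENNReal.mul_inv_cancel h2 h2', one_mul]

theorem measurable_ballAvg' {F : Rn n → ℝ≥0∞} (hF : Measurable F) (r : ℝ) :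
    Measurable (ballAvg r F) :=
  measurable_ballAvg (F := fun _ z => F z) (hF.comp measurable_snd) r

/-- The `L^τ` average of `F` over the ball `B(x, r)`. -/
def lpAvg (τ r : ℝ) (F : Rn n → ℝ≥0∞) (x : Rn n) : ℝ≥0∞ :=
  ballAvg r (fun z => F z ^ τ) x ^ (1 / τ)

theorem measurable_lpAvg {F : Rn n → ℝ≥0∞} (hF : Measurable F) (τ r : ℝ) :
    Measurable (lpAvg τ r F) :=
  (measurable_ballAvg' (hF.pow_const τ) r).pow_const _

theorem lpAvg_mono {τ r : ℝ} (hτ : 0 < τ) {F G : Rn n → ℝ≥0∞} {x : Rn n}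
    (h : ∀ z ∈ Metric.ball x r, F z ≤ G z) : lpAvg τ r F x ≤ lpAvg τ r G x := by
  unfold lpAvg
  gcongr
  refine ballAvg_mono fun z hz => ?_
  gcongr
  exact h z hz

theorem lpAvg_le_lpAvg {τ p r : ℝ} (hτ : 0 < τ) (hp : τ ≤ p) (hr : 0 < r) {F : Rn n → ℝ≥0∞}
    (hF : AEMeasurable F volume) (x : Rn n) : lpAvg τ r F x ≤ lpAvg p r F x := by
  have h := ballAvg_le_rpow hr ((one_le_div hτ).2 hp) (hF.pow_const τ) x
  simp only [← ENNReal.rpow_mul, mul_div_cancel₀ p hτ.ne'] at h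
  unfold lpAvg
  calc _ ≤ (ballAvg r (fun z => F z ^ p) x ^ (1 / (p / τ))) ^ (1 / τ) := by gcongr
    _ = _ := by
        rw [← ENNReal.rpow_mul]
        congr 1
        have : 0 < p := by linarith
        field_simp

theorem lpAvg_le_two_mul {τ r : ℝ} (hτ : 0 < τ) (hr : 0 < r) {x y : Rn n}
    (h : x ∈ Metric.ball y r) (F : Rn n → ℝ≥0∞) :
    lpAvg τ r F x ≤ ((2 : ℝ≥0∞) ^ n) ^ (1 / τ) * lpAvg τ (2 * r) F y := by
  unfold lpAvg
  rw [← ENNReal.mul_rpow_of_nonneg _ _ (by positivity)]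
  gcongr
  exact ballAvg_le_two_mul hr h _

/-- One plus the mean distance of `b x` to the values of `b` on `B(x, r)`. -/
def oscAvg (r : ℝ) (b : Rn n → 𝕜) (x : Rn n) : ℝ≥0∞ :=
  1 + ballAvg r (fun z => ‖b x - b z‖ₑ) x

theorem one_le_oscAvg (r : ℝ) (b : Rn n → 𝕜) (x : Rn n) : 1 ≤ oscAvg r b x := le_self_add

theorem measurable_oscAvg {b : Rn n → 𝕜} (hb : Measurable b) (r : ℝ) :
    Measurable (oscAvg r b) :=
  (measurable_ballAvg (F := fun x z => ‖b x - b z‖ₑ)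
    (((hb.comp measurable_fst).sub (hb.comp measurable_snd)).enorm) r).const_add _

/-- Uniform control of all moments of the oscillation over balls. -/
def HasOscMoments (b : Rn n → 𝕜) : Prop :=
  ∀ u : ℝ, 0 < u → ∃ C : ℝ≥0∞, C < ∞ ∧ ∀ (y : Rn n) (r : ℝ), 0 < r →
    ∃ β : 𝕜, ballAvg r (fun z => ‖b z - β‖ₑ ^ u) y ≤ C

theorem add_rpow_le_two_rpow_mul (a b : ℝ≥0∞) {u : ℝ} (hu : 0 ≤ u) :
    (a + b) ^ u ≤ 2 ^ u * (a ^ u + b ^ u) := by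
  wlog h : a ≤ b generalizing a b
  · rw [add_comm a, add_comm (a ^ u)]
    exact this b a (le_of_not_ge h)
  calc (a + b) ^ u ≤ (2 * b) ^ u := by
        rw [two_mul]; gcongr
    _ = 2 ^ u * b ^ u := ENNReal.mul_rpow_of_nonneg _ _ hu
    _ ≤ _ := by gcongr; exact le_add_self

theorem enorm_sub_le_enorm_sub_add (a b c : 𝕜) : ‖a - c‖ₑ ≤ ‖a - b‖ₑ + ‖b - c‖ₑ := by
  calc ‖a - c‖ₑ = ‖(a - b) + (b - c)‖ₑ := by congr 1; abel
    _ ≤ _ := enorm_add_le _ _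

/-- The constants β_i that approximate b on B(y, 2^i r) differ by a bounded amount from one i to the
next. For x in B(y,r) the oscillation at scale 2^k r is therefore at most |b(x) - β_0| plus a
multiple of k + 1, and the moments of the first term over B(y,r) are bounded. -/
theorem HasOscMoments.ballAvg_oscAvg_rpow_le {b : Rn n → 𝕜} (hbm : Measurable b)
    (hb : HasOscMoments b) {u : ℝ} (hu : 1 ≤ u) :
    ∃ C : ℝ≥0∞, C < ∞ ∧ ∀ (y : Rn n) (r : ℝ), 0 < r → ∀ k : ℕ,
      ballAvg r (fun x => oscAvg (2 ^ k * r) b x ^ u) y ≤ C * ((k : ℝ≥0∞) + 1) ^ u := by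
  have hu0 : 0 < u := by linarith
  obtain ⟨C, hC, h⟩ := hb u hu0
  set A := C ^ (1 / u)
  have hA : A < ∞ := ENNReal.rpow_lt_top_of_nonneg (by positivity) hC.ne
  set A' := 1 + (1 + 2 ^ n) * A + 2 ^ n * A with hA'
  have hA't : A' < ∞ := ENNReal.add_lt_top.2 ⟨ENNReal.add_lt_top.2 ⟨by simp,
    ENNReal.mul_lt_top (by simp) hA⟩, ENNReal.mul_lt_top (by simp) hA⟩
  refine ⟨2 ^ u * (C + A' ^ u), ENNReal.mul_lt_top (ENNReal.rpow_lt_top_of_nonneg hu0.le (by simp))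
    (ENNReal.add_lt_top.2 ⟨hC, ENNReal.rpow_lt_top_of_nonneg hu0.le hA't.ne⟩), fun y r hr k => ?_⟩
  have hpos : ∀ i : ℕ, 0 < 2 ^ i * r := fun i => by positivity
  choose β hβ using fun i : ℕ => h y (2 ^ i * r) (hpos i)
  have hdist : ∀ c : 𝕜, Measurable fun z => ‖b z - c‖ₑ := fun c => (hbm.sub_const c).enorm
  have hβ1 : ∀ i, ballAvg (2 ^ i * r) (fun z => ‖b z - β i‖ₑ) y ≤ A := fun i =>
    (ballAvg_le_rpow (hpos i) hu (hdist _).aemeasurable y).trans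
      (ENNReal.rpow_le_rpow (hβ i) (by positivity))
  have hyself : ∀ {ρ : ℝ}, 0 < ρ → y ∈ Metric.ball y ρ := fun hρ => Metric.mem_ball_self hρ
  have hstep : ∀ i, ‖β i - β (i + 1)‖ₑ ≤ (1 + 2 ^ n) * A := by
    intro i
    calc ‖β i - β (i + 1)‖ₑ = ballAvg (2 ^ i * r) (fun _ => ‖β i - β (i + 1)‖ₑ) y :=
          (ballAvg_const (hpos i) _ y).symm
      _ ≤ ballAvg (2 ^ i * r) (fun z => ‖b z - β i‖ₑ + ‖b z - β (i + 1)‖ₑ) y :=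
          ballAvg_mono fun z _ => by
            rw [← enorm_sub_rev (β i) (b z)]; exact enorm_sub_le_enorm_sub_add _ _ _
      _ = ballAvg (2 ^ i * r) (fun z => ‖b z - β i‖ₑ) y +
          ballAvg (2 ^ i * r) (fun z => ‖b z - β (i + 1)‖ₑ) y :=
          ballAvg_add (hdist _).aemeasurable _ _
      _ ≤ A + 2 ^ n * A := by
          refine add_le_add (hβ1 i) ((ballAvg_le_two_mul (hpos i) (hyself (hpos i)) _).trans ?_)
          gcongr
          rw [← mul_assoc, ← pow_succ']
          exact hβ1 (i + 1)
      _ = _ := by ring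
  have hsum : ∀ i : ℕ, ‖β 0 - β i‖ₑ ≤ i * ((1 + 2 ^ n) * A) := by
    intro i
    induction i with
    | zero => simp
    | succ i ih =>
      refine (enorm_sub_le_enorm_sub_add _ (β i) _).trans ?_
      push_cast
      rw [add_mul, one_mul]
      exact add_le_add ih (hstep i)
  have hpt : ∀ x ∈ Metric.ball y r, oscAvg (2 ^ k * r) b x ≤
      ‖b x - β 0‖ₑ + ((k : ℝ≥0∞) + 1) * A' := by
    intro x hx
    have hx' : x ∈ Metric.ball y (2 ^ k * r) :=
      Metric.ball_subset_ball (le_mul_of_one_le_left hr.le (one_le_pow₀ (by norm_num))) hx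
    -- The ball of radius 2^k r about x is not contained in the one about y but in its double, hence
    -- the index k + 1.
    have h1 : ballAvg (2 ^ k * r) (fun z => ‖b x - b z‖ₑ) x ≤
        ‖b x - β (k + 1)‖ₑ + 2 ^ n * A := by
      calc _ ≤ ballAvg (2 ^ k * r) (fun z => ‖b x - β (k + 1)‖ₑ + ‖b z - β (k + 1)‖ₑ) x :=
            ballAvg_mono fun z _ => by
              rw [← enorm_sub_rev (β (k + 1)) (b z)]; exact enorm_sub_le_enorm_sub_add _ _ _
        _ = ‖b x - β (k + 1)‖ₑ + ballAvg (2 ^ k * r) (fun z => ‖b z - β (k + 1)‖ₑ) x := by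
            rw [ballAvg_add aemeasurable_const, ballAvg_const (hpos k)]
        _ ≤ _ := by
            refine add_le_add le_rfl ((ballAvg_le_two_mul (hpos k) hx' _).trans ?_)
            gcongr
            rw [← mul_assoc, ← pow_succ']
            exact hβ1 (k + 1)
    calc oscAvg (2 ^ k * r) b x ≤ 1 + ((‖b x - β 0‖ₑ + ((k + 1 : ℕ) : ℝ≥0∞) * ((1 + 2 ^ n) * A)) +
          2 ^ n * A) := by
          unfold oscAvg
          gcongr
          refine h1.trans ?_
          gcongr
          exact (enorm_sub_le_enorm_sub_add _ (β 0) _).trans (add_le_add le_rfl (hsum (k + 1)))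
      _ ≤ ‖b x - β 0‖ₑ + (((k : ℝ≥0∞) + 1) * 1 + ((k : ℝ≥0∞) + 1) * ((1 + 2 ^ n) * A) +
          ((k : ℝ≥0∞) + 1) * (2 ^ n * A)) := by
          push_cast
          rw [show ∀ a b c d : ℝ≥0∞, a + ((b + c) + d) = b + (a + c + d) by intros; ring]
          have hk : (1 : ℝ≥0∞) ≤ (k : ℝ≥0∞) + 1 := le_add_self
          refine add_le_add le_rfl (add_le_add (add_le_add ?_ le_rfl) ?_)
          · rwa [mul_one]
          · exact le_mul_of_one_le_left' hk
      _ = _ := by rw [hA']; ring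
  calc ballAvg r (fun x => oscAvg (2 ^ k * r) b x ^ u) y
      ≤ ballAvg r (fun x => 2 ^ u * (‖b x - β 0‖ₑ ^ u + (((k : ℝ≥0∞) + 1) * A') ^ u)) y :=
        ballAvg_mono fun x hx =>
          (ENNReal.rpow_le_rpow (hpt x hx) hu0.le).trans (add_rpow_le_two_rpow_mul _ _ hu0.le)
    _ = 2 ^ u * (ballAvg r (fun x => ‖b x - β 0‖ₑ ^ u) y + (((k : ℝ≥0∞) + 1) * A') ^ u) := by
        rw [ballAvg_const_mul _ (((hdist _).pow_const u).add_const _).aemeasurable,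
          ballAvg_add ((hdist _).pow_const u).aemeasurable, ballAvg_const hr]
    _ ≤ 2 ^ u * (C * ((k : ℝ≥0∞) + 1) ^ u + A' ^ u * ((k : ℝ≥0∞) + 1) ^ u) := by
        gcongr
        · have := hβ 0
          rw [pow_zero, one_mul] at this
          refine this.trans (le_mul_of_one_le_right' ?_)
          exact ENNReal.one_le_rpow le_add_self hu0
        · rw [ENNReal.mul_rpow_of_nonneg _ _ hu0.le, mul_comm]
    _ = _ := by ring

theorem prod_le_sum_pow {m : ℕ} (hm : 0 < m) (a : Fin m → ℝ≥0∞) : ∏ j, a j ≤ ∑ j, a j ^ m := by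
  have : Nonempty (Fin m) := ⟨⟨0, hm⟩⟩
  obtain ⟨j₀, hj₀⟩ := Finite.exists_max a
  calc ∏ j, a j ≤ a j₀ ^ (Finset.univ : Finset (Fin m)).card :=
        Finset.prod_le_pow_card _ _ _ fun j _ => hj₀ j
    _ = a j₀ ^ m := by simp
    _ ≤ _ := Finset.single_le_sum (f := fun j => a j ^ m) (fun _ _ => zero_le) (Finset.mem_univ j₀)

theorem ballAvg_finset_sum {r : ℝ} {ι : Type*} (s : Finset ι) {F : ι → Rn n → ℝ≥0∞}
    (hF : ∀ i, AEMeasurable (F i) volume) (x : Rn n) :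
    ballAvg r (fun z => ∑ i ∈ s, F i z) x = ∑ i ∈ s, ballAvg r (F i) x :=
  lintegral_finsetSum' _ fun i _ => (hF i).mono_ac (ballMeasure_absolutelyContinuous x r)

/-- A product of m factors is at most the sum of their m-th powers. All factors are at least 1, so
the exponent may be raised to one N ≥ 1 to which the single-function bound applies. -/
theorem ballAvg_prod_oscAvg_rpow_le {m : ℕ} (hm : 0 < m) {b : Fin m → Rn n → 𝕜}
    (hbm : ∀ j, Measurable (b j)) (hb : ∀ j, HasOscMoments (b j)) {u : ℝ} (hu : 0 < u) :
    ∃ C : ℝ≥0∞, C < ∞ ∧ ∃ N : ℝ, ∀ (y : Rn n) (r : ℝ), 0 < r → ∀ k : ℕ,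
      ballAvg r (fun x => (∏ j, oscAvg (2 ^ k * r) (b j) x) ^ u) y ≤
        C * ((k : ℝ≥0∞) + 1) ^ N := by
  set N : ℝ := max 1 (u * m)
  choose C hC h using fun j => (hb j).ballAvg_oscAvg_rpow_le (hbm j) (le_max_left 1 (u * m))
  refine ⟨∑ j, C j, ENNReal.sum_lt_top.2 fun j _ => hC j, N, fun y r hr k => ?_⟩
  have hpt : ∀ x, (∏ j, oscAvg (2 ^ k * r) (b j) x) ^ u ≤
      ∑ j, oscAvg (2 ^ k * r) (b j) x ^ N := by
    intro x
    rw [← ENNReal.prod_rpow_of_nonneg hu.le]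
    refine (prod_le_sum_pow hm _).trans (Finset.sum_le_sum fun j _ => ?_)
    rw [← ENNReal.rpow_natCast, ← ENNReal.rpow_mul]
    exact ENNReal.rpow_le_rpow_of_exponent_le (one_le_oscAvg _ _ _) (le_max_right _ _)
  calc _ ≤ ballAvg r (fun x => ∑ j, oscAvg (2 ^ k * r) (b j) x ^ N) y :=
        ballAvg_mono fun x _ => hpt x
    _ = ∑ j, ballAvg r (fun x => oscAvg (2 ^ k * r) (b j) x ^ N) y :=
        ballAvg_finset_sum _ (fun j => ((measurable_oscAvg (hbm j) _).pow_const N).aemeasurable) y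
    _ ≤ ∑ j, C j * ((k : ℝ≥0∞) + 1) ^ N := Finset.sum_le_sum fun j _ => h j y r hr k
    _ = _ := by rw [Finset.sum_mul]

end Averages

/-! ### The positive operator that dominates the commutators -/

section FracSum

theorem prod_rpow_exponents {ι : Type*} (s : Finset ι) {x : ℝ≥0∞} (h0 : x ≠ 0) (ht : x ≠ ∞)
    (a : ι → ℝ) : ∏ i ∈ s, x ^ a i = x ^ ∑ i ∈ s, a i := by
  classical
  induction s using Finset.induction_on with
  | empty => simp
  | insert i s hi ih =>
    rw [Finset.prod_insert hi, Finset.sum_insert hi, ih, ENNReal.rpow_add _ _ h0 ht]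

variable {n m : ℕ} {𝕜 : Type*} [RCLike 𝕜]

/-- `r^γ ∏_j (|B|⁻¹ ∫_B F_j^{τ_j})^{1/τ_j}` with `B = B(x, r)`. -/
def fracTerm (γ : ℝ) (τ : Fin m → ℝ) (r : ℝ) (F : Fin m → Rn n → ℝ≥0∞) (x : Rn n) : ℝ≥0∞ :=
  ENNReal.ofReal r ^ γ * ∏ j, lpAvg (τ j) r (F j) x

/-- The product of the oscillations of the `b_j` at scale `r`. -/
def oscProd (b : Fin m → Rn n → 𝕜) (r : ℝ) (x : Rn n) : ℝ≥0∞ := ∏ j, oscAvg r (b j) x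

/-- The sum over the scales `t 2^K` of the fractional averages, weighted by oscillations. -/
def fracSum (γ : ℝ) (τ : Fin m → ℝ) (b : Fin m → Rn n → 𝕜) (t : ℝ) (F : Fin m → Rn n → ℝ≥0∞)
    (x : Rn n) : ℝ≥0∞ :=
  ∑' K : ℤ, oscProd b (t * 2 ^ K) x * fracTerm γ τ (t * 2 ^ K) F x

theorem measurable_fracTerm (γ : ℝ) (τ : Fin m → ℝ) (r : ℝ) {F : Fin m → Rn n → ℝ≥0∞}
    (hF : ∀ j, Measurable (F j)) : Measurable (fracTerm γ τ r F) :=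
  (Finset.measurable_prod _ fun j _ => measurable_lpAvg (hF j) (τ j) r).const_mul _

theorem measurable_oscProd {b : Fin m → Rn n → 𝕜} (hb : ∀ j, Measurable (b j)) (r : ℝ) :
    Measurable (oscProd b r) :=
  Finset.measurable_prod _ fun j _ => measurable_oscAvg (hb j) r

theorem measurable_fracSum (γ : ℝ) (τ : Fin m → ℝ) {b : Fin m → Rn n → 𝕜}
    (hb : ∀ j, Measurable (b j)) (t : ℝ) {F : Fin m → Rn n → ℝ≥0∞} (hF : ∀ j, Measurable (F j)) :
    Measurable (fracSum γ τ b t F) :=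
  Measurable.tsum fun _ => (measurable_oscProd hb _).mul (measurable_fracTerm γ τ _ hF)

theorem fracTerm_mono {γ : ℝ} {τ : Fin m → ℝ} (hτ : ∀ j, 0 < τ j) {r : ℝ}
    {F G : Fin m → Rn n → ℝ≥0∞} {x : Rn n} (h : ∀ j, ∀ z ∈ Metric.ball x r, F j z ≤ G j z) :
    fracTerm γ τ r F x ≤ fracTerm γ τ r G x := by
  unfold fracTerm
  gcongr with j
  exact lpAvg_mono (hτ j) (h j)

theorem fracTerm_le_two_mul {γ : ℝ} (hγ : 0 ≤ γ) {τ : Fin m → ℝ} (hτ : ∀ j, 0 < τ j) {r : ℝ}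
    (hr : 0 < r) {x y : Rn n} (h : x ∈ Metric.ball y r) (F : Fin m → Rn n → ℝ≥0∞) :
    fracTerm γ τ r F x ≤ (∏ j, ((2 : ℝ≥0∞) ^ n) ^ (1 / τ j)) * fracTerm γ τ (2 * r) F y := by
  unfold fracTerm
  calc _ ≤ ENNReal.ofReal (2 * r) ^ γ *
        ∏ j, (((2 : ℝ≥0∞) ^ n) ^ (1 / τ j) * lpAvg (τ j) (2 * r) (F j) y) := by
        gcongr with j
        · linarith
        · exact lpAvg_le_two_mul (hτ j) hr h _
    _ = _ := by rw [Finset.prod_mul_distrib]; ring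

/-- The maximal function that controls `fracTerm` at small scales. -/
def prodMax (τ : Fin m → ℝ) (t : ℝ) (F : Fin m → Rn n → ℝ≥0∞) (x : Rn n) : ℝ≥0∞ :=
  ∏ j, dyMax t (fun z => F j z ^ τ j) x ^ (1 / τ j)

theorem measurable_prodMax (τ : Fin m → ℝ) (t : ℝ) {F : Fin m → Rn n → ℝ≥0∞}
    (hF : ∀ j, Measurable (F j)) : Measurable (prodMax τ t F) :=
  Finset.measurable_prod _ fun j _ => (measurable_dyMax ((hF j).pow_const _) t).pow_const _

theorem fracTerm_le_prodMax {γ : ℝ} {τ : Fin m → ℝ} (hτ : ∀ j, 0 < τ j) (t : ℝ) (K : ℤ)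
    (F : Fin m → Rn n → ℝ≥0∞) (x : Rn n) :
    fracTerm γ τ (t * 2 ^ K) F x ≤ ENNReal.ofReal (t * 2 ^ K) ^ γ * prodMax τ t F x := by
  unfold fracTerm prodMax lpAvg
  gcongr with j
  · exact (one_div_pos.2 (hτ j)).le
  · exact ballAvg_le_dyMax t _ x K

/-- Jensen's inequality raises each τ_j to P_j, and the volume factors combine to r^{-n/p}. This is
the decay at large scales in Hedberg's inequality; `fracTerm_le_prodMax` is its counterpart at small
scales. -/
theorem fracTerm_le_prod_lintegral {γ p : ℝ} {τ P : Fin m → ℝ} (hτ : ∀ j, 0 < τ j)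
    (hτP : ∀ j, τ j ≤ P j) (hp : 1 / p = ∑ j, 1 / P j) {r : ℝ} (hr : 0 < r)
    {F : Fin m → Rn n → ℝ≥0∞} (hF : ∀ j, Measurable (F j)) (x : Rn n) :
    fracTerm γ τ r F x ≤ ENNReal.ofReal r ^ (-(n * (1 / p) - γ)) *
      (volume (Metric.ball (0 : Rn n) 1) ^ (-(1 / p)) *
        ∏ j, (∫⁻ z in Metric.ball x r, F j z ^ P j) ^ (1 / P j)) := by
  have hP : ∀ j, 0 < P j := fun j => (hτ j).trans_le (hτP j)
  set V := volume (Metric.ball x r) with hV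
  have hV0 : V ≠ 0 := volume_ball_pos x hr
  have hVt : V ≠ ∞ := volume_ball_ne_top x r
  have hr0 : ENNReal.ofReal r ≠ 0 := by simpa using hr
  have h1 : ∀ j, lpAvg (τ j) r (F j) x ≤
      V ^ (-(1 / P j)) * (∫⁻ z in Metric.ball x r, F j z ^ P j) ^ (1 / P j) := by
    intro j
    refine (lpAvg_le_lpAvg (hτ j) (hτP j) hr (hF j).aemeasurable x).trans (le_of_eq ?_)
    rw [lpAvg, ballAvg_eq, ENNReal.div_rpow_of_nonneg _ _ (by have := hP j; positivity),
      ENNReal.rpow_neg, ENNReal.div_eq_inv_mul]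
  have h2 : ∏ j, V ^ (-(1 / P j)) = V ^ (-(1 / p)) := by
    rw [hp, ← Finset.sum_neg_distrib, prod_rpow_exponents _ hV0 hVt]
  have h3 : V ^ (-(1 / p)) =
      ENNReal.ofReal r ^ (-(n * (1 / p))) * volume (Metric.ball (0 : Rn n) 1) ^ (-(1 / p)) := by
    rw [hV, volume_ball_eq x hr, ENNReal.mul_rpow_of_ne_top (by simp) (volume_ball_ne_top _ _),
      ENNReal.ofReal_pow hr.le, ← ENNReal.rpow_natCast, ← ENNReal.rpow_mul]
    congr 2; ring
  calc fracTerm γ τ r F x ≤ ENNReal.ofReal r ^ γ * ∏ j, (V ^ (-(1 / P j)) *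
        (∫⁻ z in Metric.ball x r, F j z ^ P j) ^ (1 / P j)) := by
        unfold fracTerm
        gcongr with j
        exact h1 j
    _ = (ENNReal.ofReal r ^ γ * ENNReal.ofReal r ^ (-(n * (1 / p)))) *
        (volume (Metric.ball (0 : Rn n) 1) ^ (-(1 / p)) *
        ∏ j, (∫⁻ z in Metric.ball x r, F j z ^ P j) ^ (1 / P j)) := by
        rw [Finset.prod_mul_distrib, h2, h3]; ring
    _ = _ := by
        rw [← ENNReal.rpow_add _ _ hr0 ENNReal.ofReal_ne_top]
        congr 2; ring

/-- Hedberg's inequality. -/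
theorem tsum_fracTerm_rpow_le {γ p q : ℝ} {τ P : Fin m → ℝ} (hn : 0 < n) (hγ : 0 < γ)
    (hp0 : 0 < p) (hq0 : 0 < q)
    (hτ : ∀ j, 0 < τ j) (hτP : ∀ j, τ j ≤ P j) (hp : 1 / p = ∑ j, 1 / P j)
    (hq : 1 / q = 1 / p - γ / n) {e : ℝ} (he : 0 < e) :
    ∃ C : ℝ≥0∞, C < ∞ ∧ ∀ t : ℝ, 0 < t → ∀ F : Fin m → Rn n → ℝ≥0∞, (∀ j, Measurable (F j)) →
      ∀ x, ∑' K : ℤ, fracTerm γ τ (t * 2 ^ K) F x ^ e ≤ C * (prodMax τ t F x ^ (p / q) *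
        (volume (Metric.ball (0 : Rn n) 1) ^ (-(1 / p)) *
          ∏ j, (∫⁻ z, F j z ^ P j) ^ (1 / P j)) ^ (1 - p / q)) ^ e := by
  have hn' : (0 : ℝ) < n := by exact_mod_cast hn
  set β : ℝ := n * (1 / p) - γ with hβ
  have hβq : β = n * (1 / q) := by rw [hβ, hq]; field_simp
  have hβ0 : 0 < β := by rw [hβq]; positivity
  -- Growth r^γ at small scales against decay r^{-β} with β = n/q at large ones. Since γ + β = n/p,
  -- the interpolation weights come out as p/q and 1 - p/q.
  obtain ⟨C, hC, h⟩ := tsum_min_rpow_le (a := γ * e) (b := β * e) (by positivity) (by positivity)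
  refine ⟨C, hC, fun t ht F hF x => ?_⟩
  set A := prodMax τ t F x
  set B := volume (Metric.ball (0 : Rn n) 1) ^ (-(1 / p)) *
          ∏ j, (∫⁻ z, F j z ^ P j) ^ (1 / P j)
  have hsum : γ * e + β * e = n * (1 / p) * e := by rw [hβ]; ring
  have e1 : β * e / (γ * e + β * e) = p / q := by
    rw [hsum, hβq]; field_simp
  have e2 : γ * e / (γ * e + β * e) = 1 - p / q := by
    rw [← e1, eq_sub_iff_add_eq, ← add_div, div_self (by positivity)]
  have hthis := h t ht (A ^ e) (B ^ e)
  rw [e1, e2, ← ENNReal.rpow_mul, ← ENNReal.rpow_mul, mul_comm e, mul_comm e, ENNReal.rpow_mul,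
    ENNReal.rpow_mul, ← ENNReal.mul_rpow_of_nonneg _ _ he.le] at hthis
  refine le_trans (ENNReal.tsum_le_tsum fun K => ?_) hthis
  have hpos : 0 < t * (2 : ℝ) ^ K := by positivity
  rw [← neg_mul, ENNReal.rpow_mul, ENNReal.rpow_mul, ← ENNReal.mul_rpow_of_nonneg _ _ he.le,
    ← ENNReal.mul_rpow_of_nonneg _ _ he.le]
  refine le_min ?_ ?_
  · gcongr
    exact fracTerm_le_prodMax hτ t K F x
  · gcongr
    refine (fracTerm_le_prod_lintegral hτ hτP hp hpos hF x).trans ?_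
    exact mul_le_mul_right (mul_le_mul_right (Finset.prod_le_prod' fun j _ =>
      ENNReal.rpow_le_rpow (setLIntegral_le_lintegral _ _)
        (one_div_pos.2 ((hτ j).trans_le (hτP j))).le) _) _

/-- Hölder's inequality with the weights p/P_j, which sum to 1, followed by the maximal theorem in
L^{P_j/τ_j}; this is where τ_j < P_j must be strict. -/
theorem lintegral_prodMax_rpow_le {p : ℝ} {τ P : Fin m → ℝ} (hp0 : 0 < p)
    (hτ : ∀ j, 0 < τ j) (hτP : ∀ j, τ j < P j) (hp : 1 / p = ∑ j, 1 / P j) :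
    ∃ C : ℝ≥0∞, C < ∞ ∧ ∀ t : ℝ, 0 < t → ∀ F : Fin m → Rn n → ℝ≥0∞, (∀ j, Measurable (F j)) →
      ∫⁻ x, prodMax τ t F x ^ p ≤ C * (∏ j, (∫⁻ z, F j z ^ P j) ^ (1 / P j)) ^ p := by
  have hP : ∀ j, 0 < P j := fun j => (hτ j).trans (hτP j)
  choose C hC h using fun j => lintegral_dyMax_rpow_le (n := n) ((one_lt_div (hτ j)).2 (hτP j))
  have hsum : ∑ j, p / P j = 1 := by
    simp_rw [div_eq_mul_one_div p, ← Finset.mul_sum]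
    rw [← hp, mul_one_div_cancel hp0.ne']
  refine ⟨∏ j, C j ^ (p / P j), ?_, fun t ht F hF => ?_⟩
  · refine ENNReal.prod_lt_top fun j _ => ?_
    exact ENNReal.rpow_lt_top_of_nonneg (div_pos hp0 (hP j)).le (hC j).ne
  have hM : ∀ j, Measurable (dyMax t fun z => F j z ^ τ j) :=
    fun j => measurable_dyMax ((hF j).pow_const _) t
  calc ∫⁻ x, prodMax τ t F x ^ p
      = ∫⁻ x, ∏ j, (dyMax t (fun z => F j z ^ τ j) x ^ (P j / τ j)) ^ (p / P j) := by
        refine lintegral_congr fun x => ?_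
        rw [prodMax, ← ENNReal.prod_rpow_of_nonneg hp0.le]
        refine Finset.prod_congr rfl fun j _ => ?_
        rw [← ENNReal.rpow_mul, ← ENNReal.rpow_mul]
        congr 1
        have := hP j
        have := hτ j
        field_simp
    _ ≤ ∏ j, (∫⁻ x, dyMax t (fun z => F j z ^ τ j) x ^ (P j / τ j)) ^ (p / P j) :=
        ENNReal.lintegral_prod_norm_pow_le _ (fun j _ => ((hM j).pow_const _).aemeasurable) hsum
          fun j _ => (div_pos hp0 (hP j)).le
    _ ≤ ∏ j, (C j * ∫⁻ x, F j x ^ P j) ^ (p / P j) := by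
        gcongr with j
        · exact (div_pos hp0 (hP j)).le
        · refine (h j t ht _ ((hF j).pow_const _)).trans (le_of_eq ?_)
          congr 1
          refine lintegral_congr fun x => ?_
          rw [← ENNReal.rpow_mul]
          congr 1
          have := hτ j
          field_simp
    _ = _ := by
        rw [← ENNReal.prod_rpow_of_nonneg hp0.le, ← Finset.prod_mul_distrib]
        refine Finset.prod_congr rfl fun j _ => ?_
        rw [ENNReal.mul_rpow_of_nonneg _ _ (div_pos hp0 (hP j)).le, ← ENNReal.rpow_mul]
        congr 2
        ring

/-- The boundedness of the dominating operator on products of Lebesgue spaces. -/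
theorem lintegral_fracSum_rpow_le {γ p q : ℝ} {τ P : Fin m → ℝ} (hn : 0 < n) (hm : 0 < m)
    (hγ : 0 < γ) (hp0 : 0 < p) (hq0 : 0 < q)
    (hτ : ∀ j, 0 < τ j) (hτP : ∀ j, τ j < P j) (hp : 1 / p = ∑ j, 1 / P j)
    (hq : 1 / q = 1 / p - γ / n) {b : Fin m → Rn n → 𝕜}
    (hbm : ∀ j, Measurable (b j)) (hb : ∀ j, HasOscMoments (b j)) :
    ∃ C : ℝ≥0∞, C < ∞ ∧ ∀ t : ℝ, 0 < t → ∀ F : Fin m → Rn n → ℝ≥0∞, (∀ j, Measurable (F j)) →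
      ∫⁻ x, fracSum γ τ b t F x ^ q ≤ C * (∏ j, (∫⁻ z, F j z ^ P j) ^ (1 / P j)) ^ q := by
  have hn' : (0 : ℝ) < n := by exact_mod_cast hn
  have hpq : 0 < 1 - p / q := by
    have : p / q = 1 - p * (γ / n) := by
      rw [div_eq_mul_one_div, hq]; field_simp
    rw [this, sub_sub_cancel]; positivity
  -- Hedberg's inequality is needed for two powers: e = 1/2 for the pointwise summation over scales,
  -- and e = q/2 for the summation after integration.
  obtain ⟨C₁, hC₁, h₁⟩ := tsum_fracTerm_rpow_le hn hγ hp0 hq0 hτ (fun j => (hτP j).le) hp hq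
    (e := 1 / 2) (by norm_num)
  obtain ⟨C₂, hC₂, h₂⟩ := tsum_fracTerm_rpow_le hn hγ hp0 hq0 hτ (fun j => (hτP j).le) hp hq
    (e := q / 2) (by positivity)
  obtain ⟨C₃, hC₃, N₃, h₃⟩ := ballAvg_prod_oscAvg_rpow_le hm hbm hb (u := q * 3) (by positivity)
  obtain ⟨C₄, hC₄, h₄⟩ := lintegral_dyMax_rpow_le (n := n) (p := 4 / 3) (by norm_num)
  obtain ⟨C₅, hC₅, h₅⟩ := lintegral_prodMax_rpow_le (n := n) hp0 hτ hτP hp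
  set v := volume (Metric.ball (0 : Rn n) 1)
  have hv0 : v ≠ 0 := volume_ball_pos _ one_pos
  have hvt : v ≠ ∞ := volume_ball_ne_top _ _
  set D := ∏ j, ((2 : ℝ≥0∞) ^ n) ^ (1 / τ j) with hD
  have hDt : D < ∞ := ENNReal.prod_lt_top fun j _ =>
    ENNReal.rpow_lt_top_of_nonneg (one_div_pos.2 (hτ j)).le (by simp)
  have hfin : ∀ {x : ℝ≥0∞} {e : ℝ}, 0 ≤ e → x < ∞ → x ^ e < ∞ := fun he hx =>
    ENNReal.rpow_lt_top_of_nonneg he hx.ne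
  refine ⟨C₁ ^ q * (D ^ (q / 2) * C₃ ^ (1 / 3 : ℝ) * C₂ * C₄ ^ (1 / 2 : ℝ)) *
      ((v ^ (-(1 / p))) ^ ((1 - p / q) * q) * C₅), ?_, fun t ht F hF => ?_⟩
  · refine ENNReal.mul_lt_top (ENNReal.mul_lt_top (hfin hq0.le hC₁) (ENNReal.mul_lt_top
      (ENNReal.mul_lt_top (ENNReal.mul_lt_top (hfin (by positivity) hDt)
        (hfin (by norm_num) hC₃)) hC₂) (hfin (by norm_num) hC₄))) (ENNReal.mul_lt_top ?_ hC₅)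
    refine hfin (mul_pos hpq hq0).le (lt_top_iff_ne_top.2 ?_)
    exact ENNReal.rpow_ne_top_of_ne_zero hv0 hvt
  set Nrm := ∏ j, (∫⁻ z, F j z ^ P j) ^ (1 / P j) with hNrm
  set V : Rn n → ℝ≥0∞ := fun x => prodMax τ t F x ^ (p / q) *
    (v ^ (-(1 / p)) * Nrm) ^ (1 - p / q) with hV
  have hVm : Measurable V := ((measurable_prodMax τ t hF).pow_const _).mul_const _
  set H : ℤ → Rn n → ℝ≥0∞ := fun K => fracTerm γ τ (t * 2 ^ K) F with hH
  set φ : ℤ → Rn n → ℝ≥0∞ := fun K => oscProd b (t * 2 ^ K) with hφ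
  have hHm : ∀ K, Measurable (H K) := fun K => measurable_fracTerm γ τ _ hF
  have hφm : ∀ K, Measurable (φ K) := fun K => measurable_oscProd hbm _
  have hV1 : ∀ x, ∑' K, H K x ^ (1 / 2 : ℝ) ≤ C₁ * V x ^ (1 / 2 : ℝ) := fun x => h₁ t ht F hF x
  have hV2 : ∀ x, ∑' K, H K x ^ (q / 2) ≤ C₂ * V x ^ (q / 2) := fun x => h₂ t ht F hF x
  -- the pointwise bound
  have hpt : ∀ x, fracSum γ τ b t F x ^ q ≤
      C₁ ^ q * ∑' K, V x ^ (q / 2) * (φ K x ^ q * H K x ^ (q / 2)) := by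
    intro x
    set S := ∑' K, φ K x ^ q * H K x ^ (q / 2) with hS
    -- Half of the power of H stays with the oscillations, where a single term is bounded by the
    -- whole sum S; the other half is summed over K by Hedberg's inequality. Nothing is assumed on
    -- whether q is above or below 1.
    have hterm : ∀ K, φ K x * H K x ≤ S ^ (1 / q) * H K x ^ (1 / 2 : ℝ) := by
      intro K
      have e1 : (φ K x ^ q * H K x ^ (q / 2)) ^ (1 / q) = φ K x * H K x ^ (1 / 2 : ℝ) := by
        rw [ENNReal.mul_rpow_of_nonneg _ _ (by positivity), ← ENNReal.rpow_mul, ← ENNReal.rpow_mul,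
          mul_one_div_cancel hq0.ne', ENNReal.rpow_one]
        congr 2; field_simp
      have e2 : H K x = H K x ^ (1 / 2 : ℝ) * H K x ^ (1 / 2 : ℝ) := by
        rw [← ENNReal.rpow_add_of_nonneg _ _ (by norm_num) (by norm_num)]; norm_num
      calc φ K x * H K x = (φ K x * H K x ^ (1 / 2 : ℝ)) * H K x ^ (1 / 2 : ℝ) := by
            rw [mul_assoc, ← e2]
        _ = (φ K x ^ q * H K x ^ (q / 2)) ^ (1 / q) * H K x ^ (1 / 2 : ℝ) := by rw [e1]
        _ ≤ _ := by
            gcongr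
            exact ENNReal.le_tsum (f := fun K => φ K x ^ q * H K x ^ (q / 2)) K
    calc fracSum γ τ b t F x ^ q ≤ (∑' K, S ^ (1 / q) * H K x ^ (1 / 2 : ℝ)) ^ q := by
          refine ENNReal.rpow_le_rpow (ENNReal.tsum_le_tsum hterm) hq0.le
      _ ≤ (S ^ (1 / q) * (C₁ * V x ^ (1 / 2 : ℝ))) ^ q := by
          rw [ENNReal.tsum_mul_left]
          gcongr
          exact hV1 x
      _ = C₁ ^ q * (V x ^ (q / 2) * S) := by
          rw [ENNReal.mul_rpow_of_nonneg _ _ hq0.le, ENNReal.mul_rpow_of_nonneg _ _ hq0.le,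
            ← ENNReal.rpow_mul, ← ENNReal.rpow_mul, one_div_mul_cancel hq0.ne', ENNReal.rpow_one,
            show 1 / 2 * q = q / 2 by ring]
          ring
      _ = _ := by rw [hS, ENNReal.tsum_mul_left]
  -- integration at a fixed scale
  set M : Rn n → ℝ≥0∞ := dyMax t fun z => V z ^ (q * 3 / 4) with hM
  have hMm : Measurable M := measurable_dyMax (hVm.pow_const _) t
  have hconj : Real.HolderConjugate (3 / 2 : ℝ) 3 := by
    rw [Real.holderConjugate_iff]; norm_num
  have hscale : ∀ K : ℤ, ∫⁻ x, V x ^ (q / 2) * (φ K x ^ q * H K x ^ (q / 2)) ≤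
      ∫⁻ z, D ^ (q / 2) * C₃ ^ (1 / 3 : ℝ) * (H (K + 1) z ^ (q / 2) * M z ^ (2 / 3 : ℝ)) := by
    intro K
    have hpos : 0 < t * (2 : ℝ) ^ K := by positivity
    have hmeas : Measurable fun x => V x ^ (q / 2) * (φ K x ^ q * H K x ^ (q / 2)) :=
      (hVm.pow_const _).mul (((hφm K).pow_const _).mul ((hHm K).pow_const _))
    -- Averaging at the scale of H_K costs nothing. On such a ball H_K is bounded by a multiple of
    -- H_{K+1} at the centre, so only V and the oscillations remain inside the average and can be
    -- separated by Hölder.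
    rw [← lintegral_ballAvg hmeas hpos]
    refine lintegral_mono fun z => ?_
    have hH2 : ∀ x ∈ Metric.ball z (t * 2 ^ K), H K x ≤ D * H (K + 1) z := by
      intro x hx
      refine (fracTerm_le_two_mul hγ.le hτ hpos hx F).trans (le_of_eq ?_)
      simp only [hH]
      rw [zpow_add_one₀ (by norm_num), ← mul_assoc t, mul_comm 2]
    calc ballAvg (t * 2 ^ K) (fun x => V x ^ (q / 2) * (φ K x ^ q * H K x ^ (q / 2))) z
        ≤ ballAvg (t * 2 ^ K) (fun x => (D * H (K + 1) z) ^ (q / 2) *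
            (V x ^ (q / 2) * φ K x ^ q)) z := by
          refine ballAvg_mono fun x hx => ?_
          calc _ = H K x ^ (q / 2) * (V x ^ (q / 2) * φ K x ^ q) := by ring
            _ ≤ _ := by gcongr; exact hH2 x hx
      _ = (D * H (K + 1) z) ^ (q / 2) *
            ballAvg (t * 2 ^ K) (fun x => V x ^ (q / 2) * φ K x ^ q) z :=
          ballAvg_const_mul _ ((hVm.pow_const _).mul ((hφm K).pow_const _)).aemeasurable z
      _ ≤ (D * H (K + 1) z) ^ (q / 2) *
            (ballAvg (t * 2 ^ K) (fun x => (V x ^ (q / 2)) ^ (3 / 2 : ℝ)) z ^ (1 / (3 / 2) : ℝ) *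
            ballAvg (t * 2 ^ K) (fun x => (φ K x ^ q) ^ (3 : ℝ)) z ^ (1 / 3 : ℝ)) := by
          gcongr
          exact ballAvg_mul_le hconj (hVm.pow_const _).aemeasurable
            ((hφm K).pow_const _).aemeasurable z
      _ ≤ (D * H (K + 1) z) ^ (q / 2) * (M z ^ (2 / 3 : ℝ) * C₃ ^ (1 / 3 : ℝ)) := by
          gcongr
          · rw [show (1 / (3 / 2) : ℝ) = 2 / 3 by norm_num]
            gcongr
            refine le_trans (le_of_eq ?_) (ballAvg_le_dyMax t _ z K)
            simp_rw [← ENNReal.rpow_mul]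
            congr 1
            ext x; congr 1; ring
          · have := h₃ z (t * 2 ^ K) hpos 0
            simp only [pow_zero, one_mul, CharP.cast_eq_zero, zero_add, ENNReal.one_rpow,
              mul_one] at this
            simp_rw [← ENNReal.rpow_mul]
            exact this
      _ = _ := by rw [ENNReal.mul_rpow_of_nonneg _ _ (by positivity)]; ring
  have hVq : ∫⁻ x, V x ^ q ≤ (v ^ (-(1 / p))) ^ ((1 - p / q) * q) * C₅ * Nrm ^ q := by
    calc ∫⁻ x, V x ^ q = ∫⁻ x, (v ^ (-(1 / p)) * Nrm) ^ ((1 - p / q) * q) *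
          prodMax τ t F x ^ p := by
          refine lintegral_congr fun x => ?_
          simp only [hV]
          rw [ENNReal.mul_rpow_of_nonneg _ _ hq0.le, ← ENNReal.rpow_mul, ← ENNReal.rpow_mul,
            div_mul_cancel₀ _ hq0.ne', mul_comm]
      _ = (v ^ (-(1 / p)) * Nrm) ^ ((1 - p / q) * q) * ∫⁻ x, prodMax τ t F x ^ p :=
          lintegral_const_mul _ ((measurable_prodMax τ t hF).pow_const _)
      _ ≤ (v ^ (-(1 / p)) * Nrm) ^ ((1 - p / q) * q) * (C₅ * Nrm ^ p) := by
          gcongr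
          exact h₅ t ht F hF
      _ = (v ^ (-(1 / p))) ^ ((1 - p / q) * q) * C₅ * (Nrm ^ ((1 - p / q) * q) * Nrm ^ p) := by
          rw [ENNReal.mul_rpow_of_nonneg _ _ (mul_pos hpq hq0).le]; ring
      _ = _ := by
          rw [← ENNReal.rpow_add_of_nonneg _ _ (mul_pos hpq hq0).le hp0.le]
          congr 2
          field_simp; ring
  have hMV : ∫⁻ z, V z ^ (q / 2) * M z ^ (2 / 3 : ℝ) ≤ C₄ ^ (1 / 2 : ℝ) * ∫⁻ x, V x ^ q := by
    have hc2 : Real.HolderConjugate (2 : ℝ) 2 := by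
      rw [Real.holderConjugate_iff]; norm_num
    calc _ ≤ (∫⁻ z, (V z ^ (q / 2)) ^ (2 : ℝ)) ^ (1 / 2 : ℝ) *
          (∫⁻ z, (M z ^ (2 / 3 : ℝ)) ^ (2 : ℝ)) ^ (1 / 2 : ℝ) :=
          ENNReal.lintegral_mul_le_Lp_mul_Lq _ hc2 (hVm.pow_const _).aemeasurable
            (hMm.pow_const _).aemeasurable
      _ ≤ (∫⁻ z, V z ^ q) ^ (1 / 2 : ℝ) * (C₄ * ∫⁻ z, V z ^ q) ^ (1 / 2 : ℝ) := by
          gcongr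
          · rw [← ENNReal.rpow_mul]; norm_num
          · refine le_trans (le_of_eq ?_) ((h₄ t ht _ (hVm.pow_const (q * 3 / 4))).trans
              (le_of_eq ?_))
            · refine lintegral_congr fun z => ?_
              rw [← ENNReal.rpow_mul]; norm_num [hM]
            · congr 1
              refine lintegral_congr fun z => ?_
              rw [← ENNReal.rpow_mul]; congr 1; ring
      _ = C₄ ^ (1 / 2 : ℝ) * ((∫⁻ z, V z ^ q) ^ (1 / 2 : ℝ) * (∫⁻ z, V z ^ q) ^ (1 / 2 : ℝ)) := by
          rw [ENNReal.mul_rpow_of_nonneg _ _ (by norm_num)]; ring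
      _ = _ := by
          rw [← ENNReal.rpow_add_of_nonneg _ _ (by norm_num) (by norm_num)]; norm_num
  calc ∫⁻ x, fracSum γ τ b t F x ^ q
      ≤ ∫⁻ x, C₁ ^ q * ∑' K, V x ^ (q / 2) * (φ K x ^ q * H K x ^ (q / 2)) :=
        lintegral_mono hpt
    _ = C₁ ^ q * ∑' K, ∫⁻ x, V x ^ (q / 2) * (φ K x ^ q * H K x ^ (q / 2)) := by
        have hm : ∀ K, Measurable fun x => V x ^ (q / 2) * (φ K x ^ q * H K x ^ (q / 2)) :=
          fun K => (hVm.pow_const _).mul (((hφm K).pow_const _).mul ((hHm K).pow_const _))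
        rw [lintegral_const_mul _ (Measurable.tsum hm),
          lintegral_tsum fun K => (hm K).aemeasurable]
    _ ≤ C₁ ^ q * ∑' K : ℤ, ∫⁻ z, D ^ (q / 2) * C₃ ^ (1 / 3 : ℝ) *
        (H (K + 1) z ^ (q / 2) * M z ^ (2 / 3 : ℝ)) :=
        mul_le_mul_right (ENNReal.tsum_le_tsum hscale) _
    _ = C₁ ^ q * ∫⁻ z, D ^ (q / 2) * C₃ ^ (1 / 3 : ℝ) *
        ((∑' K, H K z ^ (q / 2)) * M z ^ (2 / 3 : ℝ)) := by
        have hm : ∀ K, Measurable fun z => D ^ (q / 2) * C₃ ^ (1 / 3 : ℝ) *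
            (H K z ^ (q / 2) * M z ^ (2 / 3 : ℝ)) := fun K =>
          (((hHm K).pow_const _).mul (hMm.pow_const _)).const_mul _
        have hsh := (Equiv.addRight (1 : ℤ)).tsum_eq fun K => ∫⁻ z, D ^ (q / 2) *
          C₃ ^ (1 / 3 : ℝ) * (H K z ^ (q / 2) * M z ^ (2 / 3 : ℝ))
        simp only [Equiv.coe_addRight] at hsh
        rw [hsh, ← lintegral_tsum fun K => (hm K).aemeasurable]
        simp_rw [ENNReal.tsum_mul_left, ENNReal.tsum_mul_right]
    _ ≤ C₁ ^ q * ∫⁻ z, D ^ (q / 2) * C₃ ^ (1 / 3 : ℝ) * C₂ *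
        (V z ^ (q / 2) * M z ^ (2 / 3 : ℝ)) := by
        refine mul_le_mul_right (lintegral_mono fun z => ?_) _
        rw [mul_assoc (D ^ (q / 2) * C₃ ^ (1 / 3 : ℝ)) C₂, ← mul_assoc C₂]
        gcongr
        exact hV2 z
    _ = C₁ ^ q * (D ^ (q / 2) * C₃ ^ (1 / 3 : ℝ) * C₂) *
        ∫⁻ z, V z ^ (q / 2) * M z ^ (2 / 3 : ℝ) := by
        rw [lintegral_const_mul (f := fun z => V z ^ (q / 2) * M z ^ (2 / 3 : ℝ)) _
          ((hVm.pow_const _).mul (hMm.pow_const _))]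
        ring
    _ ≤ C₁ ^ q * (D ^ (q / 2) * C₃ ^ (1 / 3 : ℝ) * C₂) *
        (C₄ ^ (1 / 2 : ℝ) * ((v ^ (-(1 / p))) ^ ((1 - p / q) * q) * C₅ * Nrm ^ q)) := by
        gcongr
        exact hMV.trans (mul_le_mul_right hVq _)
    _ = _ := by ring

end FracSum

/-! ### The dominating operator on amalgam spaces -/

section Amalgam

variable {n m : ℕ} {𝕜 : Type*} [RCLike 𝕜]

/-- `(∫_{B(y, r)} F^P)^{1/P}`. -/
def ballNorm (P r : ℝ) (F : Rn n → ℝ≥0∞) (y : Rn n) : ℝ≥0∞ :=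
  (∫⁻ z in Metric.ball y r, F z ^ P) ^ (1 / P)

theorem measurable_ballNorm {F : Rn n → ℝ≥0∞} (hF : Measurable F) (P r : ℝ) :
    Measurable (ballNorm P r F) :=
  (measurable_setLIntegral_ball (F := fun _ z => F z ^ P)
    ((hF.pow_const P).comp measurable_snd) r).pow_const _

/-- For x in B(y,r) a ball of radius at most r about x stays inside B(y,2r), so at those scales the
data may be cut off there. The scale r itself is counted in both parts. -/
theorem fracSum_le_add {γ : ℝ} {τ : Fin m → ℝ} (hτ : ∀ j, 0 < τ j) (b : Fin m → Rn n → 𝕜)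
    {r : ℝ} (hr : 0 < r) (F : Fin m → Rn n → ℝ≥0∞) {x y : Rn n} (hx : x ∈ Metric.ball y r) :
    fracSum γ τ b r F x ≤
      ∑' k : ℕ, oscProd b (2 ^ k * r) x * fracTerm γ τ (2 ^ k * r) F x +
        fracSum γ τ b r (fun j => (Metric.ball y (2 * r)).indicator (F j)) x := by
  refine (tsum_int_le _).trans (add_le_add (le_of_eq ?_) ?_)
  · simp_rw [zpow_natCast, mul_comm r]
  · refine le_trans (ENNReal.tsum_le_tsum fun k => ?_)
      (ENNReal.tsum_comp_le_tsum_of_injective (f := fun k : ℕ => -(k : ℤ))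
        (fun _ _ h => by simpa using h) _)
    refine mul_le_mul_right (fracTerm_mono hτ fun j z hz => ?_) _
    rw [Set.indicator_of_mem]
    rw [Metric.mem_ball] at hz hx ⊢
    have h1 : r * (2 : ℝ) ^ (-(k : ℤ)) ≤ r :=
      mul_le_of_le_one_right hr.le (zpow_le_one_of_nonpos₀ (by norm_num) (by simp))
    linarith [dist_triangle z x y]

/-- Scales up to r are covered by the global Lebesgue bound for the data cut off to B(y,2r), which
gives the term k = 0. At scale 2^k r the fractional average is bounded on all of B(y,r) through the
norms over B(y, 2^{k+1} r) with the factor (2^k r)^{-n/q}; its q-th power times the volume r^n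
leaves 2^{-nk}. One half of δ pays for taking the q-th power of the series, the other for the growth
of the oscillations. -/
theorem setLIntegral_fracSum_rpow_le {γ p q : ℝ} {τ P : Fin m → ℝ} (hn : 0 < n) (hm : 0 < m)
    (hγ : 0 < γ) (hp0 : 0 < p) (hq0 : 0 < q)
    (hτ : ∀ j, 0 < τ j) (hτP : ∀ j, τ j < P j) (hp : 1 / p = ∑ j, 1 / P j)
    (hq : 1 / q = 1 / p - γ / n) {b : Fin m → Rn n → 𝕜}
    (hbm : ∀ j, Measurable (b j)) (hb : ∀ j, HasOscMoments (b j)) {δ : ℝ} (hδ : 0 < δ) :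
    ∃ C : ℝ≥0∞, C < ∞ ∧ ∀ r : ℝ, 0 < r → ∀ F : Fin m → Rn n → ℝ≥0∞, (∀ j, Measurable (F j)) →
      ∀ y, ∫⁻ x in Metric.ball y r, fracSum γ τ b r F x ^ q ≤
        C * ∑' k : ℕ, (2 : ℝ≥0∞) ^ ((δ - n) * k) *
          (∏ j, ballNorm (P j) (2 ^ (k + 1) * r) (F j) y) ^ q := by
  have hn' : (0 : ℝ) < n := by exact_mod_cast hn
  have hP : ∀ j, 0 < P j := fun j => (hτ j).trans (hτP j)
  obtain ⟨C₁, hC₁, h₁⟩ := lintegral_fracSum_rpow_le hn hm hγ hp0 hq0 hτ hτP hp hq hbm hb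
  obtain ⟨C₂, hC₂, h₂⟩ := tsum_rpow_le (a := q) (δ := δ / 2) hq0 (by positivity)
  obtain ⟨C₃, hC₃, N, h₃⟩ := ballAvg_prod_oscAvg_rpow_le hm hbm hb (u := q) hq0
  obtain ⟨C₄, hC₄, h₄⟩ := exists_add_one_rpow_le N (δ := δ / 2) (by positivity)
  set v := volume (Metric.ball (0 : Rn n) 1)
  have hv0 : v ≠ 0 := volume_ball_pos _ one_pos
  have hvt : v ≠ ∞ := volume_ball_ne_top _ _
  set D := C₂ * ((v ^ (-(1 / p))) ^ q * v * C₃ * C₄)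
  have hDt : D < ∞ := ENNReal.mul_lt_top hC₂ (ENNReal.mul_lt_top (ENNReal.mul_lt_top
    (ENNReal.mul_lt_top (ENNReal.rpow_lt_top_of_nonneg hq0.le
      (ENNReal.rpow_ne_top_of_ne_zero hv0 hvt)) hvt.lt_top) hC₃) hC₄)
  refine ⟨2 ^ q * (D + C₁), ENNReal.mul_lt_top (ENNReal.rpow_lt_top_of_nonneg hq0.le (by simp))
    (ENNReal.add_lt_top.2 ⟨hDt, hC₁⟩), fun r hr F hF y => ?_⟩
  set Q : ℕ → ℝ≥0∞ := fun k => ∏ j, ballNorm (P j) (2 ^ (k + 1) * r) (F j) y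
  set S := ∑' k : ℕ, (2 : ℝ≥0∞) ^ ((δ - n) * k) * Q k ^ q with hS
  set φ : ℕ → Rn n → ℝ≥0∞ := fun k => oscProd b (2 ^ k * r)
  set H : ℕ → Rn n → ℝ≥0∞ := fun k => fracTerm γ τ (2 ^ k * r) F
  set F' : Fin m → Rn n → ℝ≥0∞ := fun j => (Metric.ball y (2 * r)).indicator (F j) with hF'
  have hF'm : ∀ j, Measurable (F' j) := fun j => (hF j).indicator Metric.isOpen_ball.measurableSet
  have hφm : ∀ k, Measurable (φ k) := fun k => measurable_oscProd hbm _
  have hHm : ∀ k, Measurable (H k) := fun k => measurable_fracTerm γ τ _ hF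
  have hloc : ∫⁻ x, fracSum γ τ b r F' x ^ q ≤ C₁ * S := by
    refine (h₁ r hr F' hF'm).trans (mul_le_mul_right ?_ _)
    refine le_trans (le_of_eq ?_) (ENNReal.le_tsum 0)
    rw [Nat.cast_zero, mul_zero, ENNReal.rpow_zero, one_mul]
    congr 1
    refine Finset.prod_congr rfl fun j _ => ?_
    rw [ballNorm, zero_add, pow_one, ← lintegral_indicator Metric.isOpen_ball.measurableSet]
    congr 1
    refine lintegral_congr fun z => ?_
    by_cases hz : z ∈ Metric.ball y (2 * r)
    · simp only [hF', Set.indicator_of_mem hz]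
    · simp only [hF', Set.indicator_of_notMem hz, ENNReal.zero_rpow_of_pos (hP j)]
  have hsum : ∀ k, ∫⁻ x in Metric.ball y r, (φ k x * H k x) ^ q ≤
      (v ^ (-(1 / p))) ^ q * v * C₃ * C₄ * (2 ^ (δ / 2 * k) * 2 ^ (-(n * k : ℝ)) * Q k ^ q) := by
    intro k
    have hpos : 0 < 2 ^ k * r := by positivity
    have hHk : ∀ x ∈ Metric.ball y r, H k x ≤
        ENNReal.ofReal (2 ^ k * r) ^ (-(n * (1 / p) - γ)) * (v ^ (-(1 / p)) * Q k) := by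
      intro x hx
      refine (fracTerm_le_prod_lintegral hτ (fun j => (hτP j).le) hp hpos hF x).trans ?_
      refine mul_le_mul_right (mul_le_mul_right (Finset.prod_le_prod' fun j _ =>
        ENNReal.rpow_le_rpow (lintegral_mono_set ?_) (one_div_pos.2 (hP j)).le) _) _
      refine Metric.ball_subset_ball' ?_
      rw [Metric.mem_ball] at hx
      have : r ≤ 2 ^ k * r := le_mul_of_one_le_left hr.le (one_le_pow₀ (by norm_num))
      rw [pow_succ]; linarith
    have hexp : (-(n * (1 / p) - γ)) * q = -(n : ℝ) := by
      have : n * (1 / p) - γ = n * (1 / q) := by rw [hq]; field_simp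
      rw [this]; field_simp
    calc ∫⁻ x in Metric.ball y r, (φ k x * H k x) ^ q
        ≤ ∫⁻ x in Metric.ball y r, (ENNReal.ofReal (2 ^ k * r) ^ (-(n * (1 / p) - γ)) *
            (v ^ (-(1 / p)) * Q k)) ^ q * φ k x ^ q := by
          refine setLIntegral_mono' Metric.isOpen_ball.measurableSet fun x hx => ?_
          rw [← ENNReal.mul_rpow_of_nonneg _ _ hq0.le, mul_comm]
          gcongr
          exact hHk x hx
      _ = (ENNReal.ofReal (2 ^ k * r) ^ (-(n * (1 / p) - γ)) * (v ^ (-(1 / p)) * Q k)) ^ q *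
            ∫⁻ x in Metric.ball y r, φ k x ^ q := lintegral_const_mul _ ((hφm k).pow_const q)
      _ ≤ (ENNReal.ofReal (2 ^ k * r) ^ (-(n * (1 / p) - γ)) * (v ^ (-(1 / p)) * Q k)) ^ q *
            (C₃ * (C₄ * 2 ^ (δ / 2 * k)) * volume (Metric.ball y r)) := by
          gcongr
          have h5 := (h₃ y r hr k).trans (mul_le_mul_right (h₄ k) C₃)
          rw [ballAvg_eq] at h5
          exact (ENNReal.div_le_iff_le_mul (Or.inl (volume_ball_pos y hr))
            (Or.inl (volume_ball_ne_top y r))).1 h5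
      _ = _ := by
          have h2k : ENNReal.ofReal (2 ^ k * r) ^ (-(n : ℝ)) * ENNReal.ofReal (r ^ n) =
              2 ^ (-(n * k : ℝ)) := by
            rw [ENNReal.ofReal_mul (by positivity), ENNReal.mul_rpow_of_ne_top (by simp) (by simp),
              ENNReal.ofReal_pow hr.le, ← ENNReal.rpow_natCast (ENNReal.ofReal r) n, mul_assoc,
              ← ENNReal.rpow_add _ _ (by simpa using hr) (by simp), neg_add_cancel,
              ENNReal.rpow_zero, mul_one, ENNReal.ofReal_pow (by norm_num), ENNReal.ofReal_ofNat,
              ← ENNReal.rpow_natCast, ← ENNReal.rpow_mul]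
            congr 1; ring
          rw [ENNReal.mul_rpow_of_nonneg _ _ hq0.le, ENNReal.mul_rpow_of_nonneg _ _ hq0.le,
            ← ENNReal.rpow_mul (ENNReal.ofReal (2 ^ k * r)), hexp, volume_ball_eq y hr, ← h2k]
          ring
  have hnn : ∀ x ∈ Metric.ball y r, fracSum γ τ b r F x ^ q ≤
      2 ^ q * (C₂ * ∑' k : ℕ, (2 : ℝ≥0∞) ^ (δ / 2 * k) * (φ k x * H k x) ^ q +
        fracSum γ τ b r F' x ^ q) := by
    intro x hx
    refine (ENNReal.rpow_le_rpow (fracSum_le_add hτ b hr F hx) hq0.le).trans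
      ((add_rpow_le_two_rpow_mul _ _ hq0.le).trans ?_)
    gcongr
    exact h₂ _
  have hGm : ∀ k : ℕ, Measurable fun x => (2 : ℝ≥0∞) ^ (δ / 2 * k) * (φ k x * H k x) ^ q :=
    fun k => (((hφm k).mul (hHm k)).pow_const q).const_mul _
  calc ∫⁻ x in Metric.ball y r, fracSum γ τ b r F x ^ q
      ≤ ∫⁻ x in Metric.ball y r, 2 ^ q * (C₂ * ∑' k : ℕ, (2 : ℝ≥0∞) ^ (δ / 2 * k) *
          (φ k x * H k x) ^ q + fracSum γ τ b r F' x ^ q) :=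
        setLIntegral_mono' Metric.isOpen_ball.measurableSet hnn
    _ = 2 ^ q * (C₂ * ∑' k : ℕ, (2 : ℝ≥0∞) ^ (δ / 2 * k) *
          (∫⁻ x in Metric.ball y r, (φ k x * H k x) ^ q) +
          ∫⁻ x in Metric.ball y r, fracSum γ τ b r F' x ^ q) := by
        have hG : Measurable fun x => ∑' k : ℕ, (2 : ℝ≥0∞) ^ (δ / 2 * k) * (φ k x * H k x) ^ q :=
          Measurable.tsum hGm
        have hF'q : Measurable fun x => fracSum γ τ b r F' x ^ q :=
          (measurable_fracSum γ τ hbm r hF'm).pow_const q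
        rw [lintegral_const_mul (f := fun x => C₂ * ∑' k : ℕ, (2 : ℝ≥0∞) ^ (δ / 2 * k) *
            (φ k x * H k x) ^ q + fracSum γ τ b r F' x ^ q) _ ((hG.const_mul _).add hF'q),
          lintegral_add_left (hG.const_mul _), lintegral_const_mul _ hG,
          lintegral_tsum fun k => (hGm k).aemeasurable]
        congr 4
        ext k
        exact lintegral_const_mul _ (((hφm k).mul (hHm k)).pow_const q)
    _ ≤ 2 ^ q * (C₂ * ∑' k : ℕ, (2 : ℝ≥0∞) ^ (δ / 2 * k) *
          ((v ^ (-(1 / p))) ^ q * v * C₃ * C₄ *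
            (2 ^ (δ / 2 * k) * 2 ^ (-(n * k : ℝ)) * Q k ^ q)) + C₁ * S) := by
        refine mul_le_mul_right (add_le_add (mul_le_mul_right (ENNReal.tsum_le_tsum fun k =>
          mul_le_mul_right (hsum k) _) _) ((setLIntegral_le_lintegral _ _).trans hloc)) _
    _ = 2 ^ q * (D * S + C₁ * S) := by
        congr 2
        rw [hS, ← ENNReal.tsum_mul_left, ← ENNReal.tsum_mul_left]
        congr with k
        have : (2 : ℝ≥0∞) ^ ((δ - n) * k) = 2 ^ (δ / 2 * k) * (2 ^ (δ / 2 * k) *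
            2 ^ (-(n * k : ℝ))) := by
          rw [← ENNReal.rpow_add _ _ (by norm_num) (by norm_num),
            ← ENNReal.rpow_add _ _ (by norm_num) (by norm_num)]
          congr 1; ring
        rw [this]; ring
    _ = _ := by ring

theorem eLpNorm_const_mul_ennreal {α : Type*} [MeasurableSpace α] {μ : Measure α}
    {f : α → ℝ≥0∞} (hf : Measurable f) (c u : ℝ≥0∞) :
    eLpNorm (fun y => c * f y) u μ = c * eLpNorm f u μ := by
  rcases eq_or_ne u 0 with rfl | hu
  · simp
  rcases eq_or_ne u ∞ with rfl | hut
  · simp only [eLpNorm_exponent_top, eLpNormEssSup, enorm_eq_self]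
    exact ENNReal.essSup_const_mul
  · have hu' : 0 < u.toReal := ENNReal.toReal_pos hu hut
    simp only [eLpNorm_eq_lintegral_rpow_enorm_toReal hu hut, enorm_eq_self,
      ENNReal.mul_rpow_of_nonneg _ _ hu'.le]
    rw [lintegral_const_mul _ (hf.pow_const _), ENNReal.mul_rpow_of_nonneg _ _ (by positivity),
      ← ENNReal.rpow_mul, mul_one_div_cancel hu'.ne', ENNReal.rpow_one]

/-- A quasi-triangle inequality for series with geometrically decaying norms. -/
theorem eLpNorm_tsum_rpow_le {α : Type*} [MeasurableSpace α] {μ : Measure α} {q δ : ℝ}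
    (hq : 0 < q) (hδ : 0 < δ) {s : ℝ≥0∞} (hs : s ≠ 0) :
    ∃ C : ℝ≥0∞, C < ∞ ∧ ∀ (g : ℕ → α → ℝ≥0∞) (A : ℝ≥0∞), (∀ k, AEMeasurable (g k) μ) →
      (∀ k : ℕ, eLpNorm (g k) s μ ≤ 2 ^ (-(δ * k)) * A) →
      eLpNorm (fun y => (∑' k, g k y ^ q) ^ (1 / q)) s μ ≤ C * A := by
  rcases eq_or_ne s ∞ with rfl | hst
  · refine ⟨(∑' k : ℕ, (2 : ℝ≥0∞) ^ (-(δ * q) * k)) ^ (1 / q),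
      ENNReal.rpow_lt_top_of_nonneg (by positivity)
        (tsum_two_rpow_lt_top (by nlinarith [mul_pos hδ hq])).ne, fun g A _ h => ?_⟩
    rw [eLpNorm_exponent_top]
    refine essSup_le_of_ae_le _ ?_
    have hall : ∀ᵐ y ∂μ, ∀ k : ℕ, g k y ≤ 2 ^ (-(δ * k)) * A := by
      rw [ae_all_iff]
      intro k
      have h1 := ae_le_eLpNormEssSup (f := g k) (μ := μ)
      rw [← eLpNorm_exponent_top] at h1
      filter_upwards [h1] with y hy
      exact hy.trans (h k)
    filter_upwards [hall] with y hy
    rw [enorm_eq_self]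
    calc (∑' k, g k y ^ q) ^ (1 / q) ≤
          (∑' k : ℕ, (2 : ℝ≥0∞) ^ (-(δ * q) * k) * A ^ q) ^ (1 / q) := by
          refine ENNReal.rpow_le_rpow (ENNReal.tsum_le_tsum fun k => ?_) (by positivity)
          refine (ENNReal.rpow_le_rpow (hy k) hq.le).trans (le_of_eq ?_)
          rw [ENNReal.mul_rpow_of_nonneg _ _ hq.le, ← ENNReal.rpow_mul]
          congr 2; ring
      _ = _ := by
          rw [ENNReal.tsum_mul_right, ENNReal.mul_rpow_of_nonneg _ _ (by positivity),
            ← ENNReal.rpow_mul, mul_one_div_cancel hq.ne', ENNReal.rpow_one]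
  · set s' := s.toReal
    have hs' : 0 < s' := ENNReal.toReal_pos hs hst
    -- Half of the decay pays for the weights of `tsum_rpow_le`; the other half keeps the series
    -- convergent.
    obtain ⟨C, hC, hCk⟩ := tsum_rpow_le (a := s' / q) (δ := δ * s' / 2) (by positivity)
      (by positivity)
    refine ⟨(C * ∑' k : ℕ, (2 : ℝ≥0∞) ^ (-(δ * s' / 2) * k)) ^ (1 / s'),
      ENNReal.rpow_lt_top_of_nonneg (by positivity) (ENNReal.mul_lt_top hC
        (tsum_two_rpow_lt_top (by nlinarith [mul_pos hδ hs']))).ne, fun g A hg h => ?_⟩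
    rw [eLpNorm_eq_lintegral_rpow_enorm_toReal hs hst]
    have hpt : ∀ y, ‖(∑' k, g k y ^ q) ^ (1 / q)‖ₑ ^ s' ≤
        C * ∑' k : ℕ, (2 : ℝ≥0∞) ^ (δ * s' / 2 * k) * g k y ^ s' := by
      intro y
      rw [enorm_eq_self, ← ENNReal.rpow_mul, one_div_mul_eq_div]
      refine (hCk _).trans (le_of_eq ?_)
      congr with k
      rw [← ENNReal.rpow_mul, mul_div_cancel₀ _ hq.ne']
    have hgk : ∀ k : ℕ, ∫⁻ y, g k y ^ s' ∂μ ≤ (2 : ℝ≥0∞) ^ (-(δ * s') * k) * A ^ s' := by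
      intro k
      have h1 := h k
      rw [eLpNorm_eq_lintegral_rpow_enorm_toReal hs hst] at h1
      have h2 := ENNReal.rpow_le_rpow h1 hs'.le
      simp only [enorm_eq_self] at h2
      rw [← ENNReal.rpow_mul, one_div_mul_cancel hs'.ne', ENNReal.rpow_one,
        ENNReal.mul_rpow_of_nonneg _ _ hs'.le, ← ENNReal.rpow_mul] at h2
      refine h2.trans (le_of_eq ?_)
      congr 2; ring
    have hm : ∀ k : ℕ, AEMeasurable (fun y => (2 : ℝ≥0∞) ^ (δ * s' / 2 * k) * g k y ^ s') μ :=
      fun k => ((hg k).pow_const _).const_mul _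
    calc (∫⁻ y, ‖(∑' k, g k y ^ q) ^ (1 / q)‖ₑ ^ s' ∂μ) ^ (1 / s')
        ≤ (∫⁻ y, C * ∑' k : ℕ, (2 : ℝ≥0∞) ^ (δ * s' / 2 * k) * g k y ^ s' ∂μ) ^ (1 / s') :=
          ENNReal.rpow_le_rpow (lintegral_mono hpt) (by positivity)
      _ = (C * ∑' k : ℕ, (2 : ℝ≥0∞) ^ (δ * s' / 2 * k) * ∫⁻ y, g k y ^ s' ∂μ) ^ (1 / s') := by
          rw [lintegral_const_mul' _ _ hC.ne, lintegral_tsum hm]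
          congr 3
          ext k
          exact lintegral_const_mul'' _ ((hg k).pow_const _)
      _ ≤ (C * ∑' k : ℕ, (2 : ℝ≥0∞) ^ (-(δ * s' / 2) * k) * A ^ s') ^ (1 / s') := by
          refine ENNReal.rpow_le_rpow (mul_le_mul_right (ENNReal.tsum_le_tsum fun k => ?_) _)
            (by positivity)
          refine (mul_le_mul_right (hgk k) _).trans (le_of_eq ?_)
          rw [← mul_assoc, ← ENNReal.rpow_add _ _ (by norm_num) (by norm_num)]
          congr 2; ring
      _ = _ := by
          rw [ENNReal.tsum_mul_right, ← mul_assoc, ENNReal.mul_rpow_of_nonneg _ _ (by positivity),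
            ← ENNReal.rpow_mul, mul_one_div_cancel hs'.ne', ENNReal.rpow_one]

/-- Hölder's inequality for proportional exponents. -/
theorem eLpNorm_prod_le {α : Type*} [MeasurableSpace α] {μ : Measure α} {w : Fin m → ℝ}
    (hw : ∀ j, 0 < w j) (hw1 : ∑ j, w j = 1) {s : ℝ≥0∞} {sj : Fin m → ℝ≥0∞} (hs : s ≠ 0)
    (hsj : ∀ j, (sj j)⁻¹ = ENNReal.ofReal (w j) * s⁻¹) {g : Fin m → α → ℝ≥0∞}
    (hg : ∀ j, AEMeasurable (g j) μ) :
    eLpNorm (fun y => ∏ j, g j y) s μ ≤ ∏ j, eLpNorm (g j) (sj j) μ := by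
  rcases eq_or_ne s ∞ with rfl | hst
  · have hsj' : ∀ j, sj j = ∞ := fun j => by
      have := hsj j; simpa using this
    simp only [hsj', eLpNorm_exponent_top]
    refine essSup_le_of_ae_le _ ?_
    have hall : ∀ᵐ y ∂μ, ∀ j, g j y ≤ eLpNormEssSup (g j) μ := by
      rw [ae_all_iff]
      exact fun j => ae_le_eLpNormEssSup
    filter_upwards [hall] with y hy
    rw [enorm_eq_self]
    exact Finset.prod_le_prod' fun j _ => hy j
  · have hs' : 0 < s.toReal := ENNReal.toReal_pos hs hst
    have hw' : ∀ j, ENNReal.ofReal (w j) ≠ 0 := fun j => by simpa using hw j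
    have hsj0 : ∀ j, sj j ≠ 0 := fun j h => by
      have := hsj j
      rw [h, ENNReal.inv_zero] at this
      exact ENNReal.mul_ne_top (by simp) (by simpa using hs) this.symm
    have hsjt : ∀ j, sj j ≠ ∞ := fun j h => by
      have := hsj j
      rw [h, ENNReal.inv_top] at this
      exact mul_ne_zero (hw' j) (by simpa using hst) this.symm
    have hreal : ∀ j, (sj j).toReal * w j = s.toReal := fun j => by
      have := congrArg ENNReal.toReal (hsj j)
      rw [ENNReal.toReal_mul, ENNReal.toReal_inv, ENNReal.toReal_inv,
        ENNReal.toReal_ofReal (hw j).le] at this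
      have h1 : 0 < (sj j).toReal := ENNReal.toReal_pos (hsj0 j) (hsjt j)
      field_simp at this
      linarith
    rw [eLpNorm_eq_lintegral_rpow_enorm_toReal hs hst]
    calc (∫⁻ y, ‖∏ j, g j y‖ₑ ^ s.toReal ∂μ) ^ (1 / s.toReal)
        = (∫⁻ y, ∏ j, (g j y ^ (sj j).toReal) ^ w j ∂μ) ^ (1 / s.toReal) := by
          congr 1
          refine lintegral_congr fun y => ?_
          rw [enorm_eq_self, ← ENNReal.prod_rpow_of_nonneg hs'.le]
          refine Finset.prod_congr rfl fun j _ => ?_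
          rw [← ENNReal.rpow_mul, hreal]
      _ ≤ (∏ j, (∫⁻ y, g j y ^ (sj j).toReal ∂μ) ^ w j) ^ (1 / s.toReal) :=
          ENNReal.rpow_le_rpow (ENNReal.lintegral_prod_norm_pow_le _
            (fun j _ => (hg j).pow_const _) hw1 fun j _ => (hw j).le) (by positivity)
      _ = _ := by
          rw [← ENNReal.prod_rpow_of_nonneg (by positivity)]
          refine Finset.prod_congr rfl fun j _ => ?_
          rw [eLpNorm_eq_lintegral_rpow_enorm_toReal (hsj0 j) (hsjt j), ← ENNReal.rpow_mul]
          simp only [enorm_eq_self]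
          congr 1
          have h1 : 0 < (sj j).toReal := ENNReal.toReal_pos (hsj0 j) (hsjt j)
          rw [← hreal j]
          have := hw j
          field_simp

/-- The boundedness of the dominating operator on products of amalgam spaces, scale by scale. -/
theorem eLpNorm_ballNorm_fracSum_le {γ p q αs : ℝ} {τ P αj : Fin m → ℝ} (hn : 0 < n) (hm : 0 < m)
    (hγ : 0 < γ) (hp0 : 0 < p) (hq0 : 0 < q)
    (hτ : ∀ j, 0 < τ j) (hτP : ∀ j, τ j < P j) (hp : 1 / p = ∑ j, 1 / P j)
    (hq : 1 / q = 1 / p - γ / n) {b : Fin m → Rn n → 𝕜}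
    (hbm : ∀ j, Measurable (b j)) (hb : ∀ j, HasOscMoments (b j))
    (hαs0 : 0 < αs) (hαs : 1 / αs = ∑ j, 1 / αj j - γ / n) {s : ℝ≥0∞} {sj : Fin m → ℝ≥0∞}
    (hαss : ENNReal.ofReal αs < s) {w : Fin m → ℝ}
    (hw : ∀ j, 0 < w j) (hw1 : ∑ j, w j = 1)
    (hsj : ∀ j, (sj j)⁻¹ = ENNReal.ofReal (w j) * s⁻¹) :
    ∃ C : ℝ≥0∞, C < ∞ ∧ ∀ F : Fin m → Rn n → ℝ≥0∞, (∀ j, Measurable (F j)) →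
      ∀ A : Fin m → ℝ≥0∞, (∀ j, ∀ ρ : ℝ, 0 < ρ →
        eLpNorm (fun y => volume (Metric.ball y ρ) ^ (1 / αj j - 1 / P j - (sj j)⁻¹.toReal) *
          ballNorm (P j) ρ (F j) y) (sj j) volume ≤ A j) →
      ∀ r : ℝ, 0 < r →
        eLpNorm (fun y => volume (Metric.ball y r) ^ (1 / αs - 1 / q - s⁻¹.toReal) *
          ballNorm q r (fracSum γ τ b r F) y) s volume ≤ C * ∏ j, A j := by
  have hn' : (0 : ℝ) < n := by exact_mod_cast hn
  have hs0 : s ≠ 0 := (bot_le.trans_lt hαss).ne'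
  set σ := s⁻¹.toReal with hσ
  have hσ1 : σ < 1 / αs := by
    rcases eq_or_ne s ∞ with rfl | hst
    · rw [hσ]; simpa using hαs0
    · rw [hσ, ENNReal.toReal_inv, ← one_div]
      exact one_div_lt_one_div_of_lt hαs0 ((ENNReal.ofReal_lt_iff_lt_toReal hαs0.le hst).1 hαss)
  have hσj : ∀ j, (sj j)⁻¹.toReal = w j * σ := fun j => by
    rw [hsj, ENNReal.toReal_mul, ENNReal.toReal_ofReal (hw j).le]
  -- The total geometric gain from one scale to the next, positive precisely because αs < s. Half of
  -- it is spent as δ = qε/2 in the local estimate, and the other half is the decay of the norms of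
  -- `g k`.
  set ε : ℝ := n * (1 / αs - σ) with hε
  have hε0 : 0 < ε := mul_pos hn' (by linarith)
  obtain ⟨C₁, hC₁, h₁⟩ := setLIntegral_fracSum_rpow_le hn hm hγ hp0 hq0 hτ hτP hp hq hbm hb
    (δ := q * (ε / 2)) (by positivity)
  obtain ⟨C₂, hC₂, h₂⟩ := eLpNorm_tsum_rpow_le (μ := (volume : Measure (Rn n))) hq0
    (half_pos hε0) hs0
  set e : ℝ := 1 / αs - 1 / q - σ with he
  set ej : Fin m → ℝ := fun j => 1 / αj j - 1 / P j - (sj j)⁻¹.toReal with hej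
  -- The shift γ/n occurs in both 1/αs and 1/q and cancels, so the exponents of the inputs add up to
  -- the exponent of the output.
  have hesum : ∑ j, ej j = e := by
    simp only [hej, Finset.sum_sub_distrib, hσj, ← Finset.sum_mul, hw1, one_mul]
    rw [← hp, he, hq, hαs]; ring
  have htwo : ∀ x : ℝ, (2 : ℝ≥0∞) ^ x < ∞ := fun x =>
    lt_top_iff_ne_top.2 (ENNReal.rpow_ne_top_of_ne_zero (by norm_num) (by norm_num))
  refine ⟨C₁ ^ (1 / q) * (C₂ * 2 ^ (-(n * e))), ENNReal.mul_lt_top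
    (ENNReal.rpow_lt_top_of_nonneg (by positivity) hC₁.ne) (ENNReal.mul_lt_top hC₂ (htwo _)),
    fun F hF A hA r hr => ?_⟩
  set V : ℝ → ℝ≥0∞ := fun ρ => volume (Metric.ball (0 : Rn n) ρ) with hV
  have hVeq : ∀ (y : Rn n) (ρ : ℝ), volume (Metric.ball y ρ) = V ρ := fun y ρ =>
    Measure.addHaar_ball_center _ _ _
  have hV0 : ∀ {ρ : ℝ}, 0 < ρ → V ρ ≠ 0 := fun hρ => volume_ball_pos _ hρ
  have hVt : ∀ ρ, V ρ ≠ ∞ := fun ρ => volume_ball_ne_top _ _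
  have hbn : ∀ j (ρ : ℝ), Measurable (ballNorm (P j) ρ (F j)) :=
    fun j ρ => measurable_ballNorm (hF j) _ _
  have hnorm : ∀ ρ : ℝ, 0 < ρ → eLpNorm (fun y => ∏ j, ballNorm (P j) ρ (F j) y) s volume ≤
      V ρ ^ (-e) * ∏ j, A j := by
    intro ρ hρ
    refine (eLpNorm_prod_le hw hw1 hs0 hsj fun j => (hbn j ρ).aemeasurable).trans ?_
    calc ∏ j, eLpNorm (ballNorm (P j) ρ (F j)) (sj j) volume ≤ ∏ j, (V ρ ^ (-ej j) * A j) := by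
          refine Finset.prod_le_prod' fun j _ => ?_
          have h := hA j ρ hρ
          simp only [hVeq] at h
          rw [eLpNorm_const_mul_ennreal (hbn j ρ)] at h
          calc _ = V ρ ^ (-ej j) * (V ρ ^ ej j *
                eLpNorm (ballNorm (P j) ρ (F j)) (sj j) volume) := by
                rw [← mul_assoc, ← ENNReal.rpow_add _ _ (hV0 hρ) (hVt ρ), neg_add_cancel,
                  ENNReal.rpow_zero, one_mul]
            _ ≤ _ := by gcongr
      _ = _ := by
          rw [Finset.prod_mul_distrib, prod_rpow_exponents _ (hV0 hρ) (hVt ρ),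
            Finset.sum_neg_distrib, hesum]
  set g : ℕ → Rn n → ℝ≥0∞ := fun k y => (2 ^ ((q * (ε / 2) - n) * k / q) * V r ^ e) *
    ∏ j, ballNorm (P j) (2 ^ (k + 1) * r) (F j) y with hg
  have hgm : ∀ k, AEMeasurable (g k) volume := fun k =>
    ((Finset.measurable_prod _ fun j _ => hbn j _).const_mul _).aemeasurable
  have hgk : ∀ k : ℕ, eLpNorm (g k) s volume ≤
      2 ^ (-(ε / 2 * k)) * (2 ^ (-(n * e)) * ∏ j, A j) := by
    intro k
    have hpos : 0 < 2 ^ (k + 1) * r := by positivity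
    rw [hg, eLpNorm_const_mul_ennreal (Finset.measurable_prod _ fun j _ => hbn j _) ]
    refine (mul_le_mul_right (hnorm _ hpos) _).trans (le_of_eq ?_)
    have hVk : V (2 ^ (k + 1) * r) = 2 ^ ((n : ℝ) * (k + 1)) * V r := by
      simp only [hV]
      rw [volume_ball_mul 0 0 (by positivity) hr, ← pow_mul, ENNReal.ofReal_pow (by norm_num),
        ENNReal.ofReal_ofNat, ← ENNReal.rpow_natCast]
      congr 2; push_cast; ring
    rw [hVk, ENNReal.mul_rpow_of_ne_top (htwo _).ne (hVt r), ← ENNReal.rpow_mul]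
    have hVV : V r ^ e * V r ^ (-e) = 1 := by
      rw [← ENNReal.rpow_add _ _ (hV0 hr) (hVt r), add_neg_cancel, ENNReal.rpow_zero]
    calc _ = 2 ^ ((q * (ε / 2) - n) * k / q) * 2 ^ ((n : ℝ) * (k + 1) * -e) *
          (V r ^ e * V r ^ (-e)) * ∏ j, A j := by ring
      _ = _ := by
          rw [hVV, mul_one, ← mul_assoc, ← ENNReal.rpow_add _ _ (by norm_num) (by norm_num),
            ← ENNReal.rpow_add _ _ (by norm_num) (by norm_num)]
          congr 2
          rw [he, hε]; field_simp; ring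
  have hpt : ∀ y, volume (Metric.ball y r) ^ e * ballNorm q r (fracSum γ τ b r F) y ≤
      C₁ ^ (1 / q) * (∑' k, g k y ^ q) ^ (1 / q) := by
    intro y
    have h3 := h₁ r hr F hF y
    have h4 : V r ^ e = ((V r ^ e) ^ q) ^ (1 / q) := by
      rw [← ENNReal.rpow_mul, mul_one_div_cancel hq0.ne', ENNReal.rpow_one]
    rw [hVeq, h4, ballNorm, ← ENNReal.mul_rpow_of_nonneg _ _ (by positivity),
      ← ENNReal.mul_rpow_of_nonneg _ _ (by positivity)]
    refine ENNReal.rpow_le_rpow ((mul_le_mul_right h3 _).trans (le_of_eq ?_)) (by positivity)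
    rw [mul_left_comm, ← ENNReal.tsum_mul_left]
    congr with k
    simp only [hg]
    rw [ENNReal.mul_rpow_of_nonneg _ _ hq0.le, ENNReal.mul_rpow_of_nonneg _ _ hq0.le,
      ← ENNReal.rpow_mul 2, div_mul_cancel₀ _ hq0.ne']
    ring
  calc _ ≤ eLpNorm (fun y => C₁ ^ (1 / q) * (∑' k, g k y ^ q) ^ (1 / q)) s volume :=
        eLpNorm_mono_enorm fun y => by simpa only [enorm_eq_self] using hpt y
    _ = C₁ ^ (1 / q) * eLpNorm (fun y => (∑' k, g k y ^ q) ^ (1 / q)) s volume := by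
        refine eLpNorm_const_mul_ennreal ?_ _ _
        refine (Measurable.tsum fun k => Measurable.pow_const ?_ _).pow_const _
        exact (Finset.measurable_prod _ fun j _ => hbn j _).const_mul _
    _ ≤ C₁ ^ (1 / q) * (C₂ * (2 ^ (-(n * e)) * ∏ j, A j)) := by
        gcongr
        exact h₂ g _ hgm hgk
    _ = _ := by ring

end Amalgam

/-! ### Multilinear operators as multilinear maps -/

section Multilinear

variable {n m : ℕ} {𝕜 : Type*} [RCLike 𝕜]

/-- The functions in a weighted Lebesgue space. -/
def weightedLp (𝕜 : Type*) [RCLike 𝕜] (P : ℝ) (w : Rn n → ℝ) : Submodule 𝕜 (Rn n → 𝕜) where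
  carrier := {f | MemLp f (ENNReal.ofReal P) (weightMeasure fun x => w x ^ P)}
  add_mem' := MemLp.add
  zero_mem' := MemLp.zero
  smul_mem' c _ hf := MemLp.const_smul hf c

theorem coe_update_weightedLp {P : Fin m → ℝ} {ω : Fin m → Rn n → ℝ}
    (f : ∀ j, weightedLp 𝕜 (P j) (ω j)) (i : Fin m) (z : weightedLp 𝕜 (P i) (ω i)) :
    (fun j => ((Function.update f i z j : weightedLp 𝕜 (P j) (ω j)) : Rn n → 𝕜)) =
      Function.update (fun j => (f j : Rn n → 𝕜)) i z := by
  funext j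
  by_cases h : j = i
  · subst h; simp
  · simp [h]

theorem coe_piecewise_weightedLp {P : Fin m → ℝ} {ω : Fin m → Rn n → ℝ} (s : Finset (Fin m))
    (f g : ∀ j, weightedLp 𝕜 (P j) (ω j)) :
    (fun j => ((s.piecewise f g j : weightedLp 𝕜 (P j) (ω j)) : Rn n → 𝕜)) =
      s.piecewise (fun j => (f j : Rn n → 𝕜)) (fun j => (g j : Rn n → 𝕜)) := by
  funext j
  by_cases h : j ∈ s <;> simp [h]

theorem memProdLp_update {P : Fin m → ℝ} {ω : Fin m → Rn n → ℝ}
    (f : ∀ j, weightedLp 𝕜 (P j) (ω j)) (i : Fin m) (z : weightedLp 𝕜 (P i) (ω i)) :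
    MemProdLp P ω (Function.update (fun j => (f j : Rn n → 𝕜)) i z) := by
  rw [← coe_update_weightedLp]
  exact fun j => (Function.update f i z j).2

/-- A multilinear operator, with values in germs of functions along the almost everywhere
filter. -/
def IsMultilinearOp.germMap {P : Fin m → ℝ} {ω : Fin m → Rn n → ℝ}
    {T : (Fin m → Rn n → 𝕜) → Rn n → 𝕜} (hT : IsMultilinearOp P ω T) :
    MultilinearMap 𝕜 (fun j => weightedLp 𝕜 (P j) (ω j))
      (Germ (ae (volume : Measure (Rn n))) 𝕜) where
  toFun f := ((T fun j => f j : Rn n → 𝕜) : Germ (ae (volume : Measure (Rn n))) 𝕜)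
  map_update_add' {hd} f i x y := by
    obtain rfl : hd = instDecidableEqFin m := Subsingleton.elim _ _
    have h := hT.1 (Function.update (fun j => (f j : Rn n → 𝕜)) i x) i y (memProdLp_update f i x)
      (by rw [Function.update_idem]; exact memProdLp_update f i y)
    simp only [Function.update_idem, Function.update_self] at h
    rw [coe_update_weightedLp, coe_update_weightedLp, coe_update_weightedLp, ← Germ.coe_add]
    exact Germ.coe_eq.2 h
  map_update_smul' {hd} f i c x := by
    obtain rfl : hd = instDecidableEqFin m := Subsingleton.elim _ _
    have h := hT.2 (Function.update (fun j => (f j : Rn n → 𝕜)) i x) i c (memProdLp_update f i x)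
    simp only [Function.update_idem, Function.update_self] at h
    rw [coe_update_weightedLp, coe_update_weightedLp, ← Germ.coe_smul]
    exact Germ.coe_eq.2 h

theorem germ_coe_sum {ι : Type*} (s : Finset ι) {l : Filter (Rn n)} (f : ι → Rn n → 𝕜) :
    ∑ i ∈ s, (f i : Germ l 𝕜) = ((fun x => ∑ i ∈ s, f i x : Rn n → 𝕜) : Germ l 𝕜) := by
  classical
  induction s using Finset.induction_on with
  | empty => simp; rfl
  | insert i s hi ih =>
    rw [Finset.sum_insert hi, ih, ← Germ.coe_add]
    congr 1
    funext x
    rw [Finset.sum_insert hi]; rfl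

theorem memProdLp_piecewise {P : Fin m → ℝ} {ω : Fin m → Rn n → ℝ} {f g : Fin m → Rn n → 𝕜}
    (hf : MemProdLp P ω f) (hg : MemProdLp P ω g) (s : Finset (Fin m)) :
    MemProdLp P ω (s.piecewise f g) := fun j => by
  by_cases h : j ∈ s
  · simpa [h] using hf j
  · simpa [h] using hg j

/-- In germs along the almost everywhere filter the identities of T become exact equalities, so the
expansion over subsets for a `MultilinearMap` applies and is then read back as an almost everywhere
statement. -/
theorem IsMultilinearOp.eq_sum_piecewise {P : Fin m → ℝ} {ω : Fin m → Rn n → ℝ}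
    {T : (Fin m → Rn n → 𝕜) → Rn n → 𝕜} (hT : IsMultilinearOp P ω T) {f g : Fin m → Rn n → 𝕜}
    (hf : MemProdLp P ω f) (hg : MemProdLp P ω g) (J : Finset (Fin m)) :
    T (J.piecewise (f + g) g) =ᵐ[volume]
      fun x => ∑ s ∈ J.powerset, T (s.piecewise f g) x := by
  have h := hT.germMap.map_piecewise_add (fun j => ⟨f j, hf j⟩) (fun j => ⟨g j, hg j⟩) J
  simp only [IsMultilinearOp.germMap, MultilinearMap.coe_mk, coe_piecewise_weightedLp] at h
  rw [germ_coe_sum] at h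
  exact Germ.coe_eq.1 h

theorem IsMultilinearOp.piecewise_smul {P : Fin m → ℝ} {ω : Fin m → Rn n → ℝ}
    {T : (Fin m → Rn n → 𝕜) → Rn n → 𝕜} (hT : IsMultilinearOp P ω T) {f : Fin m → Rn n → 𝕜}
    (hf : MemProdLp P ω f) (c : Fin m → 𝕜) (s : Finset (Fin m)) :
    T (s.piecewise (fun j => c j • f j) f) =ᵐ[volume] (∏ j ∈ s, c j) • T f := by
  have h := hT.germMap.map_piecewise_smul c (fun j => ⟨f j, hf j⟩) s
  simp only [IsMultilinearOp.germMap, MultilinearMap.coe_mk, coe_piecewise_weightedLp] at h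
  rw [← Germ.coe_smul] at h
  exact Germ.coe_eq.1 h

end Multilinear


/-! ### Pointwise domination -/

section Domination

variable {n m : ℕ} {𝕜 : Type*} [RCLike 𝕜]

/-- The set S lies in B(x, 4ρ), so its integral is at most a volume times an average centred at x.
The surplus power of the volume is |B|^{γ/(mn)}, that is, a multiple of ρ^{γ/m}. The sign condition
on 1 - γθ/(mn) allows the larger ball in the normalisation to be replaced by the ball of radius ρ.
-/
theorem fracAvg_le (hn : 0 < n) (hm : 0 < m) {γ θ : ℝ} (hγ : 0 < γ) (hθ : 0 < θ)
    (he : 0 ≤ 1 - γ * θ / (m * n : ℝ)) :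
    ∃ C : ℝ≥0∞, C < ∞ ∧ ∀ (f : Rn n → 𝕜) (c : Rn n) (ρ a : ℝ) (S : Set (Rn n)) (x : Rn n),
      0 < ρ → ρ ≤ a → S ⊆ Metric.ball c (2 * ρ) → x ∈ Metric.ball c ρ →
      fracAvg m γ θ (Metric.ball c a) S f ≤
        C * (ENNReal.ofReal (4 * ρ) ^ (γ / m) * lpAvg θ (4 * ρ) (fun z => ‖f z‖ₑ) x) := by
  have hn' : (0 : ℝ) < n := by exact_mod_cast hn
  have hm' : (0 : ℝ) < m := by exact_mod_cast hm
  set v := volume (Metric.ball (0 : Rn n) 1)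
  have hv0 : v ≠ 0 := volume_ball_pos _ one_pos
  have hvt : v ≠ ∞ := volume_ball_ne_top _ _
  refine ⟨((4 : ℝ≥0∞) ^ n) ^ (1 / θ) * v ^ (γ / (m * n)), ENNReal.mul_lt_top
    (ENNReal.rpow_lt_top_of_nonneg (by positivity) (by simp))
    (ENNReal.rpow_lt_top_of_nonneg (by positivity) hvt), fun f c ρ a S x hρ ha hS hx => ?_⟩
  set e := 1 - γ * θ / (m * n : ℝ) with he'
  set W := volume (Metric.ball c ρ) with hW
  have hW0 : W ≠ 0 := volume_ball_pos _ hρ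
  have hWt : W ≠ ∞ := volume_ball_ne_top _ _
  have hV : volume (Metric.ball x (4 * ρ)) = 4 ^ n * W := by
    rw [volume_ball_mul x c (by norm_num) hρ, ENNReal.ofReal_pow (by norm_num),
      ENNReal.ofReal_ofNat]
  have hV0 := volume_ball_pos x (by positivity : 0 < 4 * ρ)
  have hVt := volume_ball_ne_top x (4 * ρ)
  have hint : ∫⁻ z in S, ‖f z‖ₑ ^ θ ≤
      4 ^ n * W * ballAvg (4 * ρ) (fun z => ‖f z‖ₑ ^ θ) x := by
    rw [ballAvg_eq, ← hV, ENNReal.mul_div_cancel hV0 hVt]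
    refine lintegral_mono_set (hS.trans (Metric.ball_subset_ball' ?_))
    rw [Metric.mem_ball, dist_comm] at hx
    linarith
  have hWr : W ^ (γ / (m * n)) ≤ ENNReal.ofReal (4 * ρ) ^ (γ / m) * v ^ (γ / (m * n)) := by
    rw [hW, volume_ball_eq c hρ, ENNReal.mul_rpow_of_nonneg _ _ (by positivity),
      ENNReal.ofReal_pow hρ.le, ← ENNReal.rpow_natCast, ← ENNReal.rpow_mul]
    have : (n : ℝ) * (γ / (m * n)) = γ / m := by field_simp
    rw [this]
    gcongr
    linarith
  have hWW : (W ^ e)⁻¹ * W = W ^ (γ * θ / (m * n)) := by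
    rw [← ENNReal.rpow_neg]
    nth_rewrite 2 [← ENNReal.rpow_one W]
    rw [← ENNReal.rpow_add _ _ hW0 hWt]
    congr 1
    rw [he']; ring
  unfold fracAvg lpAvg
  calc _ ≤ ((W ^ e)⁻¹ * (4 ^ n * W * ballAvg (4 * ρ) (fun z => ‖f z‖ₑ ^ θ) x)) ^ (1 / θ) := by
        gcongr
        exact measure_mono (Metric.ball_subset_ball ha)
    _ = (4 ^ n * ((W ^ e)⁻¹ * W) * ballAvg (4 * ρ) (fun z => ‖f z‖ₑ ^ θ) x) ^ (1 / θ) := by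
        congr 1; ring
    _ = (4 ^ n) ^ (1 / θ) * W ^ (γ / (m * n)) *
          ballAvg (4 * ρ) (fun z => ‖f z‖ₑ ^ θ) x ^ (1 / θ) := by
        rw [hWW, ENNReal.mul_rpow_of_nonneg _ _ (by positivity),
          ENNReal.mul_rpow_of_nonneg _ _ (by positivity), ← ENNReal.rpow_mul]
        congr 3
        field_simp
    _ ≤ (4 ^ n) ^ (1 / θ) * (ENNReal.ofReal (4 * ρ) ^ (γ / m) * v ^ (γ / (m * n))) *
          ballAvg (4 * ρ) (fun z => ‖f z‖ₑ ^ θ) x ^ (1 / θ) := by gcongr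
    _ = _ := by ring

theorem MemProdLp.indicator {P : Fin m → ℝ} {ω : Fin m → Rn n → ℝ} {f : Fin m → Rn n → 𝕜}
    (hf : MemProdLp P ω f) {A : Set (Rn n)} (hA : MeasurableSet A) :
    MemProdLp P ω (fun j => A.indicator (f j)) := fun j => (hf j).indicator hA

theorem MemProdLp.sub {P : Fin m → ℝ} {ω : Fin m → Rn n → ℝ} {f g : Fin m → Rn n → 𝕜}
    (hf : MemProdLp P ω f) (hg : MemProdLp P ω g) : MemProdLp P ω (f - g) :=
  fun j => (hf j).sub (hg j)

theorem fracTerm_const_eq_prod (hm : 0 < m) (γ θ : ℝ) (r : ℝ) (F : Fin m → Rn n → ℝ≥0∞)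
    (x : Rn n) : fracTerm γ (fun _ => θ) r F x =
      ∏ j, (ENNReal.ofReal r ^ (γ / m) * lpAvg θ r (F j) x) := by
  have hm' : (m : ℝ) ≠ 0 := by exact_mod_cast hm.ne'
  rw [fracTerm, Finset.prod_mul_distrib, Finset.prod_const, Finset.card_univ, Fintype.card_fin,
    ← ENNReal.rpow_natCast, ← ENNReal.rpow_mul, div_mul_cancel₀ _ hm']

/-- Expand the tuple cut off to the doubled ball around the tuple cut off to the ball. The empty σ
gives the subtracted term, and every other σ gives a tuple of exactly the form treated by the size
condition. Since all entries vanish outside the doubled ball, the series over annuli reduces to its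
first term. -/
theorem exists_enorm_sub_le_fracTerm (hn : 0 < n) (hm : 0 < m) {γ θ : ℝ} (hγ : 0 < γ)
    (hγ' : γ < m * n) (hθ : 0 < θ) (he : 0 ≤ 1 - γ * θ / (m * n : ℝ)) {P : Fin m → ℝ}
    {ω : Fin m → Rn n → ℝ} {T : (Fin m → Rn n → 𝕜) → Rn n → 𝕜} (hT : IsMultilinearOp P ω T)
    (hsize : FracSizeCondition γ θ P ω T) :
    ∃ C : ℝ≥0∞, C < ∞ ∧ ∀ f : Fin m → Rn n → 𝕜, MemProdLp P ω f → ∀ (c : Rn n) (ρ : ℝ), 0 < ρ →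
      ∀ᵐ x, x ∈ Metric.ball c (ρ / 2) →
        ‖T (fun j => (Metric.ball c (2 * ρ)).indicator (f j)) x -
          T (fun j => (Metric.ball c ρ).indicator (f j)) x‖ₑ ≤
          C * fracTerm γ (fun _ => θ) (4 * ρ) (fun j z => ‖f j z‖ₑ) x := by
  have hn' : (0 : ℝ) < n := by exact_mod_cast hn
  have hm' : (0 : ℝ) < m := by exact_mod_cast hm
  obtain ⟨C₀, hC₀, h₀⟩ := fracAvg_le (𝕜 := 𝕜) hn hm hγ hθ he
  obtain ⟨C₁, hC₁, h₁⟩ := hsize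
  refine ⟨(2 ^ m : ℕ) * (C₁ * C₀ ^ m), ENNReal.mul_lt_top (by simp) (ENNReal.mul_lt_top hC₁
    (ENNReal.pow_lt_top hC₀)), fun f hf c ρ hρ => ?_⟩
  set g : Fin m → Rn n → 𝕜 := fun j => (Metric.ball c (2 * ρ)).indicator (f j) with hg
  set g₀ : Fin m → Rn n → 𝕜 := fun j => (Metric.ball c ρ).indicator (f j) with hg₀
  have hgm : MemProdLp P ω g := hf.indicator Metric.isOpen_ball.measurableSet
  have hg₀m : MemProdLp P ω g₀ := hf.indicator Metric.isOpen_ball.measurableSet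
  have hsub : Metric.ball c ρ ⊆ Metric.ball c (2 * ρ) := Metric.ball_subset_ball (by linarith)
  have hsplit : ∀ σ : Finset (Fin m),
      σ.piecewise (g - g₀) g₀ = splitTuple σ (Metric.ball c ρ) g := by
    intro σ
    funext j z
    by_cases hj : j ∈ σ <;> by_cases hz : z ∈ Metric.ball c ρ
    · simp [hj, splitTuple, hg, hg₀, hz, hsub hz]
    · simp [hj, splitTuple, hg, hg₀, hz]
    · simp [hj, splitTuple, hg, hg₀, hz, hsub hz]
    · simp [hj, splitTuple, hg, hg₀, hz]
  have hsum := hT.eq_sum_piecewise (hgm.sub hg₀m) hg₀m Finset.univ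
  simp only [Finset.piecewise_univ, sub_add_cancel, hsplit] at hsum
  have hσ : ∀ᵐ x, ∀ σ : Finset (Fin m), σ.Nonempty → x ∈ Metric.ball c (ρ / 2) →
      ‖T (splitTuple σ (Metric.ball c ρ) g) x‖ₑ ≤
        C₁ * C₀ ^ m * fracTerm γ (fun _ => θ) (4 * ρ) (fun j z => ‖f j z‖ₑ) x := by
    rw [ae_all_iff]
    intro σ
    by_cases hne : σ.Nonempty
    swap
    · exact Eventually.of_forall fun x h => absurd h hne
    -- Radius ρ/2, because the size condition splits the functions along the double of the ball on
    -- which it gives the bound.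
    have h := h₁ g hgm σ hne c (ρ / 2) (by positivity)
    rw [ae_restrict_iff' Metric.isOpen_ball.measurableSet] at h
    filter_upwards [h] with x hx _ hxc
    have h2 : 2 * (ρ / 2) = ρ := by ring
    have hx' : x ∈ Metric.ball c ρ := Metric.ball_subset_ball (by linarith) hxc
    have hfg : ∀ j, lpAvg θ (4 * ρ) (fun z => ‖g j z‖ₑ) x ≤
        lpAvg θ (4 * ρ) (fun z => ‖f j z‖ₑ) x := fun j =>
      lpAvg_mono hθ fun z _ => by
        simp only [hg]
        exact enorm_indicator_le_enorm_self _ _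
    have hx := hx hxc
    rw [h2] at hx
    have hin : ∀ j, fracAvg m γ θ (Metric.ball c ρ) (Metric.ball c ρ) (g j) ≤
        C₀ * (ENNReal.ofReal (4 * ρ) ^ (γ / m) * lpAvg θ (4 * ρ) (fun z => ‖f j z‖ₑ) x) := fun j =>
      (h₀ (g j) c ρ ρ _ x hρ le_rfl hsub hx').trans (by gcongr; exact hfg j)
    have hout : ∀ j, ∑' i : ℕ, ((i + 1 : ℕ) : ℝ≥0∞) *
          (2 : ℝ≥0∞) ^ (-(((i + 1 : ℕ) : ℝ) * n * (σᶜ.card * (1 - γ / (m * n : ℝ))))) *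
            fracAvg m γ θ (Metric.ball c (2 ^ (i + 2) * (ρ / 2)))
              (Metric.ball c (2 ^ (i + 2) * (ρ / 2)) \ Metric.ball c (2 ^ (i + 1) * (ρ / 2)))
              (g j) ≤
        C₀ * (ENNReal.ofReal (4 * ρ) ^ (γ / m) * lpAvg θ (4 * ρ) (fun z => ‖f j z‖ₑ) x) := by
      intro j
      -- The index 0 is the annulus between the radii ρ and 2ρ, the only one that meets the
      -- supports.
      rw [tsum_eq_single 0]
      · have h4 : (2 : ℝ) ^ (0 + 2) * (ρ / 2) = 2 * ρ := by ring
        have h5 : (2 : ℝ) ^ (0 + 1) * (ρ / 2) = ρ := by ring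
        rw [h4, h5]
        have h6 : (2 : ℝ≥0∞) ^ (-(((0 + 1 : ℕ) : ℝ) * n * (σᶜ.card * (1 - γ / (m * n : ℝ))))) ≤
            1 := by
          have h7 : 0 ≤ 1 - γ / (m * n : ℝ) := by
            rw [sub_nonneg, div_le_one (by positivity)]; exact hγ'.le
          rw [← ENNReal.rpow_zero (x := 2)]
          exact ENNReal.rpow_le_rpow_of_exponent_le (by norm_num)
            (neg_nonpos.2 (by positivity))
        calc _ ≤ (1 : ℝ≥0∞) * 1 * (C₀ * (ENNReal.ofReal (4 * ρ) ^ (γ / m) *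
              lpAvg θ (4 * ρ) (fun z => ‖g j z‖ₑ) x)) := by
              gcongr
              · simp
              · exact h₀ (g j) c ρ (2 * ρ) _ x hρ (by linarith) Set.sdiff_subset hx'
          _ ≤ _ := by
              rw [one_mul, one_mul]
              gcongr
              exact hfg j
      · intro i hi
        have : fracAvg m γ θ (Metric.ball c (2 ^ (i + 2) * (ρ / 2)))
              (Metric.ball c (2 ^ (i + 2) * (ρ / 2)) \ Metric.ball c (2 ^ (i + 1) * (ρ / 2)))
              (g j) = 0 := by
          have hz : ∫⁻ z in Metric.ball c (2 ^ (i + 2) * (ρ / 2)) \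
              Metric.ball c (2 ^ (i + 1) * (ρ / 2)), ‖g j z‖ₑ ^ θ = 0 := by
            rw [setLIntegral_congr_fun (g := fun _ => 0)
              (Metric.isOpen_ball.measurableSet.diff Metric.isOpen_ball.measurableSet)]
            · simp
            · intro z hz
              have hz' : z ∉ Metric.ball c (2 * ρ) := fun h => hz.2
                (Metric.ball_subset_ball (by
                  have : (2 : ℝ) ^ 2 ≤ 2 ^ (i + 1) :=
                    pow_le_pow_right₀ (by norm_num) (by omega)
                  nlinarith) h)
              simp only [hg, Set.indicator_of_notMem hz', enorm_zero,
                ENNReal.zero_rpow_of_pos hθ]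
          rw [fracAvg, hz, mul_zero, ENNReal.zero_rpow_of_pos (by positivity)]
        rw [this, mul_zero]
    calc _ ≤ _ := hx
      _ ≤ C₁ * (∏ j ∈ σᶜ, (C₀ * (ENNReal.ofReal (4 * ρ) ^ (γ / m) *
            lpAvg θ (4 * ρ) (fun z => ‖f j z‖ₑ) x))) * ∏ j ∈ σ, (C₀ * (ENNReal.ofReal (4 * ρ) ^
              (γ / m) * lpAvg θ (4 * ρ) (fun z => ‖f j z‖ₑ) x)) := by
          refine mul_le_mul' (mul_le_mul_right (Finset.prod_le_prod' fun j _ => hin j) _)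
            (Finset.prod_le_prod' fun j _ => hout j)
      _ = _ := by
          rw [mul_assoc, Finset.prod_compl_mul_prod, Finset.prod_mul_distrib,
            fracTerm_const_eq_prod hm]
          simp [mul_assoc]
  filter_upwards [hsum, hσ] with x hx hx' hxc
  have hempty : splitTuple ∅ (Metric.ball c ρ) g = g₀ := by
    rw [← hsplit]; simp
  rw [hx, Finset.powerset_univ, ← Finset.sum_erase_add _ _ (Finset.mem_univ ∅), hempty,
    add_sub_cancel_right]
  refine (enorm_sum_le _ _).trans ((Finset.sum_le_card_nsmul _ _ _ fun σ hσ =>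
    hx' σ (Finset.nonempty_iff_ne_empty.2 (Finset.ne_of_mem_erase hσ)) hxc).trans ?_)
  rw [nsmul_eq_mul, ← mul_assoc]
  refine mul_le_mul_left (mul_le_mul_left ?_ _) _
  have : (Finset.univ.erase (∅ : Finset (Fin m))).card ≤ 2 ^ m :=
    (Finset.card_erase_le).trans (by simp)
  exact_mod_cast this

end Domination


/-! ### Telescoping over scales, and coverings by small balls -/

section Localization

variable {n m : ℕ} {𝕜 : Type*} [RCLike 𝕜]

/-- The radius is doubled from t 2^K until the ball contains all the supports. Each doubling costs
one fractional term, two dyadic scales up because of the factor 4, so no scale is charged twice. -/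
theorem exists_enorm_le_add_tsum_fracTerm (hn : 0 < n) (hm : 0 < m) {γ θ : ℝ} (hγ : 0 < γ)
    (hγ' : γ < m * n) (hθ : 0 < θ) (he : 0 ≤ 1 - γ * θ / (m * n : ℝ)) {P : Fin m → ℝ}
    {ω : Fin m → Rn n → ℝ} {T : (Fin m → Rn n → 𝕜) → Rn n → 𝕜} (hT : IsMultilinearOp P ω T)
    (hsize : FracSizeCondition γ θ P ω T) :
    ∃ C : ℝ≥0∞, C < ∞ ∧ ∀ f : Fin m → Rn n → 𝕜, MemProdLp P ω f →
      (∃ R : ℝ, ∀ j z, f j z ≠ 0 → ‖z‖ ≤ R) → ∀ t : ℝ, 0 < t → ∀ (c : Rn n) (K : ℤ),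
      ∀ᵐ x, x ∈ Metric.ball c (t * 2 ^ K / 2) →
        ‖T f x‖ₑ ≤ ‖T (fun j => (Metric.ball c (t * 2 ^ K)).indicator (f j)) x‖ₑ +
          C * ∑' K : ℤ, fracTerm γ (fun _ => θ) (t * 2 ^ K) (fun j z => ‖f j z‖ₑ) x := by
  obtain ⟨C, hC, h⟩ := exists_enorm_sub_le_fracTerm hn hm hγ hγ' hθ he hT hsize
  refine ⟨C, hC, fun f hf ⟨R, hR⟩ t ht c K => ?_⟩
  have hpos : ∀ i : ℤ, 0 < t * (2 : ℝ) ^ i := fun i => by positivity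
  have hall : ∀ᵐ x, ∀ i : ℕ, x ∈ Metric.ball c (t * 2 ^ (K + i) / 2) →
        ‖T (fun j => (Metric.ball c (2 * (t * 2 ^ (K + i)))).indicator (f j)) x -
          T (fun j => (Metric.ball c (t * 2 ^ (K + i))).indicator (f j)) x‖ₑ ≤
          C * fracTerm γ (fun _ => θ) (4 * (t * 2 ^ (K + i))) (fun j z => ‖f j z‖ₑ) x :=
    ae_all_iff.2 fun i => h f hf c _ (hpos _)
  filter_upwards [hall] with x hx hxc
  have hind : ∀ M : ℕ, ‖T (fun j => (Metric.ball c (t * 2 ^ (K + M))).indicator (f j)) x‖ₑ ≤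
      ‖T (fun j => (Metric.ball c (t * 2 ^ K)).indicator (f j)) x‖ₑ +
        ∑ i ∈ Finset.range M, C * fracTerm γ (fun _ => θ) (t * 2 ^ (K + i + 2))
          (fun j z => ‖f j z‖ₑ) x := by
    intro M
    induction M with
    | zero => simp
    | succ M ih =>
      have hle : t * (2 : ℝ) ^ K ≤ t * 2 ^ (K + M) := by
        gcongr
        · norm_num
        · simp
      have h1 := hx M (Metric.ball_subset_ball (by linarith) hxc)
      have e1 : 2 * (t * (2 : ℝ) ^ (K + M)) = t * 2 ^ (K + ((M + 1 : ℕ) : ℤ)) := by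
        push_cast
        rw [← add_assoc, zpow_add_one₀ two_ne_zero]; ring
      have e2 : 4 * (t * (2 : ℝ) ^ (K + M)) = t * 2 ^ (K + M + 2) := by
        rw [zpow_add₀ two_ne_zero (K + M)]; norm_num; ring
      rw [e1, e2] at h1
      rw [Finset.sum_range_succ, ← add_assoc]
      refine le_trans ?_ (add_le_add ih h1)
      refine le_trans (le_of_eq ?_) (enorm_add_le _ _)
      congr 1; ring
  obtain ⟨M, hM⟩ : ∃ M : ℕ, R + ‖c‖ < t * 2 ^ (K + M) := by
    obtain ⟨M, hM⟩ := pow_unbounded_of_one_lt ((R + ‖c‖) / (t * 2 ^ K)) one_lt_two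
    refine ⟨M, ?_⟩
    rw [div_lt_iff₀ (hpos K)] at hM
    rw [zpow_add₀ two_ne_zero, zpow_natCast]
    linarith
  have hfM : (fun j => (Metric.ball c (t * 2 ^ (K + M))).indicator (f j)) = f := by
    funext j
    refine Set.indicator_eq_self.2 fun z hz => ?_
    rw [Metric.mem_ball, dist_eq_norm]
    linarith [norm_sub_le z c, hR j z hz]
  have h2 := hind M
  rw [hfM] at h2
  refine h2.trans (add_le_add le_rfl ?_)
  rw [← Finset.mul_sum]
  refine mul_le_mul_right ((ENNReal.sum_le_tsum _).trans ?_) _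
  exact ENNReal.tsum_comp_le_tsum_of_injective (f := fun i : ℕ => K + i + 2)
    (fun a b hab => by simpa using hab)
    (fun i : ℤ => fracTerm γ (fun _ => θ) (t * 2 ^ i) (fun j z => ‖f j z‖ₑ) x)

/-- At every scale there is a lattice of balls that cover the space with bounded overlap. -/
theorem exists_ball_cover (n : ℕ) : ∃ L : ℕ, ∀ r : ℝ, 0 < r → ∃ c : (Fin n → ℤ) → Rn n,
    (∀ x, ∃ z, x ∈ Metric.ball (c z) (r / 2)) ∧
      ∀ x, ∑' z, (Metric.ball (c z) r).indicator (1 : Rn n → ℝ≥0∞) x ≤ L := by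
  refine ⟨(4 * n + 6) ^ n, fun r hr => ?_⟩
  -- The mesh of the lattice: a cell has diameter at most √n h < (n+1)h = r/2, and a coordinate of a
  -- lattice point within distance r of x can take at most 4n + 6 values.
  set h : ℝ := r / (2 * (n + 1)) with hh
  have hh0 : 0 < h := by positivity
  refine ⟨fun z => WithLp.toLp 2 fun i => h * z i, fun x => ⟨fun i => ⌊x i / h⌋, ?_⟩, fun x => ?_⟩
  · rw [Metric.mem_ball, dist_eq_norm]
    refine lt_of_pow_lt_pow_left₀ 2 (by positivity) ?_
    rw [EuclideanSpace.norm_sq_eq]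
    have hi : ∀ i, ‖(x - WithLp.toLp 2 fun i => h * (⌊x i / h⌋ : ℝ)) i‖ ^ 2 ≤ h ^ 2 := by
      intro i
      have h1 := Int.floor_le (x i / h)
      have h2 := Int.lt_floor_add_one (x i / h)
      rw [le_div_iff₀ hh0] at h1
      rw [div_lt_iff₀ hh0] at h2
      simp only [PiLp.sub_apply, Real.norm_eq_abs, sq_abs]
      refine sq_le_sq' ?_ ?_ <;> nlinarith
    calc _ ≤ ∑ _i : Fin n, h ^ 2 := Finset.sum_le_sum fun i _ => hi i
      _ = n * h ^ 2 := by simp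
      _ < (r / 2) ^ 2 := by
        have : r / 2 = (n + 1) * h := by rw [hh]; field_simp
        rw [this, mul_pow]
        have : (n : ℝ) < (n + 1) ^ 2 := by nlinarith [(Nat.cast_nonneg n : (0 : ℝ) ≤ n)]
        gcongr
  · set s : Finset (Fin n → ℤ) := Fintype.piFinset fun i =>
      Finset.Ico (⌊x i / h⌋ - (2 * n + 2)) (⌊x i / h⌋ + (2 * n + 4)) with hs
    have hmem : ∀ z : Fin n → ℤ, x ∈ Metric.ball (WithLp.toLp 2 fun i => h * (z i : ℝ)) r →
        z ∈ s := by
      intro z hz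
      rw [Metric.mem_ball, dist_eq_norm] at hz
      rw [hs, Fintype.mem_piFinset]
      intro i
      have h1 := (PiLp.norm_apply_le (x - WithLp.toLp 2 fun i => h * (z i : ℝ)) i).trans_lt hz
      simp only [PiLp.sub_apply, Real.norm_eq_abs, abs_lt] at h1
      have hr' : r = (2 * n + 2) * h := by rw [hh]; field_simp
      have h2 := Int.floor_le (x i / h)
      have h3 := Int.lt_floor_add_one (x i / h)
      rw [le_div_iff₀ hh0] at h2
      rw [div_lt_iff₀ hh0] at h3
      rw [Finset.mem_Ico]
      constructor
      · have : ((⌊x i / h⌋ - (2 * n + 2) : ℤ) : ℝ) < z i + 1 := by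
          push_cast
          refine lt_of_mul_lt_mul_right ?_ hh0.le
          nlinarith [h1.2]
        have : (⌊x i / h⌋ - (2 * n + 2) : ℤ) < z i + 1 := by exact_mod_cast this
        omega
      · have : (z i : ℝ) < ((⌊x i / h⌋ + (2 * n + 4) : ℤ) : ℝ) := by
          push_cast
          refine lt_of_mul_lt_mul_right ?_ hh0.le
          nlinarith [h1.1]
        exact_mod_cast this
    rw [tsum_eq_sum (s := s) fun z hz => Set.indicator_of_notMem (fun h => hz (hmem z h)) _]
    refine (Finset.sum_le_card_nsmul _ _ 1 fun z _ => Set.indicator_le_self' (by simp) x).trans ?_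
    have hcard : s.card = (4 * n + 6) ^ n := by
      rw [hs, Fintype.card_piFinset]
      have : ∀ i : Fin n, (Finset.Ico (⌊x i / h⌋ - (2 * n + 2) : ℤ)
          (⌊x i / h⌋ + (2 * n + 4))).card = 4 * n + 6 := by
        intro i; rw [Int.card_Ico]; omega
      simp [this]
    rw [hcard]; simp

/-- Sums of powers of the masses of small balls with bounded overlap are small. -/
theorem exists_tsum_measure_ball_rpow_le (hn : 0 < n) {κ : Measure (Rn n)} [IsFiniteMeasure κ]
    (hκ : κ ≪ volume) {a : ℝ} (ha : 1 < a) (L : ℕ) {ε : ℝ≥0∞} (hε : ε ≠ 0) :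
    ∃ δ : ℝ, 0 < δ ∧ ∀ r : ℝ, r ≤ δ → ∀ c : (Fin n → ℤ) → Rn n,
      (∀ x, ∑' z, (Metric.ball (c z) r).indicator (1 : Rn n → ℝ≥0∞) x ≤ L) →
      ∑' z, κ (Metric.ball (c z) r) ^ a ≤ ε := by
  have ha' : 0 < a - 1 := by linarith
  set D : ℝ≥0∞ := L * κ Set.univ + 1 with hD
  have hDt : D ≠ ∞ := ENNReal.add_ne_top.2 ⟨ENNReal.mul_ne_top (by simp) (measure_ne_top _ _),
    ENNReal.one_ne_top⟩
  have hD0 : D ≠ 0 := by simp [hD]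
  -- Chosen so that ε'^{a-1} D = ε. Absolute continuity of κ makes every ball of small radius have
  -- mass at most ε'; one factor of the mass is kept for the overlap bound, and the remaining a - 1
  -- supply the smallness.
  set ε' : ℝ≥0∞ := (ε / D) ^ (1 / (a - 1)) with hε'
  have hε'0 : ε' ≠ 0 := by
    rw [hε', Ne, ENNReal.rpow_eq_zero_iff_of_pos (by positivity)]
    exact (ENNReal.div_pos hε hDt).ne'
  have hd : volume.withDensity (κ.rnDeriv volume) = κ := Measure.withDensity_rnDeriv_eq κ volume hκ
  obtain ⟨η, hη, hηs⟩ := exists_pos_setLIntegral_lt_of_measure_lt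
    (μ := (volume : Measure (Rn n))) (f := κ.rnDeriv volume)
    (Measure.lintegral_rnDeriv_lt_top κ volume).ne hε'0
  obtain ⟨δ, hδ, hδη⟩ : ∃ δ : ℝ, 0 < δ ∧ volume (Metric.ball (0 : Rn n) δ) < η := by
    have hlim : Tendsto (fun δ : ℝ => ENNReal.ofReal (δ ^ n) * volume (Metric.ball (0 : Rn n) 1))
        (𝓝[>] 0) (𝓝 0) := by
      have h1 : Tendsto (fun δ : ℝ => ENNReal.ofReal (δ ^ n)) (𝓝[>] 0) (𝓝 0) := by
        have h2 : Continuous fun δ : ℝ => ENNReal.ofReal (δ ^ n) :=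
          ENNReal.continuous_ofReal.comp (continuous_pow n)
        have := h2.tendsto 0
        simp only [zero_pow hn.ne', ENNReal.ofReal_zero] at this
        exact this.mono_left nhdsWithin_le_nhds
      simpa using ENNReal.Tendsto.mul_const h1 (Or.inr (volume_ball_ne_top (0 : Rn n) 1))
    obtain ⟨δ, h1, h2⟩ := ((hlim.eventually (gt_mem_nhds hη)).and self_mem_nhdsWithin).exists
    exact ⟨δ, h2, by rwa [volume_ball_eq 0 h2]⟩
  refine ⟨δ, hδ, fun r hr c hc => ?_⟩
  have hsmall : ∀ z, κ (Metric.ball (c z) r) ≤ ε' := by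
    intro z
    rw [← hd, withDensity_apply _ Metric.isOpen_ball.measurableSet]
    refine (hηs _ (lt_of_le_of_lt (measure_mono (Metric.ball_subset_ball hr)) ?_)).le
    rwa [Measure.addHaar_ball_center]
  calc ∑' z, κ (Metric.ball (c z) r) ^ a
      ≤ ∑' z, ε' ^ (a - 1) * κ (Metric.ball (c z) r) := by
        refine ENNReal.tsum_le_tsum fun z => ?_
        calc κ (Metric.ball (c z) r) ^ a
            = κ (Metric.ball (c z) r) ^ (a - 1) * κ (Metric.ball (c z) r) ^ (1 : ℝ) := by
              rw [← ENNReal.rpow_add_of_nonneg _ _ ha'.le zero_le_one, sub_add_cancel]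
          _ ≤ _ := by
              rw [ENNReal.rpow_one]
              gcongr
              exact hsmall z
    _ = ε / D * ∑' z, κ (Metric.ball (c z) r) := by
        rw [ENNReal.tsum_mul_left, hε', ← ENNReal.rpow_mul, one_div_mul_cancel ha'.ne',
          ENNReal.rpow_one]
    _ ≤ ε / D * D := by
        gcongr
        calc ∑' z, κ (Metric.ball (c z) r)
            = ∑' z, ∫⁻ x, (Metric.ball (c z) r).indicator 1 x ∂κ := by
              congr with z
              rw [lintegral_indicator_one Metric.isOpen_ball.measurableSet]
          _ = ∫⁻ x, ∑' z, (Metric.ball (c z) r).indicator 1 x ∂κ := by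
              rw [lintegral_tsum fun z =>
                (measurable_one.indicator Metric.isOpen_ball.measurableSet).aemeasurable]
          _ ≤ ∫⁻ _, L ∂κ := lintegral_mono hc
          _ ≤ D := by
              rw [lintegral_const]
              exact le_self_add
    _ = ε := ENNReal.div_mul_cancel hD0 hDt

end Localization


/-! ### Vanishing of the diagonal part -/

section Diagonal

variable {n m : ℕ} {𝕜 : Type*} [RCLike 𝕜]

theorem prod_rpow_of_nonneg {ι : Type*} (s : Finset ι) (x : ℝ≥0∞) {a : ι → ℝ}
    (ha : ∀ i ∈ s, 0 ≤ a i) : ∏ i ∈ s, x ^ a i = x ^ ∑ i ∈ s, a i := by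
  classical
  induction s using Finset.induction_on with
  | empty => simp
  | insert i s hi ih =>
    rw [Finset.prod_insert hi, Finset.sum_insert hi,
      ih fun j hj => ha j (Finset.mem_insert_of_mem hj),
      ENNReal.rpow_add_of_nonneg _ _ (ha i (Finset.mem_insert_self i s))
        (Finset.sum_nonneg fun j hj => ha j (Finset.mem_insert_of_mem hj))]

theorem eLpNorm_ofReal_eq {α : Type*} [MeasurableSpace α] {μ : Measure α} {P : ℝ} (hP : 0 < P)
    (f : α → 𝕜) : eLpNorm f (ENNReal.ofReal P) μ = (∫⁻ x, ‖f x‖ₑ ^ P ∂μ) ^ (1 / P) := by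
  rw [eLpNorm_eq_lintegral_rpow_enorm_toReal (by simpa using hP) ENNReal.ofReal_ne_top,
    ENNReal.toReal_ofReal hP.le]

/-- The multilinear bound on a measurable set, in terms of the mass of one finite measure. -/
theorem BoundedOnLp.exists_measure {P : Fin m → ℝ} {q p : ℝ} (hP : ∀ j, 0 < P j) (hq : 0 < q)
    (hp : 1 / p = ∑ j, 1 / P j)
    {ω : Fin m → Rn n → ℝ} {T : (Fin m → Rn n → 𝕜) → Rn n → 𝕜} (hT : BoundedOnLp P q ω T) :
    ∃ C : ℝ≥0∞, C < ∞ ∧ ∀ f : Fin m → Rn n → 𝕜, MemProdLp P ω f →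
      ∃ κ : Measure (Rn n), IsFiniteMeasure κ ∧ κ ≪ volume ∧ ∀ B : Set (Rn n), MeasurableSet B →
        ∫⁻ x, ‖T (fun j => B.indicator (f j)) x‖ₑ ^ q
          ∂(weightMeasure fun x => prodWeight ω x ^ q) ≤ C * κ B ^ (q / p) := by
  obtain ⟨C, hC, h⟩ := hT
  refine ⟨C ^ q, ENNReal.rpow_lt_top_of_nonneg hq.le hC.ne, fun f hf => ?_⟩
  set μ : Fin m → Measure (Rn n) := fun j => weightMeasure fun x => ω j x ^ P j with hμ
  set κj : Fin m → Measure (Rn n) := fun j => (μ j).withDensity fun x => ‖f j x‖ₑ ^ P j with hκj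
  have hfin : ∀ j, κj j Set.univ < ∞ := by
    intro j
    have h1 := (hf j).2
    rw [eLpNorm_ofReal_eq (hP j), ENNReal.rpow_lt_top_iff_of_pos (one_div_pos.2 (hP j))] at h1
    rwa [hκj, withDensity_apply _ MeasurableSet.univ, Measure.restrict_univ]
  -- Bounding each κ_j(B) by the total mass on B lets the exponents 1/P_j add up to 1/p for a single
  -- measure.
  refine ⟨∑ j, κj j, ⟨?_⟩, ?_, fun B hB => ?_⟩
  · rw [Measure.finsetSum_apply]
    exact ENNReal.sum_lt_top.2 fun j _ => hfin j
  · intro s hs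
    rw [Measure.finsetSum_apply]
    exact Finset.sum_eq_zero fun j _ => ((withDensity_absolutelyContinuous _ _).trans
      (weightMeasure_absolutelyContinuous _)) hs
  · have h1 := (h _ (hf.indicator hB)).2
    have h2 : ∀ j, eLpNorm (B.indicator (f j)) (ENNReal.ofReal (P j)) (μ j) ≤
        (∑ j, κj j) B ^ (1 / P j) := by
      intro j
      rw [eLpNorm_indicator_eq_eLpNorm_restrict hB, eLpNorm_ofReal_eq (hP j),
        ← withDensity_apply _ hB, Measure.finsetSum_apply]
      exact ENNReal.rpow_le_rpow (Finset.single_le_sum (f := fun j => κj j B)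
        (fun _ _ => zero_le) (Finset.mem_univ j)) (one_div_pos.2 (hP j)).le
    rw [eLpNorm_ofReal_eq hq] at h1
    have h3 := h1.trans (mul_le_mul_right (Finset.prod_le_prod' fun j _ => h2 j) C)
    have h4 : ∏ j, (∑ j, κj j) B ^ (1 / P j) = (∑ j, κj j) B ^ (1 / p) := by
      rw [hp]
      exact prod_rpow_of_nonneg _ _ fun j _ => (one_div_pos.2 (hP j)).le
    rw [h4] at h3
    have h5 := ENNReal.rpow_le_rpow h3 hq.le
    rwa [← ENNReal.rpow_mul, one_div_mul_cancel hq.ne', ENNReal.rpow_one,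
      ENNReal.mul_rpow_of_nonneg _ _ hq.le, ← ENNReal.rpow_mul, one_div_mul_eq_div] at h5

/-- The localised term T(f χ_B) in the telescoping bound is removed by letting the balls shrink.
Summed over a covering, its q-th powers have integral at most C Σ κ(B)^{q/p}, which tends to 0
because q > p. The weight enters only through null sets, so the resulting domination contains none.
-/
theorem exists_enorm_le_tsum_fracTerm (hn : 0 < n) (hm : 0 < m) {γ θ : ℝ} (hγ : 0 < γ)
    (hγ' : γ < m * n) (hθ : 0 < θ) (he : 0 ≤ 1 - γ * θ / (m * n : ℝ)) {P : Fin m → ℝ}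
    {p q : ℝ} (hP : ∀ j, 0 < P j) (hp0 : 0 < p) (hpq : p < q) (hp : 1 / p = ∑ j, 1 / P j)
    {ω : Fin m → Rn n → ℝ} (hω : volume ≪ weightMeasure fun x => prodWeight ω x ^ q)
    {T : (Fin m → Rn n → 𝕜) → Rn n → 𝕜} (hT : IsMultilinearOp P ω T)
    (hsize : FracSizeCondition γ θ P ω T) (hbdd : BoundedOnLp P q ω T) :
    ∃ C : ℝ≥0∞, C < ∞ ∧ ∀ f : Fin m → Rn n → 𝕜, MemProdLp P ω f →
      (∃ R : ℝ, ∀ j z, f j z ≠ 0 → ‖z‖ ≤ R) → ∀ t : ℝ, 0 < t →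
      ∀ᵐ x, ‖T f x‖ₑ ≤
        C * ∑' K : ℤ, fracTerm γ (fun _ => θ) (t * 2 ^ K) (fun j z => ‖f j z‖ₑ) x := by
  have hq : 0 < q := hp0.trans hpq
  obtain ⟨C, hC, h⟩ := exists_enorm_le_add_tsum_fracTerm hn hm hγ hγ' hθ he hT hsize
  obtain ⟨C₁, hC₁, h₁⟩ := hbdd.exists_measure hP hq hp
  refine ⟨C, hC, fun f hf hR t ht => ?_⟩
  set μ := weightMeasure fun x => prodWeight ω x ^ q with hμ
  obtain ⟨κ, hκ, hκv, hκT⟩ := h₁ f hf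
  obtain ⟨L, hL⟩ := exists_ball_cover n
  have hscale : ∀ N : ℕ, ∃ K : ℤ, ∃ c : (Fin n → ℤ) → Rn n,
      (∀ x, ∃ z, x ∈ Metric.ball (c z) (t * 2 ^ K / 2)) ∧
      ∑' z, κ (Metric.ball (c z) (t * 2 ^ K)) ^ (q / p) ≤ ((N : ℝ≥0∞) + 1)⁻¹ := by
    intro N
    obtain ⟨δ, hδ, hδs⟩ := exists_tsum_measure_ball_rpow_le hn hκv
      (a := q / p) ((one_lt_div hp0).2 hpq) L (ε := ((N : ℝ≥0∞) + 1)⁻¹) (by simp)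
    obtain ⟨k, hk⟩ := exists_pow_lt_of_lt_one (div_pos hδ ht) (by norm_num : (2⁻¹ : ℝ) < 1)
    have hk' : t * (2 : ℝ) ^ (-(k : ℤ)) ≤ δ := by
      rw [zpow_neg, zpow_natCast, ← inv_pow, mul_comm]
      exact ((lt_div_iff₀ ht).1 hk).le
    obtain ⟨c, hc, hcL⟩ := hL (t * 2 ^ (-(k : ℤ))) (by positivity)
    exact ⟨-k, c, hc, hδs _ hk' c hcL⟩
  choose K c hc hcs using hscale
  set g : ∀ N : ℕ, (Fin n → ℤ) → Rn n → 𝕜 := fun N z =>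
    T fun j => (Metric.ball (c N z) (t * 2 ^ K N)).indicator (f j) with hg
  set D : ℕ → Rn n → ℝ≥0∞ := fun N x => ∑' z, ‖g N z x‖ₑ ^ q with hD
  have hgm : ∀ N z, AEMeasurable (fun x => ‖g N z x‖ₑ ^ q) μ := by
    intro N z
    obtain ⟨_, _, hb⟩ := hbdd
    exact ((hb _ (hf.indicator Metric.isOpen_ball.measurableSet)).1.1.enorm).pow_const q
  have hDm : ∀ N, AEMeasurable (D N) μ := fun N => AEMeasurable.tsum fun z => hgm N z
  have hDint : ∀ N : ℕ, ∫⁻ x, D N x ∂μ ≤ C₁ * ((N : ℝ≥0∞) + 1)⁻¹ := by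
    intro N
    simp only [hD]
    rw [lintegral_tsum fun z => hgm N z]
    calc _ ≤ ∑' z, C₁ * κ (Metric.ball (c N z) (t * 2 ^ K N)) ^ (q / p) :=
          ENNReal.tsum_le_tsum fun z => hκT _ Metric.isOpen_ball.measurableSet
      _ ≤ _ := by
          rw [ENNReal.tsum_mul_left]
          gcongr
          exact hcs N
  -- The bound must hold for every N, so it suffices that the infimum of the errors vanishes;
  -- convergence almost everywhere along a subsequence is not required.
  have hinf : ∫⁻ x, ⨅ N, D N x ∂μ = 0 := by
    have hlim : Tendsto (fun N : ℕ => C₁ * ((N : ℝ≥0∞) + 1)⁻¹) atTop (𝓝 0) := by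
      have h1 : Tendsto (fun N : ℕ => ((N : ℝ≥0∞) + 1)⁻¹) atTop (𝓝 0) := by
        have := (tendsto_add_atTop_iff_nat 1).2 ENNReal.tendsto_inv_nat_nhds_zero
        simpa using this
      simpa using ENNReal.Tendsto.const_mul h1 (Or.inr hC₁.ne)
    refine le_antisymm (ge_of_tendsto' hlim fun N => ?_) zero_le
    exact (lintegral_mono fun x => iInf_le _ N).trans (hDint N)
  have hzero : ∀ᵐ x, ⨅ N, D N x = 0 :=
    hω.ae_le ((lintegral_eq_zero_iff' (AEMeasurable.iInf hDm)).1 hinf)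
  have hall : ∀ᵐ x, ∀ N z, x ∈ Metric.ball (c N z) (t * 2 ^ K N / 2) →
      ‖T f x‖ₑ ≤ ‖g N z x‖ₑ +
        C * ∑' K : ℤ, fracTerm γ (fun _ => θ) (t * 2 ^ K) (fun j z => ‖f j z‖ₑ) x := by
    rw [ae_all_iff]; intro N
    rw [ae_all_iff]; intro z
    exact h f hf hR t ht (c N z) (K N)
  filter_upwards [hzero, hall] with x hx0 hx
  set S := C * ∑' K : ℤ, fracTerm γ (fun _ => θ) (t * 2 ^ K) (fun j z => ‖f j z‖ₑ) x
  -- The point x lies in a half-size ball of every covering, and the excess of |T f(x)| over S is at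
  -- most the localised term of that ball.
  have hle : (‖T f x‖ₑ - S) ^ q ≤ ⨅ N, D N x := by
    refine le_iInf fun N => ?_
    obtain ⟨z, hz⟩ := hc N x
    calc (‖T f x‖ₑ - S) ^ q ≤ ‖g N z x‖ₑ ^ q :=
          ENNReal.rpow_le_rpow (tsub_le_iff_right.2 (hx N z hz)) hq.le
      _ ≤ _ := ENNReal.le_tsum (f := fun z => ‖g N z x‖ₑ ^ q) z
  rw [hx0, nonpos_iff_eq_zero, ENNReal.rpow_eq_zero_iff_of_pos hq, tsub_eq_zero_iff_le] at hle
  exact hle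

end Diagonal


/-! ### Commutators -/

section Commutators

variable {n m : ℕ} {𝕜 : Type*} [RCLike 𝕜]

/-- Multiply the entries of a tuple with index in `s` by the `b_j`. -/
def partialMul (b : Fin m → Rn n → 𝕜) (s : Finset (Fin m)) (f : Fin m → Rn n → 𝕜) :
    Fin m → Rn n → 𝕜 := s.piecewise (fun j z => b j z * f j z) f

/-- The commutator in the entries `J`, with the values `b_j x` replaced by scalars `a_j`. -/
def commPoly (b : Fin m → Rn n → 𝕜) (T : (Fin m → Rn n → 𝕜) → Rn n → 𝕜) (J : Finset (Fin m))
    (f : Fin m → Rn n → 𝕜) (a : Fin m → 𝕜) (x : Rn n) : 𝕜 :=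
  ∑ s ∈ J.powerset, (-1) ^ s.card * (∏ i ∈ J \ s, a i) * T (partialMul b s f) x

/-- The iterated commutator in the entries `J`. -/
def commOn (b : Fin m → Rn n → 𝕜) (T : (Fin m → Rn n → 𝕜) → Rn n → 𝕜) (J : Finset (Fin m))
    (f : Fin m → Rn n → 𝕜) (x : Rn n) : 𝕜 := commPoly b T J f (fun j => b j x) x

theorem commPoly_empty (b : Fin m → Rn n → 𝕜) (T : (Fin m → Rn n → 𝕜) → Rn n → 𝕜)
    (f : Fin m → Rn n → 𝕜) (a : Fin m → 𝕜) (x : Rn n) : commPoly b T ∅ f a x = T f x := by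
  simp [commPoly, partialMul]

/-- Subsets of `insert j J` are sorted by whether they contain j. This recursion is the one
satisfied by nested commutators, and it identifies them with `commOn`. -/
theorem commPoly_insert (b : Fin m → Rn n → 𝕜) (T : (Fin m → Rn n → 𝕜) → Rn n → 𝕜)
    {J : Finset (Fin m)} {j : Fin m} (hj : j ∉ J) (f : Fin m → Rn n → 𝕜) (a : Fin m → 𝕜)
    (x : Rn n) : commPoly b T (insert j J) f a x = a j * commPoly b T J f a x -
      commPoly b T J (Function.update f j fun z => b j z * f j z) a x := by
  unfold commPoly
  rw [Finset.sum_powerset_insert hj, sub_eq_add_neg, Finset.mul_sum, ← Finset.sum_neg_distrib]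
  refine congrArg₂ _ (Finset.sum_congr rfl fun s hs => ?_) (Finset.sum_congr rfl fun s hs => ?_)
  all_goals
    have hsJ := Finset.mem_powerset.1 hs
    have hjs : j ∉ s := fun h => hj (hsJ h)
  · rw [Finset.insert_sdiff_of_notMem _ hjs, Finset.prod_insert (by simp [hj])]
    ring
  · have h1 : insert j J \ insert j s = J \ s := by
      ext i
      simp only [Finset.mem_sdiff, Finset.mem_insert]
      constructor
      · rintro ⟨h | h, h'⟩
        · exact absurd (Or.inl h) h'
        · exact ⟨h, fun h2 => h' (Or.inr h2)⟩
      · rintro ⟨h, h'⟩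
        exact ⟨Or.inr h, fun h2 => h2.elim (fun h3 => hj (h3 ▸ h)) h'⟩
    have h2 : partialMul b (insert j s) f =
        partialMul b s (Function.update f j fun z => b j z * f j z) := by
      funext i
      unfold partialMul
      by_cases hij : i = j
      · subst hij
        simp [hjs]
      · by_cases his : i ∈ s <;> simp [his, hij]
    rw [h1, h2, Finset.card_insert_of_notMem hjs, pow_succ]
    ring

theorem commAt_eq_commOn (b : Fin m → Rn n → 𝕜) (T : (Fin m → Rn n → 𝕜) → Rn n → 𝕜) (j : Fin m) :
    commAt j (b j) T = commOn b T {j} := by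
  funext f x
  rw [commOn, ← insert_empty_eq, commPoly_insert _ _ (Finset.notMem_empty j), commPoly_empty,
    commPoly_empty, commAt]

theorem iterComm_eq_commOn (b : Fin m → Rn n → 𝕜) (T : (Fin m → Rn n → 𝕜) → Rn n → 𝕜) :
    iterComm b T = commOn b T Finset.univ := by
  have h : ∀ l : List (Fin m), l.Nodup → l.foldr (fun j S => commAt j (b j) S) T =
      commOn b T l.toFinset := by
    intro l hl
    induction l with
    | nil =>
      funext f x
      rw [List.foldr_nil, commOn, List.toFinset_nil, commPoly_empty]
    | cons j l ih =>
      funext f x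
      rw [List.nodup_cons] at hl
      rw [List.foldr_cons, ih hl.2, List.toFinset_cons, commOn,
        commPoly_insert _ _ (by simpa using hl.1)]
      rfl
  rw [iterComm, h _ (List.nodup_finRange m), List.toFinset_finRange]

/-- Products of the `b_j` with bounded functions of bounded support are admissible. -/
def AdmissibleMul (P : Fin m → ℝ) (ω : Fin m → Rn n → ℝ) (b : Fin m → Rn n → 𝕜) : Prop :=
  ∀ j, ∀ f ∈ boundedFun n 𝕜, f ∈ weightedLp 𝕜 (P j) (ω j) ∧
    (fun z => b j z * f z) ∈ weightedLp 𝕜 (P j) (ω j)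

theorem AdmissibleMul.memProdLp_partialMul {P : Fin m → ℝ} {ω : Fin m → Rn n → ℝ}
    {b : Fin m → Rn n → 𝕜} (hb : AdmissibleMul P ω b) {f : Fin m → Rn n → 𝕜}
    (hf : ∀ j, f j ∈ boundedFun n 𝕜) (s : Finset (Fin m)) : MemProdLp P ω (partialMul b s f) :=
  memProdLp_piecewise (fun j => (hb j _ (hf j)).2) (fun j => (hb j _ (hf j)).1) s

/-- Multilinear expansion of the entries a_j f_j - b_j f_j. The a_j have to be scalars, since b_j(x)
cannot be pulled through T; moreover the exceptional null set depends on a. -/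
theorem IsMultilinearOp.commPoly_eq {P : Fin m → ℝ} {ω : Fin m → Rn n → ℝ}
    {T : (Fin m → Rn n → 𝕜) → Rn n → 𝕜} (hT : IsMultilinearOp P ω T) {b : Fin m → Rn n → 𝕜}
    (hb : AdmissibleMul P ω b) {f : Fin m → Rn n → 𝕜} (hf : ∀ j, f j ∈ boundedFun n 𝕜)
    (J : Finset (Fin m)) (a : Fin m → 𝕜) :
    T (J.piecewise (fun j z => (a j - b j z) * f j z) f) =ᵐ[volume] commPoly b T J f a := by
  set u : Fin m → Rn n → 𝕜 := fun j => (-1 : 𝕜) • fun z => b j z * f j z with hu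
  set v : Fin m → Rn n → 𝕜 := J.piecewise (fun j => a j • f j) f with hv
  have hum : MemProdLp P ω u := fun j => (hb j _ (hf j)).2.const_smul _
  have hvm : MemProdLp P ω v :=
    memProdLp_piecewise (fun j => (hb j _ (hf j)).1.const_smul _) (fun j => (hb j _ (hf j)).1) J
  have h1 := hT.eq_sum_piecewise hum hvm J
  have h2 : J.piecewise (u + v) v = J.piecewise (fun j z => (a j - b j z) * f j z) f := by
    funext j z
    by_cases hj : j ∈ J
    · simp only [hj, Finset.piecewise_eq_of_mem, Pi.add_apply, hu, hv, Pi.smul_apply, smul_eq_mul]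
      ring
    · simp [hj, hv]
  rw [h2] at h1
  have h3 : ∀ᵐ x, ∀ s ∈ J.powerset, T (s.piecewise u v) x =
      (-1) ^ s.card * (∏ i ∈ J \ s, a i) * T (partialMul b s f) x := by
    rw [ae_all_iff]
    intro s
    by_cases hs : s ∈ J.powerset
    swap
    · exact Eventually.of_forall fun x h => absurd h hs
    have hh := hb.memProdLp_partialMul hf s
    have h4 := hT.piecewise_smul hh (fun _ => -1) s
    set h' := s.piecewise (fun j => (-1 : 𝕜) • partialMul b s f j) (partialMul b s f) with hh'
    have hm' : MemProdLp P ω h' := memProdLp_piecewise (fun j => (hh j).const_smul _) hh s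
    have h5 := hT.piecewise_smul hm' a (J \ s)
    have h6 : (J \ s).piecewise (fun j => a j • h' j) h' = s.piecewise u v := by
      funext j
      by_cases hjs : j ∈ s
      · simp [hjs, hh', partialMul, hu]
      · by_cases hj : j ∈ J <;> simp [hjs, hj, hh', partialMul, hv]
    rw [h6] at h5
    filter_upwards [h4, h5] with x hx4 hx5 _
    rw [hx5, Pi.smul_apply, hx4, Pi.smul_apply, Finset.prod_const, smul_eq_mul, smul_eq_mul]
    ring
  filter_upwards [h1, h3] with x hx1 hx3
  rw [hx1, commPoly]
  exact Finset.sum_congr rfl hx3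

/-- Hölder's inequality with τ/θ and its conjugate leaves a moment of a - b of order u over the
ball. With β from the moment bound, |a - β| ≤ |a - b(x)| + |b(x) - β|, and the last term is
estimated by averaging over the ball. The 1 inside `oscAvg` absorbs the additive constants. -/
theorem lpAvg_mul_sub_le {θ τ : ℝ} (hθ : 1 ≤ θ) (hτ : θ < τ) {b : Rn n → 𝕜}
    (hbm : AEStronglyMeasurable b volume) (hb : HasOscMoments b) :
    ∃ C : ℝ≥0∞, C < ∞ ∧ 1 ≤ C ∧ ∀ (a : 𝕜) (F : Rn n → ℝ≥0∞), AEMeasurable F volume →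
      ∀ (r : ℝ) (x : Rn n), 0 < r → lpAvg θ r (fun z => ‖a - b z‖ₑ * F z) x ≤
        C * (‖a - b x‖ₑ + oscAvg r b x) * lpAvg τ r F x := by
  have hθ0 : 0 < θ := by linarith
  have hτθ : 1 < τ / θ := (one_lt_div hθ0).2 hτ
  have hconj := Real.HolderConjugate.conjExponent hτθ
  set p' := (τ / θ).conjExponent
  have hp' : 1 < p' := hconj.symm.lt
  set u := θ * p' with hu
  have hu1 : 1 ≤ u := by nlinarith
  have hu0 : 0 < u := by linarith
  obtain ⟨C, hC, h⟩ := hb u hu0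
  set A := C ^ (1 / u) with hA
  have hAt : A < ∞ := ENNReal.rpow_lt_top_of_nonneg (by positivity) hC.ne
  have h21 : (1 : ℝ≥0∞) ≤ 2 ^ (1 / u) := ENNReal.one_le_rpow (by norm_num) (by positivity)
  refine ⟨2 * 2 ^ (1 / u) * (1 + 2 * A), ENNReal.mul_lt_top (ENNReal.mul_lt_top (by simp)
    (ENNReal.rpow_lt_top_of_nonneg (by positivity) (by simp))) (ENNReal.add_lt_top.2
      ⟨by simp, ENNReal.mul_lt_top (by simp) hAt⟩), ?_, fun a F hF r x hr => ?_⟩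
  · calc (1 : ℝ≥0∞) = 1 * 1 * 1 := by norm_num
      _ ≤ _ := by
        gcongr
        · norm_num
        · exact le_self_add
  obtain ⟨β, hβ⟩ := h x r hr
  have hdist : ∀ c : 𝕜, AEMeasurable (fun z => ‖b z - c‖ₑ) volume := fun c =>
    (hbm.sub aestronglyMeasurable_const).enorm
  have hdist' : ∀ c : 𝕜, AEMeasurable (fun z => ‖c - b z‖ₑ) volume := fun c =>
    (aestronglyMeasurable_const.sub hbm).enorm
  have h1 : ‖b x - β‖ₑ ≤ oscAvg r b x + A := by
    calc ‖b x - β‖ₑ = ballAvg r (fun _ => ‖b x - β‖ₑ) x := (ballAvg_const hr _ x).symm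
      _ ≤ ballAvg r (fun z => ‖b x - b z‖ₑ + ‖b z - β‖ₑ) x :=
          ballAvg_mono fun z _ => enorm_sub_le_enorm_sub_add _ _ _
      _ = ballAvg r (fun z => ‖b x - b z‖ₑ) x + ballAvg r (fun z => ‖b z - β‖ₑ) x :=
          ballAvg_add (hdist' _) _ _
      _ ≤ _ := add_le_add le_add_self ((ballAvg_le_rpow hr hu1 (hdist β) x).trans
          (ENNReal.rpow_le_rpow hβ (by positivity)))
  have h2 : ‖a - β‖ₑ ≤ ‖a - b x‖ₑ + (oscAvg r b x + A) :=
    (enorm_sub_le_enorm_sub_add _ (b x) _).trans (add_le_add le_rfl h1)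
  have h3 : ballAvg r (fun z => ‖a - b z‖ₑ ^ u) x ≤ 2 ^ u * (‖a - β‖ₑ ^ u + C) := by
    calc ballAvg r (fun z => ‖a - b z‖ₑ ^ u) x
        ≤ ballAvg r (fun z => 2 ^ u * (‖a - β‖ₑ ^ u + ‖b z - β‖ₑ ^ u)) x := by
          refine ballAvg_mono fun z _ => le_trans ?_ (add_rpow_le_two_rpow_mul _ _ hu0.le)
          gcongr
          rw [enorm_sub_rev (b z)]
          exact enorm_sub_le_enorm_sub_add _ _ _
      _ = 2 ^ u * (‖a - β‖ₑ ^ u + ballAvg r (fun z => ‖b z - β‖ₑ ^ u) x) := by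
          rw [ballAvg_const_mul _ (((hdist β).pow_const u).const_add _),
            ballAvg_add aemeasurable_const, ballAvg_const hr]
      _ ≤ _ := by gcongr
  have h4 : ballAvg r (fun z => ‖a - b z‖ₑ ^ u) x ^ (1 / u) ≤
      2 * 2 ^ (1 / u) * (1 + 2 * A) * (‖a - b x‖ₑ + oscAvg r b x) := by
    calc _ ≤ (2 ^ u * (‖a - β‖ₑ ^ u + C)) ^ (1 / u) := by gcongr
      _ = 2 * (‖a - β‖ₑ ^ u + C) ^ (1 / u) := by
          rw [ENNReal.mul_rpow_of_nonneg _ _ (by positivity), ← ENNReal.rpow_mul,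
            mul_one_div_cancel hu0.ne', ENNReal.rpow_one]
      _ ≤ 2 * (2 ^ (1 / u) * (‖a - β‖ₑ + A)) := by
          gcongr
          refine (add_rpow_le_two_rpow_mul _ _ (by positivity)).trans (le_of_eq ?_)
          rw [← ENNReal.rpow_mul, mul_one_div_cancel hu0.ne', ENNReal.rpow_one]
      _ ≤ 2 * (2 ^ (1 / u) * ((1 + 2 * A) * (‖a - b x‖ₑ + oscAvg r b x))) := by
          gcongr
          calc ‖a - β‖ₑ + A ≤ ‖a - b x‖ₑ + (oscAvg r b x + A) + A := by gcongr
            _ = ‖a - b x‖ₑ + oscAvg r b x + 2 * A * 1 := by ring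
            _ ≤ ‖a - b x‖ₑ + oscAvg r b x + 2 * A * (‖a - b x‖ₑ + oscAvg r b x) := by
                gcongr
                exact (one_le_oscAvg r b x).trans le_add_self
            _ = _ := by ring
      _ = _ := by ring
  have h5 := ballAvg_mul_le (r := r) hconj.symm ((hdist' a).pow_const θ) (hF.pow_const θ) x
  simp only [← ENNReal.rpow_mul, mul_div_cancel₀ τ hθ0.ne', ← hu] at h5
  unfold lpAvg
  simp only [ENNReal.mul_rpow_of_nonneg _ _ hθ0.le]
  calc _ ≤ (ballAvg r (fun z => ‖a - b z‖ₑ ^ u) x ^ (1 / p') *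
        ballAvg r (fun z => F z ^ τ) x ^ (1 / (τ / θ))) ^ (1 / θ) := by gcongr
    _ = ballAvg r (fun z => ‖a - b z‖ₑ ^ u) x ^ (1 / u) *
        ballAvg r (fun z => F z ^ τ) x ^ (1 / τ) := by
        rw [ENNReal.mul_rpow_of_nonneg _ _ (by positivity), ← ENNReal.rpow_mul,
          ← ENNReal.rpow_mul]
        have : 0 < τ := by linarith
        congr 2
        · rw [hu]; field_simp
        · field_simp
    _ ≤ _ := by gcongr

/-- For fixed scalars a, the domination of T and Hölder's inequality bound the polynomial `commPoly`
at almost every x whose values b_j(x) are within distance 1 of a_j. This holds off one null set for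
all a in a countable dense set, and continuity of the polynomial in a allows a to tend to b(x). -/
theorem exists_enorm_commOn_le {γ θ : ℝ} (hθ : 1 ≤ θ) {P τ : Fin m → ℝ} (hτ : ∀ j, θ < τ j)
    {ω : Fin m → Rn n → ℝ} {T : (Fin m → Rn n → 𝕜) → Rn n → 𝕜} (hT : IsMultilinearOp P ω T)
    {C : ℝ≥0∞} (hC : C < ∞)
    (hdom : ∀ f : Fin m → Rn n → 𝕜, MemProdLp P ω f → (∃ R : ℝ, ∀ j z, f j z ≠ 0 → ‖z‖ ≤ R) →
      ∀ t : ℝ, 0 < t → ∀ᵐ x, ‖T f x‖ₑ ≤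
        C * ∑' K : ℤ, fracTerm γ (fun _ => θ) (t * 2 ^ K) (fun j z => ‖f j z‖ₑ) x)
    {b : Fin m → Rn n → 𝕜} (hbm : ∀ j, AEStronglyMeasurable (b j) volume)
    (hb : ∀ j, HasOscMoments (b j)) (hbP : AdmissibleMul P ω b) :
    ∃ C : ℝ≥0∞, C < ∞ ∧ ∀ (J : Finset (Fin m)) (f : Fin m → Rn n → 𝕜),
      (∀ j, f j ∈ boundedFun n 𝕜) → ∀ t : ℝ, 0 < t → ∀ᵐ x, ‖commOn b T J f x‖ₑ ≤
        C * fracSum γ τ b t (fun j z => ‖f j z‖ₑ) x := by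
  choose D hD hD1 h using fun j => lpAvg_mul_sub_le hθ (hτ j) (hbm j) (hb j)
  refine ⟨C * ∏ j, (2 * D j), ENNReal.mul_lt_top hC (ENNReal.prod_lt_top fun j _ =>
    ENNReal.mul_lt_top (by simp) (hD j)), fun J f hf t ht => ?_⟩
  have hθ0 : 0 < θ := by linarith
  set F : Fin m → Rn n → ℝ≥0∞ := fun j z => ‖f j z‖ₑ with hF
  have hFm : ∀ j, AEMeasurable (F j) volume := fun j => (hf j).1.enorm
  set B : Rn n → ℝ≥0∞ := fun x => C * (∏ j, (2 * D j)) * fracSum γ τ b t F x with hB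
  set G : (Fin m → 𝕜) → Fin m → Rn n → 𝕜 := fun a =>
    J.piecewise (fun j z => (a j - b j z) * f j z) f with hG
  have hGm : ∀ a, MemProdLp P ω (G a) := by
    intro a
    refine memProdLp_piecewise (fun j => ?_) (fun j => (hbP j _ (hf j)).1) J
    have := ((hbP j _ (hf j)).1.const_smul (a j)).sub (hbP j _ (hf j)).2
    refine this.ae_eq (Eventually.of_forall fun z => ?_)
    simp only [Pi.sub_apply, Pi.smul_apply, smul_eq_mul]
    ring
  have hGs : ∀ a, ∃ R : ℝ, ∀ j z, G a j z ≠ 0 → ‖z‖ ≤ R := by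
    intro a
    choose R hR using fun j => (hf j).2.1
    refine ⟨∑ j, |R j|, fun j z hz => ?_⟩
    have hz' : f j z ≠ 0 := by
      intro h0
      refine hz ?_
      by_cases hj : j ∈ J <;> simp [hG, hj, h0]
    exact (hR j z hz').trans ((le_abs_self _).trans
      (Finset.single_le_sum (f := fun j => |R j|) (fun _ _ => abs_nonneg _) (Finset.mem_univ j)))
  have hterm : ∀ (a : Fin m → 𝕜) (x : Rn n), a ∈ Metric.ball (fun j => b j x) 1 → ∀ r : ℝ, 0 < r →
      fracTerm γ (fun _ => θ) r (fun j z => ‖G a j z‖ₑ) x ≤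
        (∏ j, (2 * D j)) * (oscProd b r x * fracTerm γ τ r F x) := by
    intro a x ha r hr
    have hj : ∀ j, lpAvg θ r (fun z => ‖G a j z‖ₑ) x ≤
        2 * D j * (oscAvg r (b j) x * lpAvg (τ j) r (F j) x) := by
      intro j
      by_cases hj : j ∈ J
      · have h1 : ‖a j - b j x‖ₑ ≤ oscAvg r (b j) x := by
          refine le_trans ?_ (one_le_oscAvg r (b j) x)
          have h2 : ‖a j - b j x‖ ≤ 1 := by
            rw [← dist_eq_norm]
            exact (dist_le_pi_dist a (fun j => b j x) j).trans (Metric.mem_ball.1 ha).le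
          rw [← ofReal_norm]
          exact ENNReal.ofReal_le_one.2 h2
        have h3 := h j (a j) (F j) (hFm j) r x hr
        simp only [hG, hj, Finset.piecewise_eq_of_mem, enorm_mul]
        refine h3.trans ?_
        calc _ ≤ D j * (oscAvg r (b j) x + oscAvg r (b j) x) * lpAvg (τ j) r (F j) x := by gcongr
          _ = _ := by ring
      · simp only [hG, hj, not_false_eq_true, Finset.piecewise_eq_of_notMem]
        calc _ ≤ 1 * 1 * (1 * lpAvg (τ j) r (F j) x) := by
              rw [one_mul, one_mul, one_mul]
              exact lpAvg_le_lpAvg hθ0 (hτ j).le hr (hFm j) x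
          _ ≤ _ := by
              gcongr
              · norm_num
              · exact hD1 j
              · exact one_le_oscAvg r (b j) x
    calc _ ≤ ENNReal.ofReal r ^ γ *
          ∏ j, (2 * D j * (oscAvg r (b j) x * lpAvg (τ j) r (F j) x)) :=
          mul_le_mul_right (Finset.prod_le_prod' fun j _ => hj j) _
      _ = _ := by
          rw [Finset.prod_mul_distrib,
            Finset.prod_mul_distrib (f := fun j => oscAvg r (b j) x), fracTerm, oscProd]
          ring
  -- Countably many scalar tuples, so that their exceptional sets have a null union.
  set a := TopologicalSpace.denseSeq (Fin m → 𝕜) with ha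
  have hall : ∀ᵐ x, ∀ i, T (G (a i)) x = commPoly b T J f (a i) x ∧ ‖T (G (a i)) x‖ₑ ≤
        C * ∑' K : ℤ, fracTerm γ (fun _ => θ) (t * 2 ^ K) (fun j z => ‖G (a i) j z‖ₑ) x :=
    ae_all_iff.2 fun i => (hT.commPoly_eq hbP hf J (a i)).and
      (hdom _ (hGm (a i)) (hGs (a i)) t ht)
  filter_upwards [hall] with x hx
  have hcont : Continuous fun c : Fin m → 𝕜 => ‖commPoly b T J f c x‖ₑ := by
    unfold commPoly
    fun_prop
  have hclosed : IsClosed {c : Fin m → 𝕜 | ‖commPoly b T J f c x‖ₑ ≤ B x} :=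
    isClosed_le hcont continuous_const
  have hmem : (fun j => b j x) ∈ closure (Metric.ball (fun j => b j x) 1 ∩ Set.range a) :=
    (TopologicalSpace.denseRange_denseSeq (Fin m → 𝕜)).open_subset_closure_inter
      Metric.isOpen_ball (Metric.mem_ball_self one_pos)
  refine closure_minimal ?_ hclosed hmem
  rintro _ ⟨hc, i, rfl⟩
  change ‖commPoly b T J f (a i) x‖ₑ ≤ B x
  rw [← (hx i).1]
  refine (hx i).2.trans ?_
  simp only [hB, fracSum]
  rw [mul_assoc]
  refine mul_le_mul_right ?_ _
  rw [← ENNReal.tsum_mul_left]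
  exact ENNReal.tsum_le_tsum fun K => hterm _ _ hc _ (by positivity)

end Commutators


/-! ### Operators dominated by `fracSum` -/

section Dominated

variable {n m : ℕ} {𝕜 : Type*} [RCLike 𝕜]

theorem fracSum_mono {γ : ℝ} {τ : Fin m → ℝ} (hτ : ∀ j, 0 < τ j) (b : Fin m → Rn n → 𝕜) (t : ℝ)
    {F G : Fin m → Rn n → ℝ≥0∞} (h : ∀ j z, F j z ≤ G j z) (x : Rn n) :
    fracSum γ τ b t F x ≤ fracSum γ τ b t G x :=
  ENNReal.tsum_le_tsum fun _ => mul_le_mul_right (fracTerm_mono hτ fun j z _ => h j z) _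

theorem fracSum_congr_ae (γ : ℝ) (τ : Fin m → ℝ) {b b' : Fin m → Rn n → 𝕜} (t : ℝ)
    {F F' : Fin m → Rn n → ℝ≥0∞} (hb : ∀ j, b j =ᵐ[volume] b' j) (hF : ∀ j, F j =ᵐ[volume] F' j)
    {x : Rn n} (hx : ∀ j, b j x = b' j x) :
    fracSum γ τ b t F x = fracSum γ τ b' t F' x := by
  have h1 : ∀ j r, oscAvg r (b j) x = oscAvg r (b' j) x := fun j r => by
    rw [oscAvg, oscAvg, hx j]
    congr 1
    refine ballAvg_congr_ae ?_ x
    filter_upwards [hb j] with z hz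
    rw [hz]
  have h2 : ∀ j r, lpAvg (τ j) r (F j) x = lpAvg (τ j) r (F' j) x := fun j r => by
    rw [lpAvg, lpAvg]
    congr 1
    refine ballAvg_congr_ae ?_ x
    filter_upwards [hF j] with z hz
    rw [hz]
  simp only [fracSum, oscProd, fracTerm, h1, h2]

theorem HasOscMoments.congr_ae {b b' : Rn n → 𝕜} (hb : HasOscMoments b)
    (h : b =ᵐ[volume] b') : HasOscMoments b' := by
  intro u hu
  obtain ⟨C, hC, hCb⟩ := hb u hu
  refine ⟨C, hC, fun y r hr => ?_⟩
  obtain ⟨β, hβ⟩ := hCb y r hr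
  refine ⟨β, le_of_eq_of_le (ballAvg_congr_ae ?_ y) hβ⟩
  filter_upwards [h] with z hz
  rw [hz]

/-- An operator that, on bounded functions of bounded support, is additive in every entry and
dominated by `fracSum`. -/
structure IsDominated (γ : ℝ) (τ : Fin m → ℝ) (b : Fin m → Rn n → 𝕜)
    (S : (Fin m → Rn n → 𝕜) → Rn n → 𝕜) : Prop where
  aestronglyMeasurable : ∀ f : Fin m → Rn n → 𝕜, (∀ j, f j ∈ boundedFun n 𝕜) →
    AEStronglyMeasurable (S f) volume
  eq_sum : ∀ f g : Fin m → Rn n → 𝕜, (∀ j, f j ∈ boundedFun n 𝕜) →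
    (∀ j, g j ∈ boundedFun n 𝕜) →
    ∀ᵐ x, S f x = ∑ σ : Finset (Fin m), S (σ.piecewise (f - g) g) x
  bound : ∃ C : ℝ≥0∞, C < ∞ ∧ ∀ f : Fin m → Rn n → 𝕜, (∀ j, f j ∈ boundedFun n 𝕜) →
    ∀ t : ℝ, 0 < t → ∀ᵐ x, ‖S f x‖ₑ ≤ C * fracSum γ τ b t (fun j z => ‖f j z‖ₑ) x

theorem IsDominated.sum {ι : Type*} [Fintype ι] {γ : ℝ} {τ : Fin m → ℝ} {b : Fin m → Rn n → 𝕜}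
    {S : ι → (Fin m → Rn n → 𝕜) → Rn n → 𝕜} (hS : ∀ i, IsDominated γ τ b (S i)) :
    IsDominated γ τ b (fun f x => ∑ i, S i f x) where
  aestronglyMeasurable f hf :=
    Finset.aestronglyMeasurable_fun_sum _ fun i _ => (hS i).aestronglyMeasurable f hf
  eq_sum f g hf hg := by
    filter_upwards [ae_all_iff.2 fun i => (hS i).eq_sum f g hf hg] with x hx
    rw [Finset.sum_comm]
    exact Finset.sum_congr rfl fun i _ => hx i
  bound := by
    choose C hC h using fun i => (hS i).bound
    refine ⟨∑ i, C i, ENNReal.sum_lt_top.2 fun i _ => hC i, fun f hf t ht => ?_⟩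
    filter_upwards [ae_all_iff.2 fun i => h i f hf t ht] with x hx
    rw [Finset.sum_mul]
    exact (enorm_sum_le _ _).trans (Finset.sum_le_sum fun i _ => hx i)

/-- The commutator is formed with the given b, but the dominating operator with a version b',
because its measurability requires Borel measurable symbols. The two agree at almost every x, and
averages do not see the difference. -/
theorem isDominated_commOn {γ θ : ℝ} (hθ : 1 ≤ θ) {P τ : Fin m → ℝ} (hτ : ∀ j, θ < τ j) {q : ℝ}
    {ω : Fin m → Rn n → ℝ} (hω : volume ≪ weightMeasure fun x => prodWeight ω x ^ q)
    {T : (Fin m → Rn n → 𝕜) → Rn n → 𝕜} (hT : IsMultilinearOp P ω T) (hbdd : BoundedOnLp P q ω T)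
    (hdom : ∃ C : ℝ≥0∞, C < ∞ ∧ ∀ f : Fin m → Rn n → 𝕜, MemProdLp P ω f →
      (∃ R : ℝ, ∀ j z, f j z ≠ 0 → ‖z‖ ≤ R) → ∀ t : ℝ, 0 < t → ∀ᵐ x, ‖T f x‖ₑ ≤
        C * ∑' K : ℤ, fracTerm γ (fun _ => θ) (t * 2 ^ K) (fun j z => ‖f j z‖ₑ) x)
    {b b' : Fin m → Rn n → 𝕜} (hbm : ∀ j, AEStronglyMeasurable (b j) volume)
    (hbb' : ∀ j, b j =ᵐ[volume] b' j)
    (hb : ∀ j, HasOscMoments (b j)) (hbP : AdmissibleMul P ω b) (J : Finset (Fin m)) :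
    IsDominated γ τ b' (commOn b T J) where
  aestronglyMeasurable f hf := by
    obtain ⟨_, _, h⟩ := hbdd
    unfold commOn commPoly
    refine Finset.aestronglyMeasurable_fun_sum _ fun s _ => AEStronglyMeasurable.mul
      (AEStronglyMeasurable.mul aestronglyMeasurable_const ?_)
      ((h _ (hbP.memProdLp_partialMul hf s)).1.1.mono_ac hω)
    exact Finset.aestronglyMeasurable_fun_prod _ fun i _ => hbm i
  eq_sum f g hf hg := by
    have hpm : ∀ (s σ : Finset (Fin m)), σ.piecewise (partialMul b s f - partialMul b s g)
        (partialMul b s g) = partialMul b s (σ.piecewise (f - g) g) := by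
      intro s σ
      funext j z
      by_cases hs : j ∈ s <;> by_cases hj : j ∈ σ <;> simp [partialMul, hs, hj, mul_sub]
    have h : ∀ᵐ x, ∀ s, T (partialMul b s f) x =
        ∑ σ : Finset (Fin m), T (partialMul b s (σ.piecewise (f - g) g)) x := by
      rw [ae_all_iff]
      intro s
      have h1 := hT.eq_sum_piecewise ((hbP.memProdLp_partialMul hf s).sub
        (hbP.memProdLp_partialMul hg s)) (hbP.memProdLp_partialMul hg s) Finset.univ
      simp only [Finset.piecewise_univ, sub_add_cancel, Finset.powerset_univ, hpm] at h1
      exact h1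
    filter_upwards [h] with x hx
    simp only [commOn, commPoly]
    rw [Finset.sum_comm]
    refine Finset.sum_congr rfl fun s _ => ?_
    rw [hx s, Finset.mul_sum]
  bound := by
    obtain ⟨C, hC, h⟩ := hdom
    obtain ⟨C', hC', h'⟩ := exists_enorm_commOn_le hθ hτ hT hC h hbm hb hbP
    refine ⟨C', hC', fun f hf t ht => ?_⟩
    filter_upwards [h' J f hf t ht, ae_all_iff.2 hbb'] with x hx hbx
    rwa [fracSum_congr_ae γ τ t hbb' (fun j => EventuallyEq.rfl) hbx] at hx

/-! ### Truncations -/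

theorem trunc_eq_indicator (N : ℕ) (f : Rn n → 𝕜) :
    trunc N f = {x | ‖x‖ ≤ N ∧ ‖f x‖ ≤ N}.indicator f := by
  funext x
  by_cases h : ‖x‖ ≤ N ∧ ‖f x‖ ≤ N <;> simp [trunc, h]

theorem trunc_mem_boundedFun (N : ℕ) {f : Rn n → 𝕜} (hf : AEStronglyMeasurable f volume) :
    trunc N f ∈ boundedFun n 𝕜 := by
  refine mem_boundedFun.2 ⟨?_, ⟨N, fun x hx => ?_⟩, N, fun x => ?_⟩
  · rw [trunc_eq_indicator]
    refine hf.indicator₀ (NullMeasurableSet.inter ?_ ?_)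
    · exact (measurableSet_le measurable_norm measurable_const).nullMeasurableSet
    · exact nullMeasurableSet_le hf.norm.aemeasurable aemeasurable_const
  · by_contra h
    exact hx (by simp [trunc, h])
  · by_cases h : ‖x‖ ≤ N ∧ ‖f x‖ ≤ N
    · simp [trunc, h]
    · simp [trunc, h]

theorem enorm_trunc_le (N : ℕ) (f : Rn n → 𝕜) (x : Rn n) : ‖trunc N f x‖ₑ ≤ ‖f x‖ₑ := by
  rw [trunc_eq_indicator]
  exact enorm_indicator_le_enorm_self _ _

theorem enorm_trunc_sub_trunc_le {N M : ℕ} (h : N ≤ M) (f : Rn n → 𝕜) (x : Rn n) :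
    ‖trunc M f x - trunc N f x‖ₑ ≤ ‖f x - trunc N f x‖ₑ := by
  have hNM : (N : ℝ) ≤ M := by exact_mod_cast h
  by_cases hx : ‖x‖ ≤ N ∧ ‖f x‖ ≤ N
  · have hx' : ‖x‖ ≤ M ∧ ‖f x‖ ≤ M := ⟨hx.1.trans hNM, hx.2.trans hNM⟩
    simp [trunc, hx, hx']
  · have : trunc N f x = 0 := by simp [trunc, hx]
    rw [this, sub_zero, sub_zero]
    exact enorm_trunc_le M f x

theorem eventually_trunc_eq (f : Rn n → 𝕜) (x : Rn n) : ∀ᶠ N : ℕ in atTop, trunc N f x = f x := by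
  obtain ⟨N, hN⟩ := exists_nat_ge (max ‖x‖ ‖f x‖)
  filter_upwards [eventually_ge_atTop N] with M hM
  have hNM : (N : ℝ) ≤ M := by exact_mod_cast hM
  have : ‖x‖ ≤ M ∧ ‖f x‖ ≤ M :=
    ⟨(le_max_left _ _).trans (hN.trans hNM), (le_max_right _ _).trans (hN.trans hNM)⟩
  simp [trunc, this]

/-! ### Finiteness almost everywhere -/

theorem ae_lt_top_of_eLpNorm_lt_top {α : Type*} [MeasurableSpace α] {μ : Measure α}
    {f : α → ℝ≥0∞} (hf : AEMeasurable f μ) {s : ℝ≥0∞} (hs : s ≠ 0) (h : eLpNorm f s μ < ∞) :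
    ∀ᵐ x ∂μ, f x < ∞ := by
  rcases eq_or_ne s ∞ with rfl | hst
  · rw [eLpNorm_exponent_top] at h
    filter_upwards [ae_le_eLpNormEssSup (f := f) (μ := μ)] with x hx
    exact lt_of_le_of_lt hx h
  · have hs' : 0 < s.toReal := ENNReal.toReal_pos hs hst
    have h1 := lintegral_rpow_enorm_lt_top_of_eLpNorm_lt_top hs hst h
    simp only [enorm_eq_self] at h1
    filter_upwards [ae_lt_top' (hf.pow_const _) h1.ne] with x hx
    exact (ENNReal.rpow_lt_top_iff_of_pos hs').1 hx

theorem ae_ballNorm_lt_top {P r e : ℝ} (hr : 0 < r) {F : Rn n → ℝ≥0∞} (hF : Measurable F)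
    {s : ℝ≥0∞} (hs : s ≠ 0)
    (h : eLpNorm (fun y => volume (Metric.ball y r) ^ e * ballNorm P r F y) s volume < ∞) :
    ∀ᵐ y, ballNorm P r F y < ∞ := by
  have hV : ∀ y : Rn n, volume (Metric.ball y r) = volume (Metric.ball (0 : Rn n) r) := fun y =>
    Measure.addHaar_ball_center _ _ _
  simp only [hV] at h
  filter_upwards [ae_lt_top_of_eLpNorm_lt_top
    (((measurable_ballNorm hF P r).const_mul _).aemeasurable) hs h] with y hy
  refine lt_top_iff_ne_top.2 fun h' => ?_
  rw [h', ENNReal.mul_top] at hy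
  · exact lt_irrefl _ hy
  · exact (ENNReal.rpow_pos (pos_iff_ne_zero.2 (volume_ball_pos _ hr))
      (volume_ball_ne_top _ _)).ne'

/-- Almost every centre is good, so the good centres are dense, and a good ball of radius |r| + 1
with centre within distance 1 of x contains the ball in question. -/
theorem setLIntegral_ball_lt_top {P : ℝ} (hP : 0 < P) {F : Rn n → ℝ≥0∞}
    (h : ∀ r : ℝ, 0 < r → ∀ᵐ y, ballNorm P r F y < ∞) (x : Rn n) (r : ℝ) :
    ∫⁻ z in Metric.ball x r, F z ^ P < ∞ := by
  have hr : 0 < |r| + 1 := by positivity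
  obtain ⟨y, hy, hyx⟩ := (Measure.dense_of_ae (h _ hr)).exists_mem_open Metric.isOpen_ball
    ⟨x, Metric.mem_ball_self (ε := 1) one_pos⟩
  rw [Set.mem_ofPred_eq, ballNorm, ENNReal.rpow_lt_top_iff_of_pos (one_div_pos.2 hP)] at hy
  refine lt_of_le_of_lt (lintegral_mono_set (Metric.ball_subset_ball' ?_)) hy
  rw [Metric.mem_ball, dist_comm] at hyx
  linarith [le_abs_self r]

theorem ae_lt_top_of_ae_ballNorm_lt_top {P : ℝ} (hP : 0 < P) {F : Rn n → ℝ≥0∞} (hF : Measurable F)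
    (h : ∀ᵐ y, ballNorm P 1 F y < ∞) : ∀ᵐ x, F x < ∞ := by
  rw [ae_iff]
  refine measure_null_of_locally_null _ fun x _ => ?_
  obtain ⟨y, hy, hyx⟩ := (Measure.dense_of_ae h).exists_mem_open Metric.isOpen_ball
    ⟨x, Metric.mem_ball_self (ε := 1) one_pos⟩
  rw [Set.mem_ofPred_eq, ballNorm, ENNReal.rpow_lt_top_iff_of_pos (one_div_pos.2 hP)] at hy
  refine ⟨{z | ¬F z < ∞} ∩ Metric.ball y 1, inter_mem self_mem_nhdsWithin
    (mem_nhdsWithin_of_mem_nhds (Metric.isOpen_ball.mem_nhds ?_)), ?_⟩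
  · rw [Metric.mem_ball, dist_comm]; exact hyx
  · have h1 := ae_lt_top' (hF.pow_const P).aemeasurable hy.ne
    have h2 : ∀ᵐ z ∂(volume.restrict (Metric.ball y 1)), F z < ∞ := by
      filter_upwards [h1] with z hz
      exact (ENNReal.rpow_lt_top_iff_of_pos hP).1 hz
    rw [ae_iff, Measure.restrict_apply' Metric.isOpen_ball.measurableSet] at h2
    exact h2

end Dominated


/-! ### Extension along truncations and the amalgam bound -/

section Extension

variable {n m : ℕ} {𝕜 : Type*} [RCLike 𝕜]

theorem tendsto_lpAvg_zero {τ r : ℝ} (hτ : 0 < τ) {F : Rn n → ℝ≥0∞} {x : Rn n}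
    (hF : ballAvg r (fun z => F z ^ τ) x < ∞) {G : ℕ → Rn n → ℝ≥0∞}
    (hGm : ∀ N, AEMeasurable (G N) volume) (hGF : ∀ N z, G N z ≤ F z)
    (hG : ∀ z, Tendsto (fun N => G N z) atTop (𝓝 0)) :
    Tendsto (fun N => lpAvg τ r (G N) x) atTop (𝓝 0) := by
  have h1 : Tendsto (fun N => ballAvg r (fun z => G N z ^ τ) x) atTop (𝓝 0) := by
    have := tendsto_lintegral_of_dominated_convergence' (μ := ballMeasure x r)
      (F := fun N z => G N z ^ τ) (f := fun _ => 0) (fun z => F z ^ τ)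
      (fun N => ((hGm N).pow_const τ).mono_ac (ballMeasure_absolutelyContinuous x r))
      (fun N => Eventually.of_forall fun z => ENNReal.rpow_le_rpow (hGF N z) hτ.le)
      hF.ne (Eventually.of_forall fun z => by
        have := (hG z).ennrpow_const τ
        rwa [ENNReal.zero_rpow_of_pos hτ] at this)
    rwa [lintegral_zero] at this
  have h2 := h1.ennrpow_const (1 / τ)
  rwa [ENNReal.zero_rpow_of_pos (by positivity)] at h2

/-- Dominated convergence twice: inside each average, with majorant F, and over the scales with
counting measure, where the finite value of `fracSum` for F is the majorant. It is enough that a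
single entry tends to 0. -/
theorem tendsto_fracSum_zero {γ : ℝ} (hγ : 0 < γ) {τ : Fin m → ℝ} (hτ : ∀ j, 0 < τ j)
    {b : Fin m → Rn n → 𝕜} {t : ℝ} (ht : 0 < t) {F : Fin m → Rn n → ℝ≥0∞} {x : Rn n}
    (hx : fracSum γ τ b t F x < ∞) (hF : ∀ j r, 0 < r → ballAvg r (fun z => F j z ^ τ j) x < ∞)
    {G : ℕ → Fin m → Rn n → ℝ≥0∞} (hGF : ∀ N j z, G N j z ≤ F j z) (j₀ : Fin m)
    (hGm : ∀ N, AEMeasurable (G N j₀) volume)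
    (hG : ∀ z, Tendsto (fun N => G N j₀ z) atTop (𝓝 0)) :
    Tendsto (fun N => fracSum γ τ b t (G N) x) atTop (𝓝 0) := by
  have hterm : ∀ r, 0 < r → Tendsto (fun N => fracTerm γ τ r (G N) x) atTop (𝓝 0) := by
    intro r hr
    have hfin : ∀ j, lpAvg (τ j) r (F j) x ≠ ∞ := fun j =>
      (ENNReal.rpow_lt_top_of_nonneg (one_div_pos.2 (hτ j)).le (hF j r hr).ne).ne
    set D := ENNReal.ofReal r ^ γ * ∏ j ∈ Finset.univ.erase j₀, lpAvg (τ j) r (F j) x with hD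
    have hDt : D ≠ ∞ := ENNReal.mul_ne_top
      (ENNReal.rpow_lt_top_of_nonneg hγ.le ENNReal.ofReal_ne_top).ne
      (ENNReal.prod_ne_top fun j _ => hfin j)
    have h0 := ENNReal.Tendsto.const_mul (a := D) (tendsto_lpAvg_zero (hτ j₀) (hF j₀ r hr) hGm
      (fun N z => hGF N j₀ z) hG) (Or.inr hDt)
    rw [mul_zero] at h0
    refine tendsto_of_tendsto_of_tendsto_of_le_of_le tendsto_const_nhds h0
      (fun _ => zero_le) fun N => ?_
    simp only [fracTerm, hD]
    rw [← Finset.prod_erase_mul _ _ (Finset.mem_univ j₀), ← mul_assoc]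
    gcongr with j
    exact lpAvg_mono (hτ j) fun z _ => hGF N j z
  have hle : ∀ N r, fracTerm γ τ r (G N) x ≤ fracTerm γ τ r F x := fun N r =>
    fracTerm_mono hτ fun j z _ => hGF N j z
  have hsumm : ∀ K : ℤ, Tendsto (fun N => oscProd b (t * 2 ^ K) x *
      fracTerm γ τ (t * 2 ^ K) (G N) x) atTop (𝓝 0) := by
    intro K
    -- An infinite oscillation is harmless: finiteness of the sum then forces the fractional average
    -- of F at that scale to vanish.
    by_cases hosc : oscProd b (t * 2 ^ K) x = ∞
    · have hF0 : fracTerm γ τ (t * 2 ^ K) F x = 0 := by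
        by_contra h0
        have h1 : oscProd b (t * 2 ^ K) x * fracTerm γ τ (t * 2 ^ K) F x < ∞ :=
          lt_of_le_of_lt (ENNReal.le_tsum K) hx
        rw [hosc, ENNReal.top_mul h0] at h1
        exact lt_irrefl _ h1
      have h0 : ∀ N, fracTerm γ τ (t * 2 ^ K) (G N) x = 0 := fun N =>
        nonpos_iff_eq_zero.1 ((hle N _).trans hF0.le)
      simp [h0]
    · simpa using ENNReal.Tendsto.const_mul (hterm (t * 2 ^ K) (by positivity)) (Or.inr hosc)
  have hdom := tendsto_lintegral_of_dominated_convergence (μ := (Measure.count : Measure ℤ))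
    (F := fun N K => oscProd b (t * 2 ^ K) x * fracTerm γ τ (t * 2 ^ K) (G N) x)
    (f := fun _ => 0) (fun K => oscProd b (t * 2 ^ K) x * fracTerm γ τ (t * 2 ^ K) F x)
    (fun N => measurable_from_top)
    (fun N => Eventually.of_forall fun K => mul_le_mul_right (hle N _) _)
    (by rw [lintegral_count]; exact hx.ne) (Eventually.of_forall hsumm)
  simp only [lintegral_count, tsum_zero] at hdom
  exact hdom

theorem amalgamNormAt_eq {P : ℝ} (hP : 0 < P) (s : ℝ≥0∞) (α r : ℝ) (f : Rn n → 𝕜) :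
    amalgamNormAt P s α r f = eLpNorm (fun y => volume (Metric.ball y r) ^
      (1 / α - 1 / P - s⁻¹.toReal) * ballNorm P r (fun z => ‖f z‖ₑ) y) s volume := by
  unfold amalgamNormAt ballNorm
  simp only [eLpNorm_indicator_eq_eLpNorm_restrict Metric.isOpen_ball.measurableSet,
    eLpNorm_ofReal_eq hP]

theorem ballNorm_mono_ae {P : ℝ} (hP : 0 < P) (r : ℝ) {F G : Rn n → ℝ≥0∞}
    (h : ∀ᵐ z, F z ≤ G z) (y : Rn n) : ballNorm P r F y ≤ ballNorm P r G y := by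
  refine ENNReal.rpow_le_rpow (lintegral_mono_ae (ae_restrict_of_ae ?_)) (by positivity)
  filter_upwards [h] with z hz
  exact ENNReal.rpow_le_rpow hz hP.le

theorem ballNorm_const_mul {P : ℝ} (hP : 0 < P) (r : ℝ) (c : ℝ≥0∞) {F : Rn n → ℝ≥0∞}
    (hF : Measurable F) (y : Rn n) :
    ballNorm P r (fun z => c * F z) y = c * ballNorm P r F y := by
  unfold ballNorm
  simp only [ENNReal.mul_rpow_of_nonneg _ _ hP.le]
  rw [lintegral_const_mul _ (hF.pow_const P), ENNReal.mul_rpow_of_nonneg _ _ (by positivity),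
    ← ENNReal.rpow_mul, mul_one_div_cancel hP.ne', ENNReal.rpow_one]

/-- The extension of a dominated operator along truncations. -/
theorem IsDominated.exists_limit {γ : ℝ} (hγ : 0 < γ) {τ : Fin m → ℝ} (hτ : ∀ j, 0 < τ j)
    {b : Fin m → Rn n → 𝕜} {S : (Fin m → Rn n → 𝕜) → Rn n → 𝕜} (hS : IsDominated γ τ b S)
    {C : ℝ≥0∞} (hC : C < ∞)
    (hbound : ∀ f : Fin m → Rn n → 𝕜, (∀ j, f j ∈ boundedFun n 𝕜) → ∀ t : ℝ, 0 < t →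
      ∀ᵐ x, ‖S f x‖ₑ ≤ C * fracSum γ τ b t (fun j z => ‖f j z‖ₑ) x)
    {f : Fin m → Rn n → 𝕜} (hf : ∀ j, AEStronglyMeasurable (f j) volume)
    (hfin : ∀ᵐ x, fracSum γ τ b 1 (fun j z => ‖f j z‖ₑ) x < ∞)
    (hloc : ∀ j x r, 0 < r → ballAvg r (fun z => ‖f j z‖ₑ ^ τ j) x < ∞) :
    ∃ g : Rn n → 𝕜, HasValue S f g ∧ AEStronglyMeasurable g volume ∧
      ∀ t : ℝ, 0 < t → ∀ᵐ x, ‖g x‖ₑ ≤ C * fracSum γ τ b t (fun j z => ‖f j z‖ₑ) x := by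
  set F : Fin m → Rn n → ℝ≥0∞ := fun j z => ‖f j z‖ₑ with hF
  set u : ℕ → Fin m → Rn n → 𝕜 := fun N j => trunc N (f j) with hu
  have hub : ∀ N j, u N j ∈ boundedFun n 𝕜 := fun N j => trunc_mem_boundedFun N (hf j)
  set V : ℕ → Fin m → Rn n → ℝ≥0∞ := fun N j z => ‖f j z - u N j z‖ₑ with hV
  have hVm : ∀ N j, AEMeasurable (V N j) volume := fun N j => ((hf j).sub (hub N j).1).enorm
  have hVF : ∀ N j z, V N j z ≤ F j z := by
    intro N j z
    simp only [hV, hu, hF]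
    by_cases h : ‖z‖ ≤ N ∧ ‖f j z‖ ≤ N <;> simp [trunc, h]
  have hV0 : ∀ j z, Tendsto (fun N => V N j z) atTop (𝓝 0) := by
    intro j z
    refine tendsto_const_nhds.congr' ?_
    filter_upwards [eventually_trunc_eq (f j) z] with N hN
    simp [hV, hu, hN]
  -- Bounds S(u_M) - S(u_N) for all M ≥ N at once: the entries in σ are dominated by f minus its
  -- N-th truncation, the others by f. The empty σ is the subtracted term, so every remaining σ has
  -- an entry that tends to 0.
  set E : ℕ → Rn n → ℝ≥0∞ := fun N x => ∑ σ ∈ Finset.univ.erase (∅ : Finset (Fin m)),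
    C * fracSum γ τ b 1 (σ.piecewise (V N) F) x with hE
  have hdiff : ∀ᵐ x, ∀ N M : ℕ, N ≤ M → ‖S (u M) x - S (u N) x‖ₑ ≤ E N x := by
    rw [ae_all_iff]; intro N
    rw [ae_all_iff]; intro M
    by_cases hNM : N ≤ M
    swap
    · exact Eventually.of_forall fun x h => absurd h hNM
    have hpw : ∀ σ : Finset (Fin m), ∀ j, σ.piecewise (u M - u N) (u N) j ∈ boundedFun n 𝕜 := by
      intro σ j
      by_cases hj : j ∈ σ
      · simpa [hj] using (boundedFun n 𝕜).sub_mem (hub M j) (hub N j)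
      · simpa [hj] using hub N j
    filter_upwards [hS.eq_sum (u M) (u N) (hub M) (hub N),
      ae_all_iff.2 fun σ => hbound _ (hpw σ) 1 one_pos] with x hx hσ _
    rw [hx, ← Finset.sum_erase_add _ _ (Finset.mem_univ ∅), Finset.piecewise_empty,
      add_sub_cancel_right]
    refine (enorm_sum_le _ _).trans (Finset.sum_le_sum fun σ _ => (hσ σ).trans ?_)
    refine mul_le_mul_right (fracSum_mono hτ b 1 (fun j z => ?_) x) _
    by_cases hj : j ∈ σ
    · simpa [hj, hV] using enorm_trunc_sub_trunc_le hNM (f j) z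
    · simpa [hj, hF] using enorm_trunc_le N (f j) z
  have hE0 : ∀ᵐ x, Tendsto (fun N => E N x) atTop (𝓝 0) := by
    filter_upwards [hfin] with x hx
    rw [← Finset.sum_const_zero (s := Finset.univ.erase (∅ : Finset (Fin m)))]
    refine tendsto_finsetSum _ fun σ hσ => ?_
    obtain ⟨j₀, hj₀⟩ := Finset.nonempty_iff_ne_empty.2 (Finset.ne_of_mem_erase hσ)
    have h1 := tendsto_fracSum_zero hγ hτ one_pos hx (fun j r => hloc j x r)
      (G := fun N => σ.piecewise (V N) F) (fun N j z => by
        by_cases hj : j ∈ σ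
        · simpa [hj] using hVF N j z
        · simp [hj]) j₀ (fun N => by simpa [hj₀] using hVm N j₀)
      (fun z => by simpa [hj₀] using hV0 j₀ z)
    simpa using ENNReal.Tendsto.const_mul h1 (Or.inr hC.ne)
  have hcauchy : ∀ᵐ x, CauchySeq fun N => S (u N) x := by
    filter_upwards [hdiff, hE0] with x hx hx0
    rw [EMetric.cauchySeq_iff_le_tendsto_0]
    refine ⟨fun N => 2 * E N x, fun k l N hk hl => ?_, ?_⟩
    · simp only [two_mul]
      refine (edist_triangle_right _ _ (S (u N) x)).trans (add_le_add ?_ ?_)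
      · rw [edist_eq_enorm_sub]; exact hx N k hk
      · rw [edist_eq_enorm_sub]; exact hx N l hl
    · simpa using ENNReal.Tendsto.const_mul hx0 (Or.inr (by simp : (2 : ℝ≥0∞) ≠ ∞))
  set g : Rn n → 𝕜 := fun x => limUnder atTop fun N => S (u N) x with hg
  have hlim : ∀ᵐ x, Tendsto (fun N => S (u N) x) atTop (𝓝 (g x)) := by
    filter_upwards [hcauchy] with x hx
    exact CauchySeq.tendsto_limUnder hx
  refine ⟨g, hlim, aestronglyMeasurable_of_tendsto_ae atTop
    (fun N => hS.aestronglyMeasurable _ (hub N)) hlim, fun t ht => ?_⟩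
  filter_upwards [hlim, ae_all_iff.2 fun N => hbound (u N) (hub N) t ht] with x hx hb
  refine le_of_tendsto' hx.enorm fun N => (hb N).trans ?_
  exact mul_le_mul_right (fracSum_mono hτ b t (fun j z => enorm_trunc_le N (f j) z) x) _

/-- The domination holds for every starting scale t with the same constant, so the norm at scale r
can be estimated with t = r; this makes the bound uniform in r. The scale t = 1 alone supplies the
finiteness almost everywhere that is needed for the limit to exist. -/
theorem IsDominated.boundedOnAmalgam {γ p q αs : ℝ} {τ P αj : Fin m → ℝ} (hn : 0 < n)
    (hm : 0 < m) (hγ : 0 < γ) (hp0 : 0 < p) (hq0 : 0 < q)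
    (hτ : ∀ j, 0 < τ j) (hτP : ∀ j, τ j < P j) (hp : 1 / p = ∑ j, 1 / P j)
    (hq : 1 / q = 1 / p - γ / n) {b : Fin m → Rn n → 𝕜}
    (hbm : ∀ j, Measurable (b j)) (hb : ∀ j, HasOscMoments (b j))
    (hαs0 : 0 < αs) (hαs : 1 / αs = ∑ j, 1 / αj j - γ / n) {s : ℝ≥0∞} {sj : Fin m → ℝ≥0∞}
    (hαss : ENNReal.ofReal αs < s) {w : Fin m → ℝ}
    (hw : ∀ j, 0 < w j) (hw1 : ∑ j, w j = 1)
    (hsj : ∀ j, (sj j)⁻¹ = ENNReal.ofReal (w j) * s⁻¹)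
    {S : (Fin m → Rn n → 𝕜) → Rn n → 𝕜} (hS : IsDominated γ τ b S) :
    BoundedOnAmalgam P sj αj q s αs S := by
  have hP : ∀ j, 0 < P j := fun j => (hτ j).trans (hτP j)
  have hs0 : s ≠ 0 := (bot_le.trans_lt hαss).ne'
  have hsj0 : ∀ j, sj j ≠ 0 := by
    intro j h0
    have h1 := hsj j
    rw [h0, ENNReal.inv_zero] at h1
    exact ENNReal.mul_ne_top ENNReal.ofReal_ne_top (ENNReal.inv_ne_top.2 hs0) h1.symm
  obtain ⟨C, hC, hbound⟩ := hS.bound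
  obtain ⟨D, hD, hR⟩ := eLpNorm_ballNorm_fracSum_le hn hm hγ hp0 hq0 hτ hτP hp hq hbm hb hαs0 hαs
    hαss hw hw1 hsj
  refine ⟨C * D, ENNReal.mul_lt_top hC hD, fun f hf => ?_⟩
  set F' : Fin m → Rn n → ℝ≥0∞ := fun j => (hf j).1.enorm.mk with hF'
  have hF'm : ∀ j, Measurable (F' j) := fun j => (hf j).1.enorm.measurable_mk
  have hFF' : ∀ j, (fun z => ‖f j z‖ₑ) =ᵐ[volume] F' j := fun j => (hf j).1.enorm.ae_eq_mk
  have hfs : ∀ t x, fracSum γ τ b t (fun j z => ‖f j z‖ₑ) x = fracSum γ τ b t F' x := fun t x =>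
    fracSum_congr_ae γ τ t (fun j => EventuallyEq.rfl) hFF' fun j => rfl
  set A : Fin m → ℝ≥0∞ := fun j => amalgamNorm (P j) (sj j) (αj j) (f j) with hA
  have hFA : ∀ j, ∀ ρ : ℝ, 0 < ρ →
      eLpNorm (fun y => volume (Metric.ball y ρ) ^ (1 / αj j - 1 / P j - (sj j)⁻¹.toReal) *
        ballNorm (P j) ρ (F' j) y) (sj j) volume ≤ A j := by
    intro j ρ hρ
    have h1 : ballNorm (P j) ρ (F' j) = ballNorm (P j) ρ (fun z => ‖f j z‖ₑ) := by
      funext y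
      exact le_antisymm (ballNorm_mono_ae (hP j) ρ (hFF' j).symm.le y)
        (ballNorm_mono_ae (hP j) ρ (hFF' j).le y)
    rw [h1, ← amalgamNormAt_eq (hP j)]
    exact le_iSup₂ (f := fun (r : ℝ) (_ : 0 < r) => amalgamNormAt (P j) (sj j) (αj j) r (f j)) ρ hρ
  have hprod : ∏ j, A j < ∞ := ENNReal.prod_lt_top fun j _ => (hf j).2
  have hRF := hR F' hF'm A hFA
  have hfin : ∀ᵐ x, fracSum γ τ b 1 (fun j z => ‖f j z‖ₑ) x < ∞ := by
    simp only [hfs]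
    have hm1 := measurable_fracSum γ τ hbm 1 hF'm
    exact ae_lt_top_of_ae_ballNorm_lt_top hq0 hm1 (ae_ballNorm_lt_top one_pos hm1 hs0
      (lt_of_le_of_lt (hRF 1 one_pos) (ENNReal.mul_lt_top hD hprod)))
  have hloc : ∀ j x r, 0 < r → ballAvg r (fun z => ‖f j z‖ₑ ^ τ j) x < ∞ := by
    intro j x r hr
    have h1 : (fun z => ‖f j z‖ₑ ^ τ j) =ᵐ[volume] fun z => F' j z ^ τ j := by
      filter_upwards [hFF' j] with z hz
      rw [hz]
    have h2 := setLIntegral_ball_lt_top (hP j) (fun ρ hρ => ae_ballNorm_lt_top hρ (hF'm j)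
      (hsj0 j) (lt_of_le_of_lt (hFA j ρ hρ) (hf j).2)) x r
    have h3 : lpAvg (P j) r (F' j) x < ∞ := by
      rw [lpAvg, ballAvg_eq]
      exact ENNReal.rpow_lt_top_of_nonneg (one_div_pos.2 (hP j)).le
        (ENNReal.div_lt_top h2.ne (volume_ball_pos x hr)).ne
    have h4 := lt_of_le_of_lt
      (lpAvg_le_lpAvg (hτ j) (hτP j).le hr (hF'm j).aemeasurable x) h3
    rw [ballAvg_congr_ae h1]
    exact (ENNReal.rpow_lt_top_iff_of_pos (one_div_pos.2 (hτ j))).1 h4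
  obtain ⟨g, hg, hgm, hgb⟩ := hS.exists_limit hγ hτ hC hbound (fun j => (hf j).1) hfin hloc
  have hnorm : amalgamNorm q s αs g ≤ C * D * ∏ j, A j := by
    refine iSup₂_le fun r hr => ?_
    have hV : ∀ y : Rn n, volume (Metric.ball y r) = volume (Metric.ball (0 : Rn n) r) := fun y =>
      Measure.addHaar_ball_center _ _ _
    have hmr := measurable_fracSum γ τ hbm r hF'm
    rw [amalgamNormAt_eq hq0]
    calc _ ≤ eLpNorm (fun y => C * (volume (Metric.ball y r) ^ (1 / αs - 1 / q - s⁻¹.toReal) *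
          ballNorm q r (fracSum γ τ b r F') y)) s volume := by
          refine eLpNorm_mono_enorm fun y => ?_
          rw [enorm_eq_self, enorm_eq_self, mul_left_comm, ← ballNorm_const_mul hq0 r C hmr]
          gcongr
          refine ballNorm_mono_ae hq0 r ?_ y
          simpa only [hfs] using hgb r hr
      _ = C * eLpNorm (fun y => volume (Metric.ball y r) ^ (1 / αs - 1 / q - s⁻¹.toReal) *
          ballNorm q r (fracSum γ τ b r F') y) s volume := by
          refine eLpNorm_const_mul_ennreal ?_ C s
          simp only [hV]
          exact (measurable_ballNorm hmr q r).const_mul _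
      _ ≤ C * (D * ∏ j, A j) := by
          gcongr
          exact hRF r hr
      _ = _ := by ring
  exact ⟨g, hg, ⟨hgm, lt_of_le_of_lt hnorm (ENNReal.mul_lt_top (ENNReal.mul_lt_top hC hD) hprod)⟩,
    hnorm⟩

end Extension



end FracAmalgam

end

/-! ### The main theorem -/

theorem mainTheorem5 {𝕜 : Type*} [RCLike 𝕜] (n m : ℕ)
    (γ θ : ℝ) (hγ : 0 < γ) (hγ' : γ < m * n) (hθ : 1 ≤ θ)
    (pj αj qj : Fin m → ℝ) (sj : Fin m → ENNReal)
    (p q α αstar : ℝ) (s : ENNReal)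
    (hθp : ∀ j, θ < pj j) (hpα : ∀ j, pj j ≤ αj j)
    (hαs : ∀ j, ENNReal.ofReal (αj j) < sj j)
    (hqj : ∀ j, 0 < qj j) (hqj' : ∀ j, 1 / qj j = 1 / pj j - γ / (m * n))
    (hp : 1 / p = ∑ j, 1 / pj j)
    (hq : 1 / q = ∑ j, 1 / qj j)
    (hα : 1 / α = ∑ j, 1 / αj j)
    (hs : s⁻¹ = ∑ j, (sj j)⁻¹)
    (hαstar : 0 < αstar) (hαstar' : 1 / αstar = 1 / α - γ / n)
    (hαstars : ENNReal.ofReal αstar < s)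
    (hprop : ∀ j, α / αj j = p / pj j)
    (hprop' : ∀ j, (sj j)⁻¹ = ENNReal.ofReal (α / αj j) * s⁻¹)
    (ω : Fin m → FracAmalgam.Rn n → ℝ) (hω : ∀ j x, 0 ≤ ω j x)
    (hωA : FracAmalgam.MultiAPq (fun j => pj j / θ) (q / θ) (fun j x => ω j x ^ θ))
    (hωinf : ∀ j, FracAmalgam.MuckenhouptAInfty (fun x => ω j x ^ pj j))
    (T : (Fin m → FracAmalgam.Rn n → 𝕜) → FracAmalgam.Rn n → 𝕜)
    (hT : FracAmalgam.IsMultilinearOp pj ω T)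
    (hTsize : FracAmalgam.FracSizeCondition γ θ pj ω T)
    (hTbdd : FracAmalgam.BoundedOnLp pj q ω T)
    (b : Fin m → FracAmalgam.Rn n → 𝕜) (hb : ∀ j, FracAmalgam.IsBMO (b j)) :
    FracAmalgam.BoundedOnAmalgam pj sj αj q s αstar (FracAmalgam.sumComm b T) ∧
      FracAmalgam.BoundedOnAmalgam pj sj αj q s αstar (FracAmalgam.iterComm b T) := by
  have hθ0 : 0 < θ := by linarith
  have hP : ∀ j, 0 < pj j := fun j => hθ0.trans (hθp j)
  have hA : ∀ j, 0 < αj j := fun j => (hP j).trans_le (hpα j)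
  have hmn : (0 : ℝ) < m * n := hγ.trans hγ'
  have hm : 0 < m := Nat.pos_of_ne_zero fun h => by simp [h] at hmn
  have hn : 0 < n := Nat.pos_of_ne_zero fun h => by simp [h] at hmn
  have hm' : (0 : ℝ) < m := by exact_mod_cast hm
  have hn' : (0 : ℝ) < n := by exact_mod_cast hn
  have hne : (Finset.univ : Finset (Fin m)).Nonempty := ⟨⟨0, hm⟩, Finset.mem_univ _⟩
  have hα0 : 0 < α := one_div_pos.1 (hα ▸ Finset.sum_pos (fun j _ => one_div_pos.2 (hA j)) hne)
  have hp0 : 0 < p := one_div_pos.1 (hp ▸ Finset.sum_pos (fun j _ => one_div_pos.2 (hP j)) hne)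
  have hq0 : 0 < q := one_div_pos.1 (hq ▸ Finset.sum_pos (fun j _ => one_div_pos.2 (hqj j)) hne)
  have hq' : 1 / q = 1 / p - γ / n := by
    rw [hq, Finset.sum_congr rfl fun j _ => hqj' j, Finset.sum_sub_distrib, ← hp, Finset.sum_const,
      Finset.card_univ, Fintype.card_fin, nsmul_eq_mul]
    field_simp
  have hpq : p < q := by
    refine (one_div_lt_one_div hq0 hp0).1 ?_
    rw [hq']
    linarith [div_pos hγ hn']
  -- Positivity of q_j gives γ/(mn) < 1/p_j < 1/θ.
  have he : 0 ≤ 1 - γ * θ / (m * n : ℝ) := by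
    have h1 := hqj' ⟨0, hm⟩
    have h2 := one_div_pos.2 (hqj ⟨0, hm⟩)
    have h3 : γ / (m * n) < 1 / θ :=
      lt_trans (by linarith) (one_div_lt_one_div_of_lt hθ0 (hθp ⟨0, hm⟩))
    rw [lt_div_iff₀ hθ0] at h3
    rw [mul_div_right_comm]
    linarith
  have hwt : ∀ j, FracAmalgam.IsWeight (fun x => ω j x ^ pj j) := fun j => by
    obtain ⟨_, h⟩ := hωinf j
    exact h.1
  -- Measurability is available for the power ω_j^{p_j}; nonnegativity allows the root to be taken.
  have hωm : ∀ j, AEMeasurable (ω j) volume := fun j => by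
    have h1 : ω j = fun x => (ω j x ^ pj j) ^ (1 / pj j) := by
      funext x
      rw [← Real.rpow_mul (hω j x), mul_one_div_cancel (hP j).ne', Real.rpow_one]
    rw [h1]
    exact (hwt j).2.2.aestronglyMeasurable.aemeasurable.pow_const _
  have hac : (volume : Measure (FracAmalgam.Rn n)) ≪
      FracAmalgam.weightMeasure fun x => FracAmalgam.prodWeight ω x ^ q := by
    refine withDensity_absolutelyContinuous' ?_ ?_
    · exact (AEMeasurable.pow_const
        (Finset.aemeasurable_fun_prod _ fun j _ => hωm j) q).ennreal_ofReal
    · filter_upwards [ae_all_iff.2 fun j => (hwt j).2.1] with x hx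
      have h1 : 0 < FracAmalgam.prodWeight ω x := Finset.prod_pos fun j _ =>
        (hω j x).lt_of_ne fun h0 => by
          have h2 := hx j
          rw [← h0, Real.zero_rpow (hP j).ne'] at h2
          exact lt_irrefl _ h2
      exact (ENNReal.ofReal_pos.2 (Real.rpow_pos_of_pos h1 q)).ne'
  have hbP : FracAmalgam.AdmissibleMul pj ω b := fun j f hf =>
    ⟨(hwt j).memLp_of_mem_boundedFun hf _, (hωinf j).memLp_mul_of_mem_boundedFun (hb j) hf (hP j)⟩
  have hbm : ∀ j, AEStronglyMeasurable (b j) volume := fun j => (hb j).1.aestronglyMeasurable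
  have hbosc : ∀ j, FracAmalgam.HasOscMoments (b j) := fun j u hu =>
    (hb j).exists_ballAvg_rpow_le hu
  have hbb' : ∀ j, b j =ᵐ[volume] (hbm j).mk (b j) := fun j => (hbm j).ae_eq_mk
  have hbosc' : ∀ j, FracAmalgam.HasOscMoments ((hbm j).mk (b j)) := fun j =>
    (hbosc j).congr_ae (hbb' j)
  have hdom := FracAmalgam.exists_enorm_le_tsum_fracTerm hn hm hγ hγ' hθ0 he hP hp0 hpq hp hac hT
    hTsize hTbdd
  -- The midpoint τ_j leaves room on both sides: θ < τ_j for Hölder against the oscillations, τ_j <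
  -- p_j for the maximal theorem.
  have hτ : ∀ j, θ < (θ + pj j) / 2 := fun j => by linarith [hθp j]
  have hcomm := FracAmalgam.isDominated_commOn hθ hτ hac hT hTbdd hdom hbm hbb' hbosc hbP
  have key : ∀ {S},
      FracAmalgam.IsDominated γ (fun j => (θ + pj j) / 2) (fun j => (hbm j).mk (b j)) S →
      FracAmalgam.BoundedOnAmalgam pj sj αj q s αstar S := fun hS =>
    hS.boundedOnAmalgam hn hm hγ hp0 hq0 (fun j => hθ0.trans (hτ j))
      (fun j => by linarith [hθp j]) hp hq' (fun j => (hbm j).stronglyMeasurable_mk.measurable)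
      hbosc' hαstar (hα ▸ hαstar') hαstars (w := fun j => α / αj j)
      (fun j => div_pos hα0 (hA j)) (by
        simp only [div_eq_mul_one_div α]
        rw [← Finset.mul_sum, ← hα, mul_one_div_cancel hα0.ne']) hprop'
  refine ⟨key ?_, key ?_⟩
  · have h1 : FracAmalgam.sumComm b T = fun f x => ∑ j, FracAmalgam.commOn b T {j} f x := by
      funext f x
      exact Finset.sum_congr rfl fun j _ => by rw [FracAmalgam.commAt_eq_commOn]
    rw [h1]
    exact FracAmalgam.IsDominated.sum fun j => hcomm {j}
  · rw [FracAmalgam.iterComm_eq_commOn]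
    exact hcomm Finset.univ
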